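/- **Theorem 1.2.** Let $g$ be a real-valued $C^\infty$ function on an open neighbourhood of $0$ in $\mathbb C$, and write $g_1=\partial_z g$, $g_{1\bar1}=\partial_z\partial_{\bar z}g$. On $\mathbb C\times\mathbb R$, with coordinates $(z,t)$, consider the vector fields $L=\partial_z-ig_1(z)\partial_t$ and $\bar L=\partial_{\bar z}+i\overline{g_1(z)}\,\partial_t$. Assume that * $0$ is a point of infinite type: $g_{1\bar1}(z)=O(|z|^n)$ as $z\to0$, for every $n\in\mathbb N$; * $g$ is exponentially non-degenerate at $0$: $g_{1\bar1}(z)>0$ for all $z\neq0$ close to $0$, and for some real $\alpha\le1$ we have $|z|^\alpha\,|\log g_{1\bar1}(z)|\to0$ as $z\to0$, $z\ne 0$; * $|g_1|\le c\,g_{1\bar1}^{1/2}$ in a neighbourhood of $0$, for some constant $c$. Then there is a neighbourhood $U$ of $0$ in $\mathbb C\times\mathbb R$ such that for every $s\in\mathbb R$ and all real-valued cut-off functions $\zeta_0,\zeta_1\in C^\infty_c(U)$ with $\zeta_1\equiv1$ on $\operatorname{supp}\zeta_0$ there is a constant $C$ with $$\|\zeta_0u\|_s\le C\left(\|\zeta_1\bar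 Lu\|_s+\|\zeta_1\bar zLu\|_s+\|\bar zu\|_0\right)\qquad\text{for all } u\in C^\infty(\mathbb C\times\mathbb R).$$ Here $\|v\|_s=\|\Lambda^sv\|_{L^2}$, where $\Lambda^s$ is the Fourier multiplier with symbol $(1+|\xi|^2)^{s/2}$ on $\mathbb C\times\mathbb R\cong\mathbb R^3$, and $\|\cdot\|_0$ is the $L^2$ norm; the right-hand side may be $+\infty$. -/

import Mathlib

open MeasureTheory Filter Topology Asymptotics
open scoped ContDiff ENNReal NNReal FourierTransform ComplexConjugate

namespace LossDeriv

noncomputable section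

/-- The ambient space `ℂ × ℝ`, identified with Euclidean `ℝ³` through the coordinates
`(Re z, Im z, t)`. -/
abbrev R3 : Type := EuclideanSpace ℝ (Fin 3)

/-- The complex coordinate `z` of a point of `ℂ × ℝ`. -/
def zc (p : R3) : ℂ := ⟨p 0, p 1⟩

/-- The Wirtinger derivative `∂_z = (∂_x - i ∂_y) / 2` on `ℂ`. -/
def dz (f : ℂ → ℂ) (z : ℂ) : ℂ :=
  (1 / 2 : ℂ) * (fderiv ℝ f z 1 - Complex.I * fderiv ℝ f z Complex.I)

/-- The Wirtinger derivative `∂_{z̄} = (∂_x + i ∂_y) / 2` on `ℂ`. -/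
def dzbar (f : ℂ → ℂ) (z : ℂ) : ℂ :=
  (1 / 2 : ℂ) * (fderiv ℝ f z 1 + Complex.I * fderiv ℝ f z Complex.I)

/-- `g₁ = ∂_z g` for a real function `g`. -/
def g1 (g : ℂ → ℝ) : ℂ → ℂ := dz (fun z => (g z : ℂ))

/-- `g_{1 1̄} = ∂_z ∂_{z̄} g`; for a `C²` real function `g` this is a real number (a quarter of the
Laplacian of `g`), so nothing is lost in taking the real part. -/
def g11 (g : ℂ → ℝ) (z : ℂ) : ℝ := (dz (dzbar (fun w => (g w : ℂ))) z).re

/-- The partial derivative in the `j`-th real coordinate of `ℝ³`. -/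
def pd (j : Fin 3) (u : R3 → ℂ) (p : R3) : ℂ := fderiv ℝ u p (EuclideanSpace.single j 1)

/-- The vector field `L = ∂_z - i g₁(z) ∂_t`. -/
def L (g : ℂ → ℝ) (u : R3 → ℂ) (p : R3) : ℂ :=
  (1 / 2 : ℂ) * (pd 0 u p - Complex.I * pd 1 u p) - Complex.I * g1 g (zc p) * pd 2 u p

/-- The conjugate vector field `L̄ = ∂_{z̄} + i (conj g₁(z)) ∂_t`. -/
def Lbar (g : ℂ → ℝ) (u : R3 → ℂ) (p : R3) : ℂ :=
  (1 / 2 : ℂ) * (pd 0 u p + Complex.I * pd 1 u p) + Complex.I * conj (g1 g (zc p)) * pd 2 u p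

/-- The Sobolev norm `‖f‖_s = ‖Λ^s f‖_{L²}` of an integrable function `f` (below it is only applied
to `C^∞` functions with compact support), where `Λ^s` is the Fourier multiplier with symbol
`(1 + |ξ|²)^{s/2}`, `ξ` being the angular frequency. It is computed on the Fourier side by
Plancherel; `𝓕` has kernel `exp (-2 π i x · ξ)`, which accounts for the factor `2 π`. -/
def sobolevNorm (s : ℝ) (f : R3 → ℂ) : ℝ≥0∞ :=
  eLpNorm (fun ξ : R3 => (((1 + (2 * Real.pi * ‖ξ‖) ^ 2) ^ (s / 2) : ℝ) : ℂ) * 𝓕 f ξ) 2 volume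

/-- `ζ` is a cut-off function with support in `U`: real valued, `C^∞`, with compact support
contained in `U`. -/
structure IsCutoff (U : Set R3) (ζ : R3 → ℝ) : Prop where
  smooth : ContDiff ℝ ∞ ζ
  compact : HasCompactSupport ζ
  support_subset : tsupport ζ ⊆ U

end

end LossDeriv

open LossDeriv

/-!
# An a priori estimate near a point of infinite type

Write `a` for a test function on `ℂ` which equals `g₁` near `0`, so that near `0` the vector fields
are `L = ∂_z - i a ∂_t` and `L̄ = ∂_{z̄} + i ā ∂_t`, with `L̄* = -L` and `[L, L̄] = i h(z) ∂_t`, where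
`h = levi a` equals `2 g_{1 1̄}` near `0`. The proof rests on the facts that `g_{1 1̄}` is nonnegative,
is positive away from `0`, and dominates `|g₁|²`.

*Energy.* Since `[L̄, z̄] = 1` and `[L, z̄] = 0`, integration by parts gives
`‖v‖ ≤ ‖z̄ L v‖ + ‖z̄ L̄ v‖` (`norm_le_mulZbar_opL_add`). To pass to Sobolev norms, one commutes with
the multiplier `J ε s` of symbol `(1 + |(ε ξ₀, ε ξ₁, ξ₂)|²) ^ (s / 2)`, which for fixed `ε > 0` gives
a norm equivalent to `‖·‖_s`. Functions of `z` have horizontal frequencies only, along which the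
symbol varies with speed `ε`. So the commutators carry a factor `ε`, and for small `ε` they are
absorbed, except for a part which is controlled by `L̄ v`. The result is
`‖v‖_s ≤ C (‖z̄ L v‖_s + ‖z̄ L̄ v‖_s + ‖L̄ v‖_{s-1})` (`exists_nrm_le_energy`).

*Gain.* Pairing `[L, L̄] W` with `-i ∂_t ⟨∂_t⟩⁻¹ W` bounds `(h ⟨∂_t⟩^{1/2} W, ⟨∂_t⟩^{1/2} W)` by
`‖L W‖² + ‖L̄ W‖² + ‖W‖²`. Hence `b(z) w` gains half a derivative from `L w`, `L̄ w` and `w`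
whenever `|b|² ≤ K Re h` near the support of `b` (`exists_nrm_mulZ_le_subelliptic`). This applies to
`b = a b₁` and `b = ā b₁` by the hypothesis `|g₁|² ≤ c² g_{1 1̄}`, and to cut-offs `b` which vanish
near `0` (`exists_extension`).

*Localization.* The energy estimate is applied to `β u`. The commutator of `L` or `L̄` with `β` has
the terms `∂_z β`, `∂_{z̄} β` and `a ∂_t β`. If `β` depends on `t` alone for small `z`, then each of
these has a factor `b(z)` with a gain, so that after multiplication by `z̄` (which commutes with `L`
and costs only `w` itself with `L̄`) they are controlled by `‖u‖_{s-1/2}` on a larger set, together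
with the data (`exists_nrm_cut_le_half`). Such `β` exist between any compact set and any
neighbourhood of it (`exists_cutoff_flat`).

*Induction.* For `s ≤ -1` the estimate is immediate from `u = L̄(z̄ u) - z̄ L̄ u`, and it extends to
all `s` in steps of `1/2` (`exists_nrm_cut_le_dataNorm`).

All computations take place on the Schwartz space, on which the operators act without domain
questions. Commutators of multipliers with multiplications are estimated on the Fourier side, where
multiplication by a test function of `z` is a superposition of horizontal translations.
-/

namespace LossDeriv

noncomputable section

/-! ### Schwartz functions, Fourier multipliers and `L²` -/

/-- The Schwartz space of `ℂ × ℝ`, on which all operators below act. -/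
abbrev SF : Type := SchwartzMap R3 ℂ

/-- The inclusion of the Schwartz space into `L²`; norms and scalar products of Schwartz functions
are taken through it. -/
def toL2 : SF →L[ℂ] Lp ℂ 2 (volume : Measure R3) := SchwartzMap.toLpCLM ℂ ℂ 2 volume

/-- The Fourier multiplier with symbol `m`, in the ordinary frequency `ξ` (so that `∂ⱼ` has the
symbol `2πiξⱼ`). It is `0` if `m` is not of temperate growth. -/
def multiplier (m : R3 → ℂ) : SF →L[ℂ] SF := SchwartzMap.fourierMultiplierCLM ℂ m

/-- Multiplication by the function `f`. It is `0` if `f` is not of temperate growth. -/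
def mulOp (f : R3 → ℂ) : SF →L[ℂ] SF := SchwartzMap.smulLeftCLM ℂ f

/-- The `j`-th partial derivative on the Schwartz space. -/
def Dc (j : Fin 3) : SF →L[ℂ] SF :=
  LineDeriv.lineDerivOpCLM ℂ SF (EuclideanSpace.single j (1 : ℝ) : R3)

lemma inner_toL2 (f g : SF) :
    inner ℂ (toL2 f) (toL2 g) = ∫ x, conj (f x) * g x := by
  simp only [toL2, SchwartzMap.toLpCLM_apply, SchwartzMap.inner_toL2_toL2_eq]
  congr 1
  ext x
  simp [mul_comm]

lemma norm_toL2_le_add {f g h : SF} (H : ∀ x, ‖f x‖ ≤ ‖g x‖ + ‖h x‖) :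
    ‖toL2 f‖ ≤ ‖toL2 g‖ + ‖toL2 h‖ := by
  simp only [toL2, SchwartzMap.toLpCLM_apply, SchwartzMap.norm_toLp]
  rw [← ENNReal.toReal_add (g.memLp 2 volume).2.ne (h.memLp 2 volume).2.ne]
  refine ENNReal.toReal_mono
    (ENNReal.add_ne_top.2 ⟨(g.memLp 2 volume).2.ne, (h.memLp 2 volume).2.ne⟩) ?_
  calc eLpNorm f 2 volume ≤ eLpNorm (fun x => ‖g x‖ + ‖h x‖) 2 volume := eLpNorm_mono_real H
    _ ≤ eLpNorm (fun x => ‖g x‖) 2 volume + eLpNorm (fun x => ‖h x‖) 2 volume :=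
        eLpNorm_add_le (g.continuous.norm.aestronglyMeasurable)
          (h.continuous.norm.aestronglyMeasurable) (by norm_num)
    _ = _ := by rw [eLpNorm_norm, eLpNorm_norm]

lemma norm_toL2_le {f g : SF} {C : ℝ} (H : ∀ x, ‖f x‖ ≤ C * ‖g x‖) :
    ‖toL2 f‖ ≤ C * ‖toL2 g‖ := by
  simp only [toL2, SchwartzMap.toLpCLM_apply]
  refine Lp.norm_le_mul_norm_of_ae_le_mul ?_
  filter_upwards [f.coeFn_toLp 2 volume, g.coeFn_toLp 2 volume] with x hf hg
  rw [hf, hg]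
  exact H x

lemma norm_toL2_fourier (f : SF) : ‖toL2 (𝓕 f)‖ = ‖toL2 f‖ := by
  simp only [toL2, SchwartzMap.toLpCLM_apply, SchwartzMap.norm_fourier_toL2_eq]

lemma inner_toL2_fourier (f g : SF) :
    inner ℂ (toL2 (𝓕 f)) (toL2 (𝓕 g)) = inner ℂ (toL2 f) (toL2 g) := by
  simp only [toL2, SchwartzMap.toLpCLM_apply]
  exact SchwartzMap.inner_fourier_toL2_eq f g

lemma mulOp_apply {f : R3 → ℂ} (hf : f.HasTemperateGrowth) (v : SF) (x : R3) :
    mulOp f v x = f x * v x := by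
  simp [mulOp, SchwartzMap.smulLeftCLM_apply_apply hf]

lemma fourier_multiplier {m : R3 → ℂ} (v : SF) :
    𝓕 (multiplier m v) = mulOp m (𝓕 v) := by
  simp [multiplier, SchwartzMap.fourierMultiplierCLM_apply, mulOp]

lemma fourier_multiplier_apply {m : R3 → ℂ} (hm : m.HasTemperateGrowth) (v : SF) (x : R3) :
    𝓕 (multiplier m v) x = m x * 𝓕 v x := by
  rw [fourier_multiplier, mulOp_apply hm]

lemma fourier_injective {f g : SF} (h : 𝓕 f = 𝓕 g) : f = g := by
  have := congrArg (fun F : SF => (𝓕⁻ F : SF)) h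
  simpa using this

lemma fourier_ext {f g : SF} (h : ∀ ξ, 𝓕 f ξ = 𝓕 g ξ) : f = g :=
  fourier_injective (SchwartzMap.ext h)

lemma Dc_apply (j : Fin 3) (v : SF) (x : R3) : Dc j v x = pd j v x := rfl

lemma fourier_Dc_apply (j : Fin 3) (v : SF) (ξ : R3) :
    𝓕 (Dc j v) ξ = (2 * Real.pi * Complex.I) * (ξ j : ℂ) * 𝓕 v ξ := by
  have h := SchwartzMap.fourier_lineDerivOp_eq v (EuclideanSpace.single j (1 : ℝ) : R3)
  have hg : (fun x : R3 =>
      inner ℝ x (EuclideanSpace.single j (1 : ℝ) : R3)).HasTemperateGrowth := by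
    fun_prop
  simp only [Dc, LineDeriv.lineDerivOpCLM_apply]
  rw [h, smul_apply, SchwartzMap.smulLeftCLM_apply_apply hg]
  simp [EuclideanSpace.inner_single_right]
  ring

lemma multiplier_multiplier {m n : R3 → ℂ} (hm : m.HasTemperateGrowth)
    (hn : n.HasTemperateGrowth) (v : SF) :
    multiplier m (multiplier n v) = multiplier (fun ξ => m ξ * n ξ) v := by
  refine fourier_ext fun ξ => ?_
  rw [fourier_multiplier_apply hm, fourier_multiplier_apply hn,
    fourier_multiplier_apply (m := fun ξ => m ξ * n ξ) (hm.mul hn), mul_assoc]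

lemma multiplier_comm {m n : R3 → ℂ} (hm : m.HasTemperateGrowth)
    (hn : n.HasTemperateGrowth) (v : SF) :
    multiplier m (multiplier n v) = multiplier n (multiplier m v) := by
  rw [multiplier_multiplier hm hn, multiplier_multiplier hn hm]
  simp only [mul_comm]

lemma multiplier_Dc {m : R3 → ℂ} (hm : m.HasTemperateGrowth) (j : Fin 3) (v : SF) :
    multiplier m (Dc j v) = Dc j (multiplier m v) := by
  refine fourier_ext fun ξ => ?_
  rw [fourier_multiplier_apply hm, fourier_Dc_apply, fourier_Dc_apply,
    fourier_multiplier_apply hm]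
  ring

lemma Dc_comm (i j : Fin 3) (v : SF) : Dc i (Dc j v) = Dc j (Dc i v) := by
  refine fourier_ext fun ξ => ?_
  simp only [fourier_Dc_apply]
  ring

lemma norm_le_of_fourier_le {f g : SF} {C : ℝ} (H : ∀ ξ, ‖𝓕 f ξ‖ ≤ C * ‖𝓕 g ξ‖) :
    ‖toL2 f‖ ≤ C * ‖toL2 g‖ := by
  rw [← norm_toL2_fourier f, ← norm_toL2_fourier g]
  exact norm_toL2_le H

lemma norm_le_of_fourier_le_add {f g h : SF} (H : ∀ ξ, ‖𝓕 f ξ‖ ≤ ‖𝓕 g ξ‖ + ‖𝓕 h ξ‖) :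
    ‖toL2 f‖ ≤ ‖toL2 g‖ + ‖toL2 h‖ := by
  rw [← norm_toL2_fourier f, ← norm_toL2_fourier g, ← norm_toL2_fourier h]
  exact norm_toL2_le_add H

lemma inner_multiplier {m : R3 → ℂ} (hm : m.HasTemperateGrowth) (hr : ∀ ξ, conj (m ξ) = m ξ)
    (f g : SF) :
    inner ℂ (toL2 (multiplier m f)) (toL2 g) = inner ℂ (toL2 f) (toL2 (multiplier m g)) := by
  rw [← inner_toL2_fourier, ← inner_toL2_fourier f, inner_toL2, inner_toL2]
  congr 1
  ext ξ
  rw [fourier_multiplier_apply hm, fourier_multiplier_apply hm, map_mul, hr]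
  ring

lemma inner_mulOp {a : R3 → ℂ} (ha : a.HasTemperateGrowth)
    (ha' : (fun x => conj (a x)).HasTemperateGrowth) (f g : SF) :
    inner ℂ (toL2 (mulOp a f)) (toL2 g) =
      inner ℂ (toL2 f) (toL2 (mulOp (fun x => conj (a x)) g)) := by
  rw [inner_toL2, inner_toL2]
  congr 1
  ext ξ
  rw [mulOp_apply ha, mulOp_apply ha', map_mul]
  ring

lemma inner_Dc (j : Fin 3) (f g : SF) :
    inner ℂ (toL2 (Dc j f)) (toL2 g) = - inner ℂ (toL2 f) (toL2 (Dc j g)) := by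
  rw [← inner_toL2_fourier, ← inner_toL2_fourier f, inner_toL2, inner_toL2, ← integral_neg]
  congr 1
  ext ξ
  rw [fourier_Dc_apply, fourier_Dc_apply]
  simp only [map_mul, map_ofNat, Complex.conj_ofReal, Complex.conj_I]
  ring

lemma mulOp_mulOp {a b : R3 → ℂ} (ha : a.HasTemperateGrowth) (hb : b.HasTemperateGrowth)
    (v : SF) : mulOp a (mulOp b v) = mulOp (fun x => a x * b x) v := by
  ext x
  rw [mulOp_apply ha, mulOp_apply hb, mulOp_apply (f := fun x => a x * b x) (ha.mul hb),
    mul_assoc]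

lemma mulOp_comm {a b : R3 → ℂ} (ha : a.HasTemperateGrowth) (hb : b.HasTemperateGrowth)
    (v : SF) : mulOp a (mulOp b v) = mulOp b (mulOp a v) := by
  rw [mulOp_mulOp ha hb, mulOp_mulOp hb ha]
  simp only [mul_comm]

lemma Dc_mulOp {a : R3 → ℂ} (ha : a.HasTemperateGrowth) (j : Fin 3)
    (ha' : (pd j a).HasTemperateGrowth) (v : SF) :
    Dc j (mulOp a v) = mulOp (pd j a) v + mulOp a (Dc j v) := by
  ext x
  rw [add_apply, mulOp_apply ha', mulOp_apply ha, Dc_apply, Dc_apply]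
  have h1 : (mulOp a v : R3 → ℂ) = fun y => a y * v y := funext fun y => mulOp_apply ha v y
  have h2 : DifferentiableAt ℝ a x := (ha.1.differentiable (by simp)) x
  rw [h1]
  unfold pd
  rw [fderiv_fun_mul h2 v.differentiableAt]
  simp
  ring

/-! ### Sobolev weights -/

/-- The linear map `ξ ↦ 2π (ε ξ₀, ε ξ₁, ξ₂)` of frequency space. -/
def scaleFreq (ε : ℝ) : R3 →L[ℝ] R3 :=
  (2 * Real.pi * ε) • ContinuousLinearMap.id ℝ R3 +
    (2 * Real.pi * (1 - ε)) •
      (EuclideanSpace.proj (2 : Fin 3) : R3 →L[ℝ] ℝ).smulRight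
        (EuclideanSpace.single 2 (1 : ℝ) : R3)

lemma scaleFreq_zero_coord (ε : ℝ) (ξ : R3) : scaleFreq ε ξ 0 = 2 * Real.pi * ε * ξ 0 := by
  simp [scaleFreq]

lemma scaleFreq_one_coord (ε : ℝ) (ξ : R3) : scaleFreq ε ξ 1 = 2 * Real.pi * ε * ξ 1 := by
  simp [scaleFreq]

lemma scaleFreq_two_coord (ε : ℝ) (ξ : R3) : scaleFreq ε ξ 2 = 2 * Real.pi * ξ 2 := by
  simp [scaleFreq]
  ring

lemma norm_sq_R3 (ξ : R3) : ‖ξ‖ ^ 2 = ξ 0 ^ 2 + ξ 1 ^ 2 + ξ 2 ^ 2 := by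
  rw [EuclideanSpace.norm_sq_eq, Fin.sum_univ_three]
  simp

lemma norm_sq_scaleFreq (ε : ℝ) (ξ : R3) :
    ‖scaleFreq ε ξ‖ ^ 2 = (2 * Real.pi) ^ 2 * (ε ^ 2 * (ξ 0 ^ 2 + ξ 1 ^ 2) + ξ 2 ^ 2) := by
  rw [norm_sq_R3, scaleFreq_zero_coord, scaleFreq_one_coord, scaleFreq_two_coord]
  ring

lemma norm_scaleFreq_le {ε : ℝ} (h0 : 0 ≤ ε) (h1 : ε ≤ 1) (ξ : R3) :
    ‖scaleFreq ε ξ‖ ≤ 2 * Real.pi * ‖ξ‖ := by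
  have hp := Real.pi_pos
  refine abs_le_of_sq_le_sq' ?_ (by positivity) |>.2
  rw [norm_sq_scaleFreq, mul_pow _ ‖ξ‖, norm_sq_R3]
  have : ε ^ 2 ≤ 1 := by nlinarith
  have h2 : ε ^ 2 * (ξ 0 ^ 2 + ξ 1 ^ 2) ≤ 1 * (ξ 0 ^ 2 + ξ 1 ^ 2) := by gcongr
  gcongr
  linarith

lemma norm_scaleFreq_of_vertical_zero {ε : ℝ} (h0 : 0 ≤ ε) {ξ : R3} (h : ξ 2 = 0) :
    ‖scaleFreq ε ξ‖ = ε * (2 * Real.pi * ‖ξ‖) := by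
  have hp := Real.pi_pos
  have : ‖scaleFreq ε ξ‖ ^ 2 = (ε * (2 * Real.pi * ‖ξ‖)) ^ 2 := by
    rw [norm_sq_scaleFreq, mul_pow ε, mul_pow _ ‖ξ‖, norm_sq_R3, h]
    ring
  exact (pow_left_inj₀ (norm_nonneg _) (by positivity) two_ne_zero).1 this

lemma scaleFreq_one (ξ : R3) : ‖scaleFreq 1 ξ‖ = 2 * Real.pi * ‖ξ‖ := by
  have hp := Real.pi_pos
  simp [scaleFreq, norm_smul, abs_of_pos hp]

/-- The weight `(1 + |2π (ε ξ₀, ε ξ₁, ξ₂)|²) ^ (s / 2)`. For `ε = 1` it is the symbol of `Λˢ`; for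
`ε = 0` it involves only the frequency dual to `t`. -/
def wt (ε s : ℝ) (ξ : R3) : ℝ := (1 + ‖scaleFreq ε ξ‖ ^ 2) ^ (s / 2)

lemma wt_pos (ε s : ℝ) (ξ : R3) : 0 < wt ε s ξ := by
  unfold wt; positivity

@[simp] lemma wt_zero (ε : ℝ) (ξ : R3) : wt ε 0 ξ = 1 := by simp [wt]

lemma wt_mul (ε s r : ℝ) (ξ : R3) : wt ε s ξ * wt ε r ξ = wt ε (s + r) ξ := by
  unfold wt
  rw [← Real.rpow_add (by positivity)]
  congr 1
  ring

lemma wt_one_eq (ε : ℝ) (ξ : R3) : wt ε 1 ξ = √(1 + ‖scaleFreq ε ξ‖ ^ 2) := by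
  rw [wt, Real.sqrt_eq_rpow]

lemma wt_one_sq (ε : ℝ) (ξ : R3) : wt ε 1 ξ ^ 2 = 1 + ‖scaleFreq ε ξ‖ ^ 2 := by
  rw [wt_one_eq, Real.sq_sqrt (by positivity)]

lemma wt_two (ε : ℝ) (ξ : R3) : wt ε 2 ξ = 1 + ‖scaleFreq ε ξ‖ ^ 2 := by
  simp [wt]

lemma wt_eq_rpow (ε s : ℝ) (ξ : R3) : wt ε s ξ = wt ε 1 ξ ^ s := by
  rw [wt, wt, ← Real.rpow_mul (by positivity)]
  congr 1
  ring

lemma one_le_wt_one (ε : ℝ) (ξ : R3) : 1 ≤ wt ε 1 ξ := by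
  rw [wt_one_eq]
  exact Real.one_le_sqrt.2 (by nlinarith [sq_nonneg ‖scaleFreq ε ξ‖])

lemma wt_mono (ε : ℝ) {s r : ℝ} (h : s ≤ r) (ξ : R3) : wt ε s ξ ≤ wt ε r ξ := by
  rw [wt_eq_rpow, wt_eq_rpow ε r]
  exact Real.rpow_le_rpow_of_exponent_le (one_le_wt_one ε ξ) h

lemma norm_scaleFreq_le_wt (ε : ℝ) (ξ : R3) : ‖scaleFreq ε ξ‖ ≤ wt ε 1 ξ := by
  rw [wt_one_eq]
  exact Real.le_sqrt_of_sq_le (by linarith)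

lemma hasTemperateGrowth_wt (ε s : ℝ) :
    (fun ξ => ((wt ε s ξ : ℝ) : ℂ)).HasTemperateGrowth := by
  have h1 := Function.hasTemperateGrowth_one_add_norm_sq_rpow R3 (s / 2)
  have h2 : (fun ξ => wt ε s ξ).HasTemperateGrowth :=
    h1.comp (scaleFreq ε).hasTemperateGrowth
  exact Function.HasTemperateGrowth.comp (by fun_prop : Complex.ofReal.HasTemperateGrowth) h2

lemma abs_wt_one_sub_le (ε : ℝ) (ξ η : R3) :
    |wt ε 1 ξ - wt ε 1 η| ≤ ‖scaleFreq ε (ξ - η)‖ := by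
  have key : ∀ ξ η : R3, wt ε 1 ξ ≤ wt ε 1 η + ‖scaleFreq ε (ξ - η)‖ := by
    intro ξ η
    have hx : ‖scaleFreq ε ξ‖ ≤ ‖scaleFreq ε η‖ + ‖scaleFreq ε (ξ - η)‖ := by
      rw [map_sub]
      simpa using norm_add_le (scaleFreq ε η) (scaleFreq ε ξ - scaleFreq ε η)
    have hp := wt_pos ε 1 η
    refine abs_le_of_sq_le_sq' ?_ (by positivity) |>.2
    have h1 := norm_scaleFreq_le_wt ε η
    have h2 := norm_nonneg (scaleFreq ε (ξ - η))
    have h3 : ‖scaleFreq ε ξ‖ ^ 2 ≤ (‖scaleFreq ε η‖ + ‖scaleFreq ε (ξ - η)‖) ^ 2 := by gcongr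
    have := wt_one_sq ε η
    rw [wt_one_sq]
    nlinarith [mul_le_mul_of_nonneg_right h1 h2]
  rw [abs_le]
  have h1 := key ξ η
  have h2 := key η ξ
  have h3 : ‖scaleFreq ε (η - ξ)‖ = ‖scaleFreq ε (ξ - η)‖ := by
    rw [← norm_neg, ← map_neg, neg_sub]
  constructor <;> linarith

/-- Powers of comparable numbers are comparable, for exponents of either sign. -/
lemma rpow_le_of_ratio {t y c : ℝ} (ht : 0 < t) (hy : 0 < y) (h1 : t ≤ c * y)
    (h2 : y ≤ c * t) (r : ℝ) : t ^ r ≤ c ^ |r| * y ^ r := by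
  have hc : 0 < c := by
    by_contra hc
    push Not at hc
    nlinarith
  rcases le_total 0 r with hr | hr
  · rw [abs_of_nonneg hr, ← Real.mul_rpow hc.le hy.le]
    exact Real.rpow_le_rpow ht.le h1 hr
  · rw [abs_of_nonpos hr]
    have h3 : (c * t) ^ r ≤ y ^ r := Real.rpow_le_rpow_of_nonpos hy h2 hr
    rw [Real.mul_rpow hc.le ht.le] at h3
    rw [Real.rpow_neg hc.le]
    have : 0 < c ^ r := by positivity
    field_simp
    linarith

lemma wt_one_le_mul (ε : ℝ) (ξ η : R3) :
    wt ε 1 ξ ≤ (1 + ‖scaleFreq ε (ξ - η)‖) * wt ε 1 η := by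
  have h1 := (abs_le.1 (abs_wt_one_sub_le ε ξ η)).2
  have h2 := one_le_wt_one ε η
  nlinarith [norm_nonneg (scaleFreq ε (ξ - η))]

lemma wt_one_le_mul' (ε : ℝ) (ξ η : R3) :
    wt ε 1 η ≤ (1 + ‖scaleFreq ε (ξ - η)‖) * wt ε 1 ξ := by
  have h1 := (abs_le.1 (abs_wt_one_sub_le ε ξ η)).1
  have h2 := one_le_wt_one ε ξ
  nlinarith [norm_nonneg (scaleFreq ε (ξ - η))]

/-- Peetre's inequality. -/
lemma wt_le_mul_wt (ε s : ℝ) (ξ k : R3) :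
    wt ε s ξ ≤ (1 + ‖scaleFreq ε k‖) ^ |s| * wt ε s (ξ - k) := by
  have h1 := wt_one_le_mul ε ξ (ξ - k)
  have h2 := wt_one_le_mul' ε ξ (ξ - k)
  rw [sub_sub_cancel] at h1 h2
  rw [wt_eq_rpow, wt_eq_rpow ε s (ξ - k)]
  exact rpow_le_of_ratio (wt_pos _ _ _) (wt_pos _ _ _) h1 h2 s

lemma abs_rpow_sub_rpow_le {x y c : ℝ} (hx : 0 < x) (hy : 0 < y) (hc : 1 ≤ c) (h1 : x ≤ c * y)
    (h2 : y ≤ c * x) (s : ℝ) :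
    |x ^ s - y ^ s| ≤ |s| * (c ^ |s - 1| * y ^ (s - 1)) * |x - y| := by
  have hderiv : ∀ t ∈ Set.uIcc x y,
      HasDerivWithinAt (fun t : ℝ => t ^ s) (s * t ^ (s - 1)) (Set.uIcc x y) t := by
    intro t ht
    have ht0 : 0 < t := lt_of_lt_of_le (lt_min hx hy) ht.1
    exact (Real.hasDerivAt_rpow_const (Or.inl ht0.ne')).hasDerivWithinAt
  have hb : ∀ t ∈ Set.uIcc x y, ‖s * t ^ (s - 1)‖ ≤ |s| * (c ^ |s - 1| * y ^ (s - 1)) := by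
    intro t ht
    have ht0 : 0 < t := lt_of_lt_of_le (lt_min hx hy) ht.1
    rw [norm_mul, Real.norm_eq_abs, Real.norm_eq_abs, abs_of_nonneg (Real.rpow_nonneg ht0.le _)]
    gcongr
    refine rpow_le_of_ratio ht0 hy ?_ ?_ _
    · exact ht.2.trans (max_le h1 (by nlinarith))
    · rcases le_total x y with h | h
      · exact h2.trans (by gcongr; exact (min_eq_left h ▸ ht.1 : x ≤ t))
      · have : y ≤ t := min_eq_right h ▸ ht.1
        nlinarith
  have := (convex_uIcc x y).norm_image_sub_le_of_norm_hasDerivWithin_le hderiv hb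
    Set.right_mem_uIcc Set.left_mem_uIcc
  simpa [Real.norm_eq_abs] using this

/-- The symbol estimate behind the commutators of `J ε s`: a translation by `k` gains one order, with
a factor `‖scaleFreq ε k‖`, which is small with `ε` if `k` is horizontal. -/
lemma abs_wt_sub_le (ε s : ℝ) (ξ k : R3) :
    |wt ε s ξ - wt ε s (ξ - k)| ≤
      |s| * ‖scaleFreq ε k‖ * (1 + ‖scaleFreq ε k‖) ^ |s - 1| * wt ε (s - 1) (ξ - k) := by
  have h1 := wt_one_le_mul ε ξ (ξ - k)
  have h2 := wt_one_le_mul' ε ξ (ξ - k)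
  have h3 := abs_wt_one_sub_le ε ξ (ξ - k)
  rw [sub_sub_cancel] at h1 h2 h3
  have h4 := abs_rpow_sub_rpow_le (wt_pos ε 1 ξ) (wt_pos ε 1 (ξ - k))
    (by linarith [norm_nonneg (scaleFreq ε k)]) h1 h2 s
  rw [wt_eq_rpow, wt_eq_rpow ε s (ξ - k), wt_eq_rpow ε (s - 1) (ξ - k)]
  refine h4.trans ?_
  have h5 : 0 ≤ |s| * ((1 + ‖scaleFreq ε k‖) ^ |s - 1| * wt ε 1 (ξ - k) ^ (s - 1)) := by
    have := wt_pos ε 1 (ξ - k)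
    positivity
  calc _ ≤ |s| * ((1 + ‖scaleFreq ε k‖) ^ |s - 1| * wt ε 1 (ξ - k) ^ (s - 1))
        * ‖scaleFreq ε k‖ := by gcongr
    _ = _ := by ring

/-- For fixed `ε > 0` the weights `wt ε s` and `wt 1 s` define equivalent norms. -/
lemma wt_one_le_wt {ε : ℝ} (h0 : 0 < ε) (h1 : ε ≤ 1) (s : ℝ) (ξ : R3) :
    wt 1 s ξ ≤ ε⁻¹ ^ |s| * wt ε s ξ ∧ wt ε s ξ ≤ ε⁻¹ ^ |s| * wt 1 s ξ := by
  have hp := Real.pi_pos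
  have he : 1 ≤ ε⁻¹ := (one_le_inv₀ h0).2 h1
  have a1 : wt ε 1 ξ ≤ wt 1 1 ξ := by
    rw [wt_one_eq, wt_one_eq, scaleFreq_one]
    gcongr
    exact norm_scaleFreq_le h0.le h1 ξ
  have a2 : wt 1 1 ξ ≤ ε⁻¹ * wt ε 1 ξ := by
    refine abs_le_of_sq_le_sq' ?_ (by have := wt_pos ε 1 ξ; positivity) |>.2
    rw [mul_pow, wt_one_sq, wt_one_sq, norm_sq_scaleFreq, norm_sq_scaleFreq, inv_pow]
    have he2 : ε ^ 2 ≤ 1 := by nlinarith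
    have : 0 < ε ^ 2 := by positivity
    rw [inv_mul_eq_div, le_div_iff₀ this]
    have h4 : ε ^ 2 * (ξ 2) ^ 2 ≤ 1 * (ξ 2) ^ 2 := by gcongr
    have h5 : 0 < (2 * Real.pi) ^ 2 := by positivity
    nlinarith [mul_le_mul_of_nonneg_left h4 h5.le]
  have b1 := wt_pos ε 1 ξ
  have b2 := wt_pos 1 1 ξ
  rw [wt_eq_rpow, wt_eq_rpow ε s]
  exact ⟨rpow_le_of_ratio b2 b1 a2 (a1.trans (by nlinarith)) s,
    rpow_le_of_ratio b1 b2 (a1.trans (by nlinarith)) a2 s⟩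

/-- The operator with symbol `wt ε s`; `J 1 s` is `Λˢ`. -/
def J (ε s : ℝ) : SF →L[ℂ] SF := multiplier (fun ξ => ((wt ε s ξ : ℝ) : ℂ))

lemma fourier_J_apply (ε s : ℝ) (v : SF) (ξ : R3) : 𝓕 (J ε s v) ξ = (wt ε s ξ : ℂ) * 𝓕 v ξ :=
  fourier_multiplier_apply (hasTemperateGrowth_wt ε s) v ξ

lemma norm_fourier_J_apply (ε s : ℝ) (v : SF) (ξ : R3) :
    ‖𝓕 (J ε s v) ξ‖ = wt ε s ξ * ‖𝓕 v ξ‖ := by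
  rw [fourier_J_apply, norm_mul, Complex.norm_real, Real.norm_of_nonneg (wt_pos _ _ _).le]

lemma J_J (ε s r : ℝ) (v : SF) : J ε s (J ε r v) = J ε (s + r) v := by
  refine fourier_ext fun ξ => ?_
  rw [fourier_J_apply, fourier_J_apply, fourier_J_apply, ← wt_mul]
  push_cast
  ring

@[simp] lemma J_zero (ε : ℝ) (v : SF) : J ε 0 v = v := by
  refine fourier_ext fun ξ => ?_
  rw [fourier_J_apply]
  simp

lemma J_comm (ε s δ r : ℝ) (v : SF) : J ε s (J δ r v) = J δ r (J ε s v) :=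
  multiplier_comm (hasTemperateGrowth_wt _ _) (hasTemperateGrowth_wt _ _) v

lemma J_Dc (ε s : ℝ) (j : Fin 3) (v : SF) : J ε s (Dc j v) = Dc j (J ε s v) :=
  multiplier_Dc (hasTemperateGrowth_wt _ _) j v

lemma inner_J (ε s : ℝ) (f g : SF) :
    inner ℂ (toL2 (J ε s f)) (toL2 g) = inner ℂ (toL2 f) (toL2 (J ε s g)) :=
  inner_multiplier (hasTemperateGrowth_wt _ _) (fun _ => Complex.conj_ofReal _) f g

lemma norm_J_mono (ε : ℝ) {s r : ℝ} (h : s ≤ r) (v : SF) :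
    ‖toL2 (J ε s v)‖ ≤ ‖toL2 (J ε r v)‖ := by
  have : ∀ ξ, ‖𝓕 (J ε s v) ξ‖ ≤ 1 * ‖𝓕 (J ε r v) ξ‖ := fun ξ => by
    rw [norm_fourier_J_apply, norm_fourier_J_apply, one_mul]
    gcongr
    exact wt_mono ε h ξ
  simpa using norm_le_of_fourier_le this

lemma norm_J_Dc_two_le (ε s : ℝ) (v : SF) :
    ‖toL2 (J ε s (Dc 2 v))‖ ≤ ‖toL2 (J ε (s + 1) v)‖ := by
  have hp := Real.pi_pos
  have : ∀ ξ, ‖𝓕 (J ε s (Dc 2 v)) ξ‖ ≤ 1 * ‖𝓕 (J ε (s + 1) v) ξ‖ := fun ξ => by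
    rw [norm_fourier_J_apply, norm_fourier_J_apply, one_mul, fourier_Dc_apply, ← wt_mul,
      norm_mul, norm_mul (2 * Real.pi * Complex.I : ℂ), mul_assoc (wt ε s ξ)]
    have h1 : 2 * Real.pi * |ξ 2| ≤ wt ε 1 ξ := by
      refine le_trans ?_ (norm_scaleFreq_le_wt ε ξ)
      refine le_trans (le_of_eq ?_) (PiLp.norm_apply_le (scaleFreq ε ξ) 2)
      rw [scaleFreq_two_coord]
      simp [abs_of_pos hp]
    have h2 := wt_pos ε s ξ
    have h3 : ‖(2 * Real.pi * Complex.I : ℂ)‖ * ‖(ξ 2 : ℂ)‖ = 2 * Real.pi * |ξ 2| := by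
      simp [abs_of_pos hp]
    rw [h3]
    gcongr
  simpa using norm_le_of_fourier_le this

/-! ### Commutators with Fourier multipliers -/

section Kernel

variable {V : Type*} [NormedAddCommGroup V] [InnerProductSpace ℝ V] [FiniteDimensional ℝ V]
  [MeasurableSpace V] [BorelSpace V]

/-- The Cauchy–Schwarz inequality with respect to the measure of density `w`. -/
lemma sq_lintegral_mul_le {α : Type*} [MeasurableSpace α] (μ : Measure α) {w h : α → ℝ≥0∞}
    (hw : AEMeasurable w μ) (hh : AEMeasurable h μ) :
    (∫⁻ x, w x * h x ∂μ) ^ 2 ≤ (∫⁻ x, w x ∂μ) * ∫⁻ x, w x * h x ^ 2 ∂μ := by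
  have h1 := ENNReal.lintegral_mul_le_Lp_mul_Lq μ Real.HolderConjugate.two_two
    (hw.pow_const (1 / 2 : ℝ)) ((hw.pow_const (1 / 2 : ℝ)).mul hh)
  have e1 : ∀ x : ℝ≥0∞, x ^ (1 / 2 : ℝ) * x ^ (1 / 2 : ℝ) = x := fun x => by
    rw [← ENNReal.rpow_add_of_nonneg _ _ (by norm_num) (by norm_num)]
    norm_num
  have e2 : ∀ x : ℝ≥0∞, (x ^ (1 / 2 : ℝ)) ^ (2 : ℝ) = x := fun x => by
    rw [← ENNReal.rpow_mul]; norm_num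
  simp only [Pi.mul_apply, ← mul_assoc, e1, ENNReal.mul_rpow_of_nonneg _ _ zero_le_two, e2] at h1
  calc _ ≤ ((∫⁻ x, w x ∂μ) ^ (1 / 2 : ℝ) * (∫⁻ x, w x * h x ^ (2 : ℝ) ∂μ) ^ (1 / 2 : ℝ)) ^ 2 := by
        gcongr
    _ = _ := by
        rw [mul_pow, ← ENNReal.rpow_two, ← ENNReal.rpow_two, e2, e2]
        simp only [ENNReal.rpow_two]

/-- Schur's test, for a kernel which is dominated by a superposition of translations. -/
lemma norm_toL2_le_of_kernel (k : V →L[ℝ] R3) {F H : SF} {w : V → ℝ} (hw : Integrable w)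
    (hw0 : ∀ κ, 0 ≤ w κ)
    (h : ∀ ξ, ‖F ξ‖ₑ ≤ ∫⁻ κ, ENNReal.ofReal (w κ) * ‖H (ξ - k κ)‖ₑ) :
    ‖toL2 F‖ ≤ (∫ κ, w κ) * ‖toL2 H‖ := by
  set W : ℝ≥0∞ := ∫⁻ κ, ENNReal.ofReal (w κ) with hW
  have hWi : W = ENNReal.ofReal (∫ κ, w κ) :=
    (ofReal_integral_eq_lintegral_ofReal hw (Eventually.of_forall hw0)).symm
  have hwm : AEMeasurable (fun κ => ENNReal.ofReal (w κ)) :=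
    hw.aestronglyMeasurable.aemeasurable.ennreal_ofReal
  have hHm : Measurable fun p : R3 × V => ‖H (p.1 - k p.2)‖ₑ := by
    have : Continuous fun p : R3 × V => H (p.1 - k p.2) :=
      H.continuous.comp (continuous_fst.sub (k.continuous.comp continuous_snd))
    exact this.measurable.enorm
  have main : ∫⁻ ξ, ‖F ξ‖ₑ ^ 2 ≤ W ^ 2 * ∫⁻ ξ, ‖H ξ‖ₑ ^ 2 := by
    calc ∫⁻ ξ, ‖F ξ‖ₑ ^ 2
        ≤ ∫⁻ ξ, (W * ∫⁻ κ, ENNReal.ofReal (w κ) * ‖H (ξ - k κ)‖ₑ ^ 2) := by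
          refine lintegral_mono fun ξ => ?_
          refine le_trans (pow_le_pow_left' (h ξ) 2) ?_
          exact sq_lintegral_mul_le volume hwm (hHm.comp measurable_prodMk_left).aemeasurable
      _ = W * ∫⁻ ξ, ∫⁻ κ, ENNReal.ofReal (w κ) * ‖H (ξ - k κ)‖ₑ ^ 2 := by
          rw [lintegral_const_mul' _ _ (by rw [hWi]; exact ENNReal.ofReal_ne_top)]
      _ = W * ∫⁻ κ, ∫⁻ ξ, ENNReal.ofReal (w κ) * ‖H (ξ - k κ)‖ₑ ^ 2 := by
          rw [lintegral_lintegral_swap]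
          exact ((hwm.comp_snd).mul (hHm.pow_const 2).aemeasurable)
      _ = W * ∫⁻ κ, ENNReal.ofReal (w κ) * ∫⁻ ξ, ‖H ξ‖ₑ ^ 2 := by
          congr 1
          refine lintegral_congr fun κ => ?_
          rw [lintegral_const_mul' _ _ ENNReal.ofReal_ne_top]
          congr 1
          exact lintegral_sub_right_eq_self (fun ξ => ‖H ξ‖ₑ ^ 2) (k κ)
      _ = W ^ 2 * ∫⁻ ξ, ‖H ξ‖ₑ ^ 2 := by
          rw [lintegral_mul_const'' _ hwm]
          ring
  have conv : ∀ G : SF, eLpNorm G 2 volume = (∫⁻ ξ, ‖G ξ‖ₑ ^ 2) ^ (1 / 2 : ℝ) := fun G => by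
    rw [eLpNorm_eq_lintegral_rpow_enorm_toReal two_ne_zero ENNReal.ofNat_ne_top]
    simp
  have main2 : eLpNorm F 2 volume ≤ W * eLpNorm H 2 volume := by
    rw [conv, conv]
    refine le_trans (ENNReal.rpow_le_rpow main (by norm_num)) ?_
    rw [ENNReal.mul_rpow_of_nonneg _ _ (by norm_num)]
    gcongr
    rw [← ENNReal.rpow_two, ← ENNReal.rpow_mul]
    norm_num
  simp only [toL2, SchwartzMap.toLpCLM_apply, SchwartzMap.norm_toLp]
  have h0 : 0 ≤ ∫ κ, w κ := integral_nonneg hw0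
  calc _ ≤ (W * eLpNorm H 2 volume).toReal :=
        ENNReal.toReal_mono (ENNReal.mul_ne_top (by rw [hWi]; exact ENNReal.ofReal_ne_top)
          (H.memLp 2 volume).2.ne) main2
    _ = _ := by rw [ENNReal.toReal_mul, hWi, ENNReal.toReal_ofReal h0]

lemma integrable_fourier_mul_moment (A : SchwartzMap V ℂ) {p : ℝ} (hp : 0 ≤ p) :
    Integrable fun κ => ‖𝓕 A κ‖ * (1 + 2 * Real.pi * ‖κ‖) ^ p := by
  have hg := Function.hasTemperateGrowth_one_add_norm_sq_rpow V (p / 2)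
  have hi := (SchwartzMap.smulLeftCLM ℂ (fun x : V => (1 + ‖x‖ ^ 2) ^ (p / 2)) (𝓕 A)).integrable
    (μ := volume)
  have hpi := Real.pi_pos
  refine (hi.norm.const_mul ((1 + 2 * Real.pi) ^ p)).mono' ?_ (Eventually.of_forall fun κ => ?_)
  · refine Continuous.aestronglyMeasurable ?_
    refine (𝓕 A).continuous.norm.mul (Continuous.rpow_const (by fun_prop) fun x => Or.inr hp)
  · rw [SchwartzMap.smulLeftCLM_apply_apply hg, norm_smul, norm_mul, norm_norm, Real.norm_eq_abs,
      Real.norm_eq_abs, abs_of_nonneg (by positivity), abs_of_nonneg (by positivity)]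
    have h1 : 1 + 2 * Real.pi * ‖κ‖ ≤ (1 + 2 * Real.pi) * √(1 + ‖κ‖ ^ 2) := by
      have h2 : 1 ≤ √(1 + ‖κ‖ ^ 2) := Real.one_le_sqrt.2 (by nlinarith [sq_nonneg ‖κ‖])
      have h3 : ‖κ‖ ≤ √(1 + ‖κ‖ ^ 2) := Real.le_sqrt_of_sq_le (by linarith)
      nlinarith [mul_le_mul_of_nonneg_left h3 hpi.le]
    have h2 : (1 + 2 * Real.pi * ‖κ‖) ^ p ≤ ((1 + 2 * Real.pi) * √(1 + ‖κ‖ ^ 2)) ^ p :=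
      Real.rpow_le_rpow (by positivity) h1 hp
    rw [Real.mul_rpow (by positivity) (by positivity), Real.sqrt_eq_rpow, ← Real.rpow_mul
      (by positivity)] at h2
    have e : (1 / 2 : ℝ) * p = p / 2 := by ring
    rw [e] at h2
    calc _ ≤ ‖𝓕 A κ‖ * ((1 + 2 * Real.pi) ^ p * (1 + ‖κ‖ ^ 2) ^ (p / 2)) := by gcongr
      _ = _ := by ring

/-- The Fourier transform of the product of `v` with a function `A ∘ π` of some of the variables is
a superposition of translates of the Fourier transform of `v`. -/
lemma fourier_mulOp_comp (A : SchwartzMap V ℂ) (k : V →L[ℝ] R3) (π : R3 →L[ℝ] V)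
    (hadj : ∀ x κ, inner ℝ (π x) κ = inner ℝ x (k κ)) (v : SF) (ξ : R3) :
    𝓕 (mulOp (fun x => A (π x)) v) ξ = ∫ κ, 𝓕 A κ * 𝓕 v (ξ - k κ) := by
  have hA : (fun x => A (π x)).HasTemperateGrowth :=
    A.hasTemperateGrowth.comp π.hasTemperateGrowth
  have hinv : ∀ y : V,
      A y = ∫ κ, Complex.exp (↑(2 * Real.pi * inner ℝ κ y) * Complex.I) * 𝓕 A κ := by
    intro y
    have hA' : (𝓕⁻ (𝓕 A) : SchwartzMap V ℂ) = A := by simp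
    conv_lhs => rw [← hA']
    rw [SchwartzMap.fourierInv_coe, Real.fourierInv_eq']
    simp
  have hF : ∀ (w : SF) (η : R3),
      𝓕 w η = ∫ x, Complex.exp (↑(-2 * Real.pi * inner ℝ x η) * Complex.I) * w x := by
    intro w η
    rw [SchwartzMap.fourier_coe, Real.fourier_eq']
    simp
  rw [hF]
  simp only [mulOp_apply hA]
  have s1 : ∀ x : R3, Complex.exp (↑(-2 * Real.pi * inner ℝ x ξ) * Complex.I) * (A (π x) * v x) =
      ∫ κ, Complex.exp (↑(-2 * Real.pi * inner ℝ x (ξ - k κ)) * Complex.I) * (𝓕 A κ * v x) := by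
    intro x
    rw [hinv (π x), ← integral_mul_const, ← integral_const_mul]
    congr 1
    ext κ
    rw [inner_sub_right, ← hadj, real_inner_comm (π x) κ]
    have : Complex.exp (↑(-2 * Real.pi * (inner ℝ x ξ - inner ℝ (π x) κ)) * Complex.I) =
        Complex.exp (↑(-2 * Real.pi * inner ℝ x ξ) * Complex.I) *
          Complex.exp (↑(2 * Real.pi * inner ℝ (π x) κ) * Complex.I) := by
      rw [← Complex.exp_add]
      congr 1
      push_cast
      ring
    rw [this]
    ring
  simp_rw [s1]
  rw [integral_integral_swap]
  · congr 1
    ext κ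
    rw [hF, ← integral_const_mul]
    congr 1
    ext x
    ring
  · have hi : Integrable (fun p : R3 × V => v p.1 * 𝓕 A p.2) (volume.prod volume) :=
      (v.integrable (μ := volume)).mul_prod ((𝓕 A).integrable (μ := volume))
    refine hi.mono ?_ (Eventually.of_forall fun p => ?_)
    · refine Continuous.aestronglyMeasurable ?_
      have h1 : Continuous fun p : R3 × V => inner ℝ p.1 (ξ - k p.2) :=
        continuous_fst.inner (continuous_const.sub (k.continuous.comp continuous_snd))
      have h2 : Continuous fun p : R3 × V => 𝓕 A p.2 := (𝓕 A).continuous.comp continuous_snd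
      have h3 : Continuous fun p : R3 × V => v p.1 := v.continuous.comp continuous_fst
      simp only [Function.uncurry_def]
      fun_prop
    · simp only [Function.uncurry_def, norm_mul, Complex.norm_exp_ofReal_mul_I, one_mul]
      rw [mul_comm]

variable (A : SchwartzMap V ℂ) (k : V →L[ℝ] R3) (π : R3 →L[ℝ] V)

/-- Multiplication by a function `A ∘ π` of some of the variables is bounded in the norms defined by
`J ε s`, uniformly in `ε`. The map `k` is the adjoint of `π`. -/
lemma norm_J_mulOp_comp_le (hadj : ∀ x κ, inner ℝ (π x) κ = inner ℝ x (k κ))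
    (hk : ∀ κ, ‖k κ‖ ≤ ‖κ‖) (s : ℝ) :
    ∃ K : ℝ, 0 ≤ K ∧ ∀ ε, 0 ≤ ε → ε ≤ 1 → ∀ v : SF,
      ‖toL2 (J ε s (mulOp (fun x => A (π x)) v))‖ ≤ K * ‖toL2 (J ε s v)‖ := by
  have hpi := Real.pi_pos
  refine ⟨∫ κ, ‖𝓕 A κ‖ * (1 + 2 * Real.pi * ‖κ‖) ^ |s|, integral_nonneg fun κ => by positivity,
    fun ε h0 h1 v => ?_⟩
  rw [← norm_toL2_fourier, ← norm_toL2_fourier (J ε s v)]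
  refine norm_toL2_le_of_kernel k (integrable_fourier_mul_moment A (abs_nonneg s))
    (fun κ => by positivity) fun ξ => ?_
  rw [fourier_J_apply, fourier_mulOp_comp A k π hadj, ← integral_const_mul]
  refine (enorm_integral_le_lintegral_enorm _).trans (lintegral_mono fun κ => ?_)
  rw [fourier_J_apply, ← ofReal_norm, ← ofReal_norm,
    ← ENNReal.ofReal_mul (by positivity)]
  refine ENNReal.ofReal_le_ofReal ?_
  rw [norm_mul, norm_mul, norm_mul, Complex.norm_real, Complex.norm_real,
    Real.norm_of_nonneg (wt_pos _ _ _).le, Real.norm_of_nonneg (wt_pos _ _ _).le]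
  have h2 : wt ε s ξ ≤ (1 + 2 * Real.pi * ‖κ‖) ^ |s| * wt ε s (ξ - k κ) := by
    refine (wt_le_mul_wt ε s ξ (k κ)).trans ?_
    have := wt_pos ε s (ξ - k κ)
    have h3 : ‖scaleFreq ε (k κ)‖ ≤ 2 * Real.pi * ‖κ‖ :=
      (norm_scaleFreq_le h0 h1 _).trans (by gcongr; exact hk κ)
    gcongr
  calc _ ≤ ((1 + 2 * Real.pi * ‖κ‖) ^ |s| * wt ε s (ξ - k κ)) *
        (‖𝓕 A κ‖ * ‖𝓕 v (ξ - k κ)‖) := by gcongr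
    _ = _ := by ring

/-- The commutator of `J ε s` with multiplication by `A ∘ π` has order `s - 1`, and its size is
proportional to `ε`, provided that the frequencies of `A ∘ π` are horizontal. -/
lemma norm_J_mulOp_comp_sub_le (hadj : ∀ x κ, inner ℝ (π x) κ = inner ℝ x (k κ))
    (hk : ∀ κ, ‖k κ‖ ≤ ‖κ‖) (hk2 : ∀ κ, k κ 2 = 0) (s : ℝ) :
    ∃ K : ℝ, 0 ≤ K ∧ ∀ ε, 0 ≤ ε → ε ≤ 1 → ∀ v : SF,
      ‖toL2 (J ε s (mulOp (fun x => A (π x)) v) - mulOp (fun x => A (π x)) (J ε s v))‖ ≤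
        ε * K * ‖toL2 (J ε (s - 1) v)‖ := by
  have hpi := Real.pi_pos
  have hp : 0 ≤ |s - 1| + 1 := by positivity
  refine ⟨|s| * ∫ κ, ‖𝓕 A κ‖ * (1 + 2 * Real.pi * ‖κ‖) ^ (|s - 1| + 1),
    mul_nonneg (abs_nonneg s) (integral_nonneg fun κ => by positivity), fun ε h0 h1 v => ?_⟩
  rw [← norm_toL2_fourier, ← norm_toL2_fourier (J ε (s - 1) v), ← mul_assoc, ← integral_const_mul]
  refine norm_toL2_le_of_kernel k
    ((integrable_fourier_mul_moment A hp).const_mul (ε * |s|))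
    (fun κ => by positivity) fun ξ => ?_
  have hJ : 𝓕 (J ε s (mulOp (fun x => A (π x)) v) - mulOp (fun x => A (π x)) (J ε s v)) ξ =
      ∫ κ, ((wt ε s ξ : ℂ) - wt ε s (ξ - k κ)) * (𝓕 A κ * 𝓕 v (ξ - k κ)) := by
    have hint : ∀ w : SF, Integrable fun κ => 𝓕 A κ * 𝓕 w (ξ - k κ) := fun w => by
      have hb : ∃ C, ∀ κ, ‖𝓕 w (ξ - k κ)‖ ≤ C :=
        ⟨_, fun κ => SchwartzMap.norm_le_seminorm ℝ (𝓕 w) _⟩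
      obtain ⟨C, hC⟩ := hb
      refine ((𝓕 A).integrable (μ := volume)).mul_bdd ?_ (Eventually.of_forall hC)
      exact ((𝓕 w).continuous.comp
        (continuous_const.sub k.continuous)).aestronglyMeasurable
    have hsub : ∀ f g : SF, 𝓕 (f - g) = 𝓕 f - 𝓕 g := fun f g =>
      (FourierTransform.fourierCLM ℂ SF).map_sub f g
    rw [hsub, sub_apply, fourier_J_apply, fourier_mulOp_comp A k π hadj,
      fourier_mulOp_comp A k π hadj, ← integral_const_mul, ← integral_sub
      ((hint v).const_mul _) (hint _)]
    congr 1
    ext κ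
    rw [fourier_J_apply]
    ring
  rw [hJ]
  refine (enorm_integral_le_lintegral_enorm _).trans (lintegral_mono fun κ => ?_)
  rw [fourier_J_apply, ← ofReal_norm, ← ofReal_norm,
    ← ENNReal.ofReal_mul (by positivity)]
  refine ENNReal.ofReal_le_ofReal ?_
  rw [norm_mul, norm_mul, norm_mul, ← Complex.ofReal_sub, Complex.norm_real, Complex.norm_real,
    Real.norm_eq_abs, Real.norm_of_nonneg (wt_pos _ _ _).le]
  have hw := wt_pos ε (s - 1) (ξ - k κ)
  have h2 : |wt ε s ξ - wt ε s (ξ - k κ)| ≤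
      ε * |s| * (1 + 2 * Real.pi * ‖κ‖) ^ (|s - 1| + 1) * wt ε (s - 1) (ξ - k κ) := by
    refine (abs_wt_sub_le ε s ξ (k κ)).trans ?_
    have h3 : ‖scaleFreq ε (k κ)‖ ≤ 2 * Real.pi * ‖κ‖ :=
      (norm_scaleFreq_le h0 h1 _).trans (by gcongr; exact hk κ)
    have h4 : ‖scaleFreq ε (k κ)‖ ≤ ε * (1 + 2 * Real.pi * ‖κ‖) := by
      rw [norm_scaleFreq_of_vertical_zero h0 (hk2 κ)]
      have : 2 * Real.pi * ‖k κ‖ ≤ 2 * Real.pi * ‖κ‖ := by gcongr; exact hk κ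
      gcongr
      linarith
    rw [Real.rpow_add_one (by positivity)]
    calc _ ≤ |s| * (ε * (1 + 2 * Real.pi * ‖κ‖)) * (1 + 2 * Real.pi * ‖κ‖) ^ |s - 1| *
          wt ε (s - 1) (ξ - k κ) := by gcongr
      _ = _ := by ring
  calc _ ≤ (ε * |s| * (1 + 2 * Real.pi * ‖κ‖) ^ (|s - 1| + 1) * wt ε (s - 1) (ξ - k κ)) *
        (‖𝓕 A κ‖ * ‖𝓕 v (ξ - k κ)‖) := by gcongr
    _ = _ := by ring

end Kernel

/-! ### The vector fields on the Schwartz space -/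

/-- The projection `(z, t) ↦ z` as a continuous linear map. -/
def zcL : R3 →L[ℝ] ℂ :=
  (EuclideanSpace.proj (0 : Fin 3) : R3 →L[ℝ] ℝ).smulRight (1 : ℂ) +
    (EuclideanSpace.proj (1 : Fin 3) : R3 →L[ℝ] ℝ).smulRight Complex.I

lemma zcL_apply (p : R3) : zcL p = zc p := by
  apply Complex.ext <;> simp [zcL, zc]

/-- The inclusion of the horizontal frequencies, adjoint to `(z, t) ↦ z`. -/
def horizontal : ℂ →L[ℝ] R3 :=
  Complex.reCLM.smulRight (EuclideanSpace.single 0 (1 : ℝ) : R3) +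
    Complex.imCLM.smulRight (EuclideanSpace.single 1 (1 : ℝ) : R3)

lemma horizontal_two (w : ℂ) : horizontal w 2 = 0 := by simp [horizontal]

lemma norm_horizontal (w : ℂ) : ‖horizontal w‖ = ‖w‖ := by
  have h : ‖horizontal w‖ ^ 2 = ‖w‖ ^ 2 := by
    rw [norm_sq_R3, Complex.sq_norm, Complex.normSq_apply]
    simp [horizontal]
    ring
  exact (pow_left_inj₀ (norm_nonneg _) (norm_nonneg _) two_ne_zero).1 h

lemma inner_zcL (x : R3) (w : ℂ) : inner ℝ (zcL x) w = inner ℝ x (horizontal w) := by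
  rw [zcL_apply, Complex.inner, PiLp.inner_apply, Fin.sum_univ_three]
  simp [horizontal, zc]

/-- Smooth functions with compact support. -/
structure IsTest {E : Type*} [NormedAddCommGroup E] [NormedSpace ℝ E] (a : E → ℂ) : Prop where
  smooth : ContDiff ℝ ∞ a
  compact : HasCompactSupport a

namespace IsTest

variable {E : Type*} [NormedAddCommGroup E] [NormedSpace ℝ E] {a b : E → ℂ}

lemma hasTemperateGrowth (ha : IsTest a) : a.HasTemperateGrowth :=
  ha.compact.hasTemperateGrowth ha.smooth

lemma mul_left (ha : IsTest a) (hb : ContDiff ℝ ∞ b) : IsTest fun x => b x * a x :=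
  ⟨hb.mul ha.smooth, ha.compact.mul_left⟩

lemma mul_right (ha : IsTest a) (hb : ContDiff ℝ ∞ b) : IsTest fun x => a x * b x :=
  ⟨ha.smooth.mul hb, ha.compact.mul_right⟩

lemma add (ha : IsTest a) (hb : IsTest b) : IsTest fun x => a x + b x :=
  ⟨ha.smooth.add hb.smooth, ha.compact.add hb.compact⟩

lemma conjugate (ha : IsTest a) : IsTest fun x => conj (a x) :=
  ⟨Complex.conjCLE.contDiff.comp ha.smooth, ha.compact.comp_left (map_zero _)⟩

lemma fderiv_apply (ha : IsTest a) (v : E) : IsTest fun x => fderiv ℝ a x v :=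
  ⟨(ha.smooth.fderiv_right (m := ∞) (by simp)).clm_apply contDiff_const,
    ha.compact.fderiv_apply (𝕜 := ℝ) v⟩

end IsTest

lemma dz_eq (a : ℂ → ℂ) :
    dz a = fun z => (1 / 2 : ℂ) * (fderiv ℝ a z 1 + -Complex.I * fderiv ℝ a z Complex.I) := by
  ext z; simp [dz]; ring

lemma dzbar_eq (a : ℂ → ℂ) :
    dzbar a = fun z => (1 / 2 : ℂ) * (fderiv ℝ a z 1 + Complex.I * fderiv ℝ a z Complex.I) := rfl

lemma IsTest.dz {a : ℂ → ℂ} (ha : IsTest a) : IsTest (dz a) := by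
  rw [dz_eq]
  exact ((ha.fderiv_apply 1).add ((ha.fderiv_apply Complex.I).mul_left
    (contDiff_const (c := -Complex.I)))).mul_left (contDiff_const (c := (1 / 2 : ℂ)))

lemma IsTest.dzbar {a : ℂ → ℂ} (ha : IsTest a) : IsTest (dzbar a) := by
  rw [dzbar_eq]
  exact ((ha.fderiv_apply 1).add ((ha.fderiv_apply Complex.I).mul_left
    (contDiff_const (c := Complex.I)))).mul_left (contDiff_const (c := (1 / 2 : ℂ)))

lemma hasTemperateGrowth_fderiv_apply {E : Type*} [NormedAddCommGroup E] [NormedSpace ℝ E]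
    {a : E → ℂ} (ha : a.HasTemperateGrowth) (v : E) :
    (fun x => fderiv ℝ a x v).HasTemperateGrowth := by
  have h1 : (fderiv ℝ a).HasTemperateGrowth := by
    refine ⟨ha.1.fderiv_right (m := ∞) (by simp), fun n => ?_⟩
    obtain ⟨k, C, h⟩ := ha.2 (n + 1)
    exact ⟨k, C, fun x => by rw [norm_iteratedFDeriv_fderiv]; exact h x⟩
  exact (ContinuousLinearMap.apply ℝ ℂ v).hasTemperateGrowth.comp h1

lemma hasTemperateGrowth_dz {a : ℂ → ℂ} (ha : a.HasTemperateGrowth) :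
    (dz a).HasTemperateGrowth := by
  rw [dz_eq]
  have h1 := hasTemperateGrowth_fderiv_apply ha 1
  have h2 := hasTemperateGrowth_fderiv_apply ha Complex.I
  fun_prop

lemma hasTemperateGrowth_dzbar {a : ℂ → ℂ} (ha : a.HasTemperateGrowth) :
    (dzbar a).HasTemperateGrowth := by
  rw [dzbar_eq]
  have h1 := hasTemperateGrowth_fderiv_apply ha 1
  have h2 := hasTemperateGrowth_fderiv_apply ha Complex.I
  fun_prop

lemma hasTemperateGrowth_conj {a : ℂ → ℂ} (ha : a.HasTemperateGrowth) :
    (fun z => conj (a z)).HasTemperateGrowth :=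
  (Complex.conjCLE.toContinuousLinearMap.hasTemperateGrowth).comp ha

lemma hasTemperateGrowth_conj_id : (fun z : ℂ => conj z).HasTemperateGrowth :=
  hasTemperateGrowth_conj (a := fun z => z) Function.HasTemperateGrowth.id'

lemma hasTemperateGrowth_comp_zc {a : ℂ → ℂ} (ha : a.HasTemperateGrowth) :
    (fun p => a (zc p)).HasTemperateGrowth := by
  simpa only [← zcL_apply, Function.comp_def] using ha.comp zcL.hasTemperateGrowth

/-- Multiplication by the function `a(z)` of `z` alone. -/
def mulZ (a : ℂ → ℂ) : SF →L[ℂ] SF := mulOp fun p => a (zc p)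

section mulZ

variable {a b : ℂ → ℂ}

lemma mulZ_apply (ha : a.HasTemperateGrowth) (v : SF) (p : R3) :
    mulZ a v p = a (zc p) * v p := mulOp_apply (hasTemperateGrowth_comp_zc ha) v p

lemma mulZ_mulZ (ha : a.HasTemperateGrowth) (hb : b.HasTemperateGrowth) (v : SF) :
    mulZ a (mulZ b v) = mulZ (fun z => a z * b z) v :=
  mulOp_mulOp (hasTemperateGrowth_comp_zc ha) (hasTemperateGrowth_comp_zc hb) v

lemma mulZ_comm (ha : a.HasTemperateGrowth) (hb : b.HasTemperateGrowth) (v : SF) :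
    mulZ a (mulZ b v) = mulZ b (mulZ a v) :=
  mulOp_comm (hasTemperateGrowth_comp_zc ha) (hasTemperateGrowth_comp_zc hb) v

lemma inner_mulZ (ha : a.HasTemperateGrowth) (f g : SF) :
    inner ℂ (toL2 (mulZ a f)) (toL2 g) =
      inner ℂ (toL2 f) (toL2 (mulZ (fun z => conj (a z)) g)) :=
  inner_mulOp (hasTemperateGrowth_comp_zc ha)
    (hasTemperateGrowth_comp_zc (hasTemperateGrowth_conj ha)) f g

lemma norm_mulZ_eq (ha : a.HasTemperateGrowth) (hb : b.HasTemperateGrowth)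
    (h : ∀ z, ‖a z‖ = ‖b z‖) (v : SF) : ‖toL2 (mulZ a v)‖ = ‖toL2 (mulZ b v)‖ := by
  apply le_antisymm
  · rw [← one_mul ‖toL2 (mulZ b v)‖]
    exact norm_toL2_le fun x => by
      rw [mulZ_apply ha, mulZ_apply hb, norm_mul, norm_mul, h, one_mul]
  · rw [← one_mul ‖toL2 (mulZ a v)‖]
    exact norm_toL2_le fun x => by
      rw [mulZ_apply ha, mulZ_apply hb, norm_mul, norm_mul, h, one_mul]

lemma fderiv_comp_zc (ha : Differentiable ℝ a) (p v : R3) :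
    fderiv ℝ (fun p => a (zc p)) p v = fderiv ℝ a (zc p) (zc v) := by
  simp only [← zcL_apply]
  have := fderiv_comp p (ha (zcL p)) zcL.differentiableAt
  simp only [Function.comp_def] at this
  rw [this]
  simp

lemma zc_single_zero : zc (EuclideanSpace.single 0 (1 : ℝ)) = 1 := by
  apply Complex.ext <;> simp [zc]

lemma zc_single_one : zc (EuclideanSpace.single 1 (1 : ℝ)) = Complex.I := by
  apply Complex.ext <;> simp [zc]

lemma zc_single_two : zc (EuclideanSpace.single 2 (1 : ℝ)) = 0 := by
  apply Complex.ext <;> simp [zc]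

lemma pd_zero_comp_zc (ha : Differentiable ℝ a) :
    pd 0 (fun p => a (zc p)) = fun p => fderiv ℝ a (zc p) 1 := by
  ext p; rw [pd, fderiv_comp_zc ha, zc_single_zero]

lemma pd_one_comp_zc (ha : Differentiable ℝ a) :
    pd 1 (fun p => a (zc p)) = fun p => fderiv ℝ a (zc p) Complex.I := by
  ext p; rw [pd, fderiv_comp_zc ha, zc_single_one]

lemma pd_two_comp_zc (ha : Differentiable ℝ a) :
    pd 2 (fun p => a (zc p)) = fun _ => 0 := by
  ext p; rw [pd, fderiv_comp_zc ha, zc_single_two, map_zero]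

lemma Dc_zero_mulZ (ha : a.HasTemperateGrowth) (v : SF) :
    Dc 0 (mulZ a v) = mulZ (fun z => fderiv ℝ a z 1) v + mulZ a (Dc 0 v) := by
  have hd : Differentiable ℝ a := ha.1.differentiable (by simp)
  have h := pd_zero_comp_zc hd
  have h2 := hasTemperateGrowth_comp_zc (hasTemperateGrowth_fderiv_apply ha 1)
  unfold mulZ
  rw [Dc_mulOp (hasTemperateGrowth_comp_zc ha) 0 (by rw [h]; exact h2), h]

lemma Dc_one_mulZ (ha : a.HasTemperateGrowth) (v : SF) :
    Dc 1 (mulZ a v) = mulZ (fun z => fderiv ℝ a z Complex.I) v + mulZ a (Dc 1 v) := by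
  have hd : Differentiable ℝ a := ha.1.differentiable (by simp)
  have h := pd_one_comp_zc hd
  have h2 := hasTemperateGrowth_comp_zc (hasTemperateGrowth_fderiv_apply ha Complex.I)
  unfold mulZ
  rw [Dc_mulOp (hasTemperateGrowth_comp_zc ha) 1 (by rw [h]; exact h2), h]

lemma Dc_two_mulZ (ha : a.HasTemperateGrowth) (v : SF) :
    Dc 2 (mulZ a v) = mulZ a (Dc 2 v) := by
  have hd : Differentiable ℝ a := ha.1.differentiable (by simp)
  have h := pd_two_comp_zc hd
  unfold mulZ
  rw [Dc_mulOp (hasTemperateGrowth_comp_zc ha) 2 (by rw [h]; fun_prop), h]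
  simp [mulOp]

end mulZ

/-- `∂_z` on the Schwartz space. -/
def opDz : SF →L[ℂ] SF := (1 / 2 : ℂ) • (Dc 0 - Complex.I • Dc 1)

/-- `∂_{z̄}` on the Schwartz space. -/
def opDzbar : SF →L[ℂ] SF := (1 / 2 : ℂ) • (Dc 0 + Complex.I • Dc 1)

lemma opDz_apply (v : SF) : opDz v = (1 / 2 : ℂ) • (Dc 0 v - Complex.I • Dc 1 v) := rfl

lemma opDzbar_apply (v : SF) : opDzbar v = (1 / 2 : ℂ) • (Dc 0 v + Complex.I • Dc 1 v) := rfl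

/-- The operator `∂_z - i a(z) ∂_t`. -/
def opL (a : ℂ → ℂ) (v : SF) : SF := opDz v - Complex.I • mulZ a (Dc 2 v)

/-- The operator `∂_{z̄} + i (conj a(z)) ∂_t`. -/
def opLbar (a : ℂ → ℂ) (v : SF) : SF :=
  opDzbar v + Complex.I • mulZ (fun z => conj (a z)) (Dc 2 v)

lemma opDz_mulZ {b : ℂ → ℂ} (hb : b.HasTemperateGrowth) (v : SF) :
    opDz (mulZ b v) = mulZ (dz b) v + mulZ b (opDz v) := by
  ext p
  have h1 := hasTemperateGrowth_fderiv_apply hb 1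
  have h2 := hasTemperateGrowth_fderiv_apply hb Complex.I
  simp only [opDz_apply, Dc_zero_mulZ hb, Dc_one_mulZ hb, add_apply, sub_apply, smul_apply,
    mulZ_apply hb, mulZ_apply (hasTemperateGrowth_dz hb), mulZ_apply h1, mulZ_apply h2, smul_eq_mul,
    dz]
  ring

lemma opDzbar_mulZ {b : ℂ → ℂ} (hb : b.HasTemperateGrowth) (v : SF) :
    opDzbar (mulZ b v) = mulZ (dzbar b) v + mulZ b (opDzbar v) := by
  ext p
  have h1 := hasTemperateGrowth_fderiv_apply hb 1
  have h2 := hasTemperateGrowth_fderiv_apply hb Complex.I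
  simp only [opDzbar_apply, Dc_zero_mulZ hb, Dc_one_mulZ hb, add_apply, smul_apply,
    mulZ_apply hb, mulZ_apply (hasTemperateGrowth_dzbar hb), mulZ_apply h1, mulZ_apply h2,
    smul_eq_mul, dzbar]
  ring

lemma opL_mulZ {a b : ℂ → ℂ} (ha : a.HasTemperateGrowth) (hb : b.HasTemperateGrowth) (v : SF) :
    opL a (mulZ b v) = mulZ (dz b) v + mulZ b (opL a v) := by
  rw [opL, opL, opDz_mulZ hb, Dc_two_mulZ hb, mulZ_comm ha hb, map_sub, map_smul]
  abel

lemma opLbar_mulZ {a b : ℂ → ℂ} (ha : a.HasTemperateGrowth) (hb : b.HasTemperateGrowth)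
    (v : SF) : opLbar a (mulZ b v) = mulZ (dzbar b) v + mulZ b (opLbar a v) := by
  rw [opLbar, opLbar, opDzbar_mulZ hb, Dc_two_mulZ hb, mulZ_comm (hasTemperateGrowth_conj ha) hb,
    map_add, map_smul]
  abel

lemma inner_opDzbar (f g : SF) :
    inner ℂ (toL2 (opDzbar f)) (toL2 g) = - inner ℂ (toL2 f) (toL2 (opDz g)) := by
  simp only [opDzbar_apply, opDz_apply, map_smul, map_add, map_sub, inner_smul_left,
    inner_smul_right, inner_add_left, inner_sub_right, inner_Dc, map_div₀, map_one, map_ofNat,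
    Complex.conj_I]
  ring

/-- The formal adjoint of `L̄` is `-L`. -/
lemma inner_opLbar {a : ℂ → ℂ} (ha : a.HasTemperateGrowth) (f g : SF) :
    inner ℂ (toL2 (opLbar a f)) (toL2 g) = - inner ℂ (toL2 f) (toL2 (opL a g)) := by
  simp only [opLbar, opL, map_smul, map_add, map_sub, inner_smul_left,
    inner_smul_right, inner_add_left, inner_sub_right, inner_opDzbar,
    inner_mulZ (hasTemperateGrowth_conj ha), inner_Dc, Complex.conj_conj, Dc_two_mulZ ha,
    Complex.conj_I]
  ring

lemma inner_opL {a : ℂ → ℂ} (ha : a.HasTemperateGrowth) (f g : SF) :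
    inner ℂ (toL2 (opL a f)) (toL2 g) = - inner ℂ (toL2 f) (toL2 (opLbar a g)) := by
  rw [← inner_conj_symm, ← inner_conj_symm (toL2 f), inner_opLbar ha, map_neg, neg_neg]

lemma dzbar_conj : dzbar (fun z => conj z) = fun _ => 1 := by
  ext z
  have : fderiv ℝ (fun z : ℂ => conj z) z = Complex.conjCLE.toContinuousLinearMap :=
    Complex.conjCLE.toContinuousLinearMap.hasFDerivAt.fderiv
  rw [dzbar, this]
  simp
  norm_num

lemma dz_conj : dz (fun z => conj z) = fun _ => 0 := by
  ext z
  have : fderiv ℝ (fun z : ℂ => conj z) z = Complex.conjCLE.toContinuousLinearMap :=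
    Complex.conjCLE.toContinuousLinearMap.hasFDerivAt.fderiv
  rw [dz, this]
  simp

/-- Multiplication by `z̄`. -/
abbrev mulZbar : SF →L[ℂ] SF := mulZ fun z => conj z

lemma opLbar_mulZbar {a : ℂ → ℂ} (ha : a.HasTemperateGrowth) (v : SF) :
    opLbar a (mulZbar v) = v + mulZbar (opLbar a v) := by
  rw [opLbar_mulZ ha hasTemperateGrowth_conj_id, dzbar_conj]
  congr 1
  simp [mulZ, mulOp]

lemma opL_mulZbar {a : ℂ → ℂ} (ha : a.HasTemperateGrowth) (v : SF) :
    opL a (mulZbar v) = mulZbar (opL a v) := by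
  rw [opL_mulZ ha hasTemperateGrowth_conj_id, dz_conj]
  simp [mulZ, mulOp]

/-- The basic estimate, which follows from `[L̄, z̄] = 1`. -/
lemma norm_le_mulZbar_opL_add {a : ℂ → ℂ} (ha : a.HasTemperateGrowth) (v : SF) :
    ‖toL2 v‖ ≤ ‖toL2 (mulZbar (opL a v))‖ + ‖toL2 (mulZbar (opLbar a v))‖ := by
  have h1 : inner ℂ (toL2 v) (toL2 v) =
      - inner ℂ (toL2 v) (toL2 (mulZ (fun z => conj (conj z)) (opL a v)))
        - inner ℂ (toL2 (mulZbar (opLbar a v))) (toL2 v) := by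
    have h2 : v = opLbar a (mulZbar v) - mulZbar (opLbar a v) := by
      rw [opLbar_mulZbar ha]; abel
    have h5 : toL2 v = toL2 (opLbar a (mulZbar v)) - toL2 (mulZbar (opLbar a v)) := by
      rw [← map_sub, ← h2]
    conv_lhs => lhs; rw [h5]
    rw [inner_sub_left, inner_opLbar ha, inner_mulZ hasTemperateGrowth_conj_id]
  have h3 : ‖toL2 (mulZ (fun z => conj (conj z)) (opL a v))‖ = ‖toL2 (mulZbar (opL a v))‖ :=
    norm_mulZ_eq (hasTemperateGrowth_conj hasTemperateGrowth_conj_id) hasTemperateGrowth_conj_id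
      (fun z => by simp) _
  have h4 : ‖toL2 v‖ * ‖toL2 v‖ ≤
      (‖toL2 (mulZbar (opL a v))‖ + ‖toL2 (mulZbar (opLbar a v))‖) * ‖toL2 v‖ := by
    rw [← inner_self_eq_norm_mul_norm (𝕜 := ℂ), h1]
    refine (RCLike.re_le_norm _).trans ?_
    refine (norm_sub_le _ _).trans ?_
    rw [norm_neg, add_mul]
    refine add_le_add ((norm_inner_le_norm _ _).trans ?_) (norm_inner_le_norm _ _)
    rw [h3, mul_comm]
  rcases (norm_nonneg (toL2 v)).eq_or_lt with h | h
  · rw [← h]; positivity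
  · exact le_of_mul_le_mul_right h4 h

/-! ### The energy estimate -/

lemma norm_J_mulOp_le {θ : R3 → ℂ} (hθ : IsTest θ) (s : ℝ) :
    ∃ K : ℝ, 0 ≤ K ∧ ∀ v : SF, ‖toL2 (J 1 s (mulOp θ v))‖ ≤ K * ‖toL2 (J 1 s v)‖ := by
  obtain ⟨K, hK, h⟩ := norm_J_mulOp_comp_le (hθ.compact.toSchwartzMap hθ.smooth)
    (ContinuousLinearMap.id ℝ R3) (ContinuousLinearMap.id ℝ R3) (fun x κ => rfl)
    (fun κ => le_rfl) s
  exact ⟨K, hK, fun v => h 1 zero_le_one le_rfl v⟩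

lemma mulOp_toSchwartzMap_comp_zcL {a : ℂ → ℂ} (ha : IsTest a) :
    mulOp (fun x => (ha.compact.toSchwartzMap ha.smooth) (zcL x)) = mulZ a := by
  simp only [zcL_apply]
  rfl

lemma norm_J_mulZ_le {a : ℂ → ℂ} (ha : IsTest a) (s : ℝ) :
    ∃ K : ℝ, 0 ≤ K ∧ ∀ ε, 0 ≤ ε → ε ≤ 1 → ∀ v : SF,
      ‖toL2 (J ε s (mulZ a v))‖ ≤ K * ‖toL2 (J ε s v)‖ := by
  have h := norm_J_mulOp_comp_le (ha.compact.toSchwartzMap ha.smooth) horizontal zcL inner_zcL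
    (fun κ => (norm_horizontal κ).le) s
  simpa only [mulOp_toSchwartzMap_comp_zcL ha] using h

lemma norm_J_mulZ_sub_le {a : ℂ → ℂ} (ha : IsTest a) (s : ℝ) :
    ∃ K : ℝ, 0 ≤ K ∧ ∀ ε, 0 ≤ ε → ε ≤ 1 → ∀ v : SF,
      ‖toL2 (J ε s (mulZ a v) - mulZ a (J ε s v))‖ ≤ ε * K * ‖toL2 (J ε (s - 1) v)‖ := by
  have h := norm_J_mulOp_comp_sub_le (ha.compact.toSchwartzMap ha.smooth) horizontal zcL inner_zcL
    (fun κ => (norm_horizontal κ).le) horizontal_two s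
  simpa only [mulOp_toSchwartzMap_comp_zcL ha] using h

lemma toL2_injective : Function.Injective toL2 :=
  SchwartzMap.injective_toLp 2 volume

/-- Multipliers in the frequency dual to `t` commute with functions of `z`. -/
lemma J_zero_mulZ {a : ℂ → ℂ} (ha : IsTest a) (s : ℝ) (v : SF) :
    J 0 s (mulZ a v) = mulZ a (J 0 s v) := by
  -- the size of the commutator is proportional to `ε`, and here `ε = 0`
  obtain ⟨K, -, h⟩ := norm_J_mulZ_sub_le ha s
  have h1 := h 0 le_rfl zero_le_one v
  rw [zero_mul, zero_mul, norm_le_zero_iff, map_sub, sub_eq_zero] at h1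
  exact toL2_injective h1

lemma hasTemperateGrowth_coord (j : Fin 3) : (fun x : R3 => (x j : ℂ)).HasTemperateGrowth :=
  (Complex.ofRealCLM ∘L (EuclideanSpace.proj j : R3 →L[ℝ] ℝ)).hasTemperateGrowth

lemma Dc_fourier (j : Fin 3) (v : SF) :
    Dc j (𝓕 v) = 𝓕 ((-(2 * Real.pi * Complex.I)) • mulOp (fun x => (x j : ℂ)) v) := by
  have h := SchwartzMap.lineDerivOp_fourier_eq v (EuclideanSpace.single j (1 : ℝ) : R3)
  have hg : (fun x : R3 =>
      inner ℝ x (EuclideanSpace.single j (1 : ℝ) : R3)).HasTemperateGrowth := by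
    fun_prop
  simp only [Dc, LineDeriv.lineDerivOpCLM_apply]
  rw [h]
  congr 2
  ext x
  rw [SchwartzMap.smulLeftCLM_apply_apply hg, mulOp_apply (hasTemperateGrowth_coord j)]
  simp [EuclideanSpace.inner_single_right]

lemma pd_wt (ε s : ℝ) {j : Fin 3} (hj : j ≠ 2) (ξ : R3) :
    pd j (fun ξ => ((wt ε s ξ : ℝ) : ℂ)) ξ =
      ((s * (2 * Real.pi * ε) * (2 * Real.pi * ε * ξ j) * wt ε (s - 2) ξ : ℝ) : ℂ) := by
  have hq : HasFDerivAt (fun ξ : R3 => 1 + ‖scaleFreq ε ξ‖ ^ 2)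
      ((2 • (innerSL ℝ (scaleFreq ε ξ))).comp (scaleFreq ε)) ξ := by
    have := ((hasStrictFDerivAt_norm_sq (scaleFreq ε ξ)).hasFDerivAt.comp ξ
      (scaleFreq ε).hasFDerivAt).const_add 1
    exact this
  have hw : HasFDerivAt (fun ξ => wt ε s ξ) _ ξ :=
    hq.rpow_const (p := s / 2) (Or.inl (by positivity))
  have hc : HasFDerivAt (fun ξ => ((wt ε s ξ : ℝ) : ℂ)) _ ξ :=
    Complex.ofRealCLM.hasFDerivAt.comp ξ hw
  have hs : scaleFreq ε (EuclideanSpace.single j (1 : ℝ)) =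
      (2 * Real.pi * ε) • (EuclideanSpace.single j (1 : ℝ) : R3) := by
    simp [scaleFreq, hj.symm]
  have hsj : scaleFreq ε ξ j = 2 * Real.pi * ε * ξ j := by
    simp [scaleFreq, hj]
  have he : wt ε (s - 2) ξ = (1 + ‖scaleFreq ε ξ‖ ^ 2) ^ (s / 2 - 1) := by
    unfold wt
    congr 1
    ring
  rw [pd, hc.fderiv, he]
  simp [hs, EuclideanSpace.inner_single_right, hsj]
  ring

/-- The commutator of `J ε s` with a horizontal coordinate, which is the multiplier whose symbol is a
derivative of `wt ε s`. The coordinates are unbounded, so that `norm_J_mulZ_sub_le` does not apply. -/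
lemma norm_J_coord_sub_le {ε : ℝ} (h0 : 0 ≤ ε) (s : ℝ) {j : Fin 3} (hj : j ≠ 2) (v : SF) :
    ‖toL2 (J ε s (mulOp (fun x => (x j : ℂ)) v) - mulOp (fun x => (x j : ℂ)) (J ε s v))‖ ≤
      ε * |s| * ‖toL2 (J ε (s - 1) v)‖ := by
  have hp := Real.pi_pos
  refine norm_le_of_fourier_le fun ξ => ?_
  set c : ℂ := -(2 * Real.pi * Complex.I) with hc
  have hc0 : ‖c‖ = 2 * Real.pi := by simp [hc, abs_of_pos hp]
  have hsub : ∀ f g : SF, 𝓕 (f - g) = 𝓕 f - 𝓕 g := fun f g =>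
    (FourierTransform.fourierCLM ℂ SF).map_sub f g
  have hsm : ∀ f : SF, 𝓕 (c • f) = c • 𝓕 f := fun f =>
    (FourierTransform.fourierCLM ℂ SF).map_smul c f
  have hD : ∀ w : SF, c * 𝓕 (mulOp (fun x => (x j : ℂ)) w) ξ = Dc j (𝓕 w) ξ := fun w => by
    rw [Dc_fourier, hsm, smul_apply, smul_eq_mul]
  have hwg := hasTemperateGrowth_wt ε s
  have hpd : (pd j (fun ξ => ((wt ε s ξ : ℝ) : ℂ))).HasTemperateGrowth :=
    hasTemperateGrowth_fderiv_apply hwg _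
  have key : c * 𝓕 (J ε s (mulOp (fun x => (x j : ℂ)) v)
      - mulOp (fun x => (x j : ℂ)) (J ε s v)) ξ =
      - (pd j (fun ξ => ((wt ε s ξ : ℝ) : ℂ)) ξ * 𝓕 v ξ) := by
    rw [hsub, sub_apply, mul_sub, hD, fourier_J_apply, mul_left_comm, hD]
    have : 𝓕 (J ε s v) = mulOp (fun ξ => ((wt ε s ξ : ℝ) : ℂ)) (𝓕 v) := fourier_multiplier v
    rw [this, Dc_mulOp hwg j hpd, add_apply, mulOp_apply hwg, mulOp_apply hpd]
    ring
  have key2 := congrArg norm key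
  rw [norm_mul, hc0, norm_neg, norm_mul, pd_wt ε s hj, Complex.norm_real] at key2
  rw [norm_fourier_J_apply]
  have hb : |2 * Real.pi * ε * ξ j| ≤ wt ε 1 ξ := by
    refine le_trans ?_ (norm_scaleFreq_le_wt ε ξ)
    refine le_trans (le_of_eq ?_) (PiLp.norm_apply_le (scaleFreq ε ξ) j)
    have hsj : scaleFreq ε ξ j = 2 * Real.pi * ε * ξ j := by simp [scaleFreq, hj]
    rw [hsj, Real.norm_eq_abs]
  have hb2 : wt ε 1 ξ * wt ε (s - 2) ξ = wt ε (s - 1) ξ := by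
    rw [wt_mul]; congr 1; ring
  have hb3 : ‖s * (2 * Real.pi * ε) * (2 * Real.pi * ε * ξ j) * wt ε (s - 2) ξ‖ ≤
      2 * Real.pi * (ε * |s| * wt ε (s - 1) ξ) := by
    have hw2 := wt_pos ε (s - 2) ξ
    rw [norm_mul, norm_mul, norm_mul, Real.norm_eq_abs, Real.norm_eq_abs, Real.norm_eq_abs,
      Real.norm_eq_abs, abs_of_pos hw2, abs_of_nonneg (by positivity : 0 ≤ 2 * Real.pi * ε), ← hb2]
    calc _ ≤ |s| * (2 * Real.pi * ε) * wt ε 1 ξ * wt ε (s - 2) ξ := by gcongr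
      _ = _ := by ring
  have := mul_le_mul_of_nonneg_right hb3 (norm_nonneg (𝓕 v ξ))
  rw [← key2] at this
  refine le_of_mul_le_mul_left (this.trans (le_of_eq (by ring))) (by positivity : 0 < 2 * Real.pi)

lemma mulZbar_eq (v : SF) :
    mulZbar v = mulOp (fun x => (x 0 : ℂ)) v - Complex.I • mulOp (fun x => (x 1 : ℂ)) v := by
  ext p
  rw [sub_apply, smul_apply, mulZ_apply hasTemperateGrowth_conj_id,
    mulOp_apply (hasTemperateGrowth_coord 0), mulOp_apply (hasTemperateGrowth_coord 1)]
  have : conj (zc p) = (p 0 : ℂ) - Complex.I * (p 1 : ℂ) := by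
    apply Complex.ext <;> simp [zc]
  rw [this, smul_eq_mul]
  ring

lemma norm_J_mulZbar_sub_le {ε : ℝ} (h0 : 0 ≤ ε) (s : ℝ) (v : SF) :
    ‖toL2 (J ε s (mulZbar v) - mulZbar (J ε s v))‖ ≤
      ε * (2 * |s|) * ‖toL2 (J ε (s - 1) v)‖ := by
  have h1 := norm_J_coord_sub_le h0 s (j := 0) (by decide) v
  have h2 := norm_J_coord_sub_le h0 s (j := 1) (by decide) v
  have e : J ε s (mulZbar v) - mulZbar (J ε s v) =
      (J ε s (mulOp (fun x => (x 0 : ℂ)) v) - mulOp (fun x => (x 0 : ℂ)) (J ε s v)) -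
      Complex.I •
        (J ε s (mulOp (fun x => (x 1 : ℂ)) v) - mulOp (fun x => (x 1 : ℂ)) (J ε s v)) := by
    rw [mulZbar_eq, mulZbar_eq, map_sub, map_smul, smul_sub]
    abel
  rw [e, map_sub, map_smul]
  refine (norm_sub_le _ _).trans ?_
  rw [norm_smul, Complex.norm_I, one_mul]
  linarith

lemma fourier_opDz_apply (v : SF) (ξ : R3) :
    𝓕 (opDz v) ξ = Real.pi * Complex.I * (ξ 0 - Complex.I * ξ 1) * 𝓕 v ξ := by
  have h : 𝓕 (opDz v) = (1 / 2 : ℂ) • (𝓕 (Dc 0 v) - Complex.I • 𝓕 (Dc 1 v)) := by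
    have := (FourierTransform.fourierCLM ℂ SF).map_smul (1 / 2 : ℂ) (Dc 0 v - Complex.I • Dc 1 v)
    rw [map_sub, map_smul (FourierTransform.fourierCLM ℂ SF) Complex.I] at this
    exact this
  rw [h, smul_apply, sub_apply, smul_apply, fourier_Dc_apply, fourier_Dc_apply, smul_eq_mul,
    smul_eq_mul]
  ring

lemma fourier_opDzbar_apply (v : SF) (ξ : R3) :
    𝓕 (opDzbar v) ξ = Real.pi * Complex.I * (ξ 0 + Complex.I * ξ 1) * 𝓕 v ξ := by
  have h : 𝓕 (opDzbar v) = (1 / 2 : ℂ) • (𝓕 (Dc 0 v) + Complex.I • 𝓕 (Dc 1 v)) := by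
    have := (FourierTransform.fourierCLM ℂ SF).map_smul (1 / 2 : ℂ) (Dc 0 v + Complex.I • Dc 1 v)
    rw [map_add, map_smul (FourierTransform.fourierCLM ℂ SF) Complex.I] at this
    exact this
  rw [h, smul_apply, add_apply, smul_apply, fourier_Dc_apply, fourier_Dc_apply, smul_eq_mul,
    smul_eq_mul]
  ring

lemma norm_add_I_mul (x y : ℝ) : ‖(x + Complex.I * y : ℂ)‖ = √(x ^ 2 + y ^ 2) := by
  rw [mul_comm, Complex.norm_add_mul_I]

lemma norm_sub_I_mul (x y : ℝ) : ‖(x - Complex.I * y : ℂ)‖ = √(x ^ 2 + y ^ 2) := by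
  have h : (x - Complex.I * y : ℂ) = (x : ℂ) + ((-y : ℝ) : ℂ) * Complex.I := by push_cast; ring
  rw [h, Complex.norm_add_mul_I, neg_sq]

/-- `∂_z` and `∂_{z̄}` have symbols of the same modulus. -/
lemma norm_J_opDz_le (ε s : ℝ) (v : SF) :
    ‖toL2 (J ε s (opDz v))‖ ≤ ‖toL2 (J ε s (opDzbar v))‖ := by
  rw [← one_mul ‖toL2 (J ε s (opDzbar v))‖]
  refine norm_le_of_fourier_le fun ξ => le_of_eq ?_
  rw [norm_fourier_J_apply, norm_fourier_J_apply, fourier_opDz_apply, fourier_opDzbar_apply,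
    norm_mul _ (𝓕 v ξ), norm_mul _ (𝓕 v ξ), norm_mul _ (_ - _), norm_mul _ (_ + _),
    norm_add_I_mul, norm_sub_I_mul, one_mul]

lemma J_opDz (ε s : ℝ) (v : SF) : J ε s (opDz v) = opDz (J ε s v) := by
  simp only [opDz_apply, map_smul, map_sub, J_Dc]

lemma J_opDzbar (ε s : ℝ) (v : SF) : J ε s (opDzbar v) = opDzbar (J ε s v) := by
  simp only [opDzbar_apply, map_smul, map_add, J_Dc]

lemma contDiff_conj : ContDiff ℝ ∞ fun z : ℂ => conj z := Complex.conjCLE.contDiff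

/-- `L̄` is elliptic in the horizontal directions. -/
lemma norm_J_opDzbar_le {a : ℂ → ℂ} (ha : IsTest a) (s : ℝ) :
    ∃ K : ℝ, 0 ≤ K ∧ ∀ ε, 0 ≤ ε → ε ≤ 1 → ∀ v : SF,
      ‖toL2 (J ε s (opDzbar v))‖ ≤
        ‖toL2 (J ε s (opLbar a v))‖ + K * ‖toL2 (J ε s (Dc 2 v))‖ := by
  obtain ⟨K, hK, h⟩ := norm_J_mulZ_le ha.conjugate s
  refine ⟨K, hK, fun ε h0 h1 v => ?_⟩
  have e : J ε s (opDzbar v) =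
      J ε s (opLbar a v) - Complex.I • J ε s (mulZ (fun z => conj (a z)) (Dc 2 v)) := by
    rw [opLbar, map_add, map_smul]; abel
  rw [e, map_sub, map_smul]
  refine (norm_sub_le _ _).trans ?_
  rw [norm_smul, Complex.norm_I, one_mul]
  gcongr
  exact h ε h0 h1 _

/-- The Sobolev norm on the Schwartz space. -/
def nrm (s : ℝ) (v : SF) : ℝ := ‖toL2 (J 1 s v)‖

/-- The basic estimate in the norms defined by `J ε s`. The commutators of `z̄L` and `z̄L̄` with
`J ε s` are small with `ε`, apart from a part which is controlled by `L̄`. -/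
lemma norm_J_le_energy {a : ℂ → ℂ} (ha : IsTest a) (s : ℝ) :
    ∃ M : ℝ, 0 ≤ M ∧ ∀ ε, 0 ≤ ε → ε ≤ 1 → ∀ v : SF, ‖toL2 (J ε s v)‖ ≤
      ‖toL2 (J ε s (mulZbar (opL a v)))‖ + ‖toL2 (J ε s (mulZbar (opLbar a v)))‖ +
        ε * (4 * |s|) * ‖toL2 (J ε (s - 1) (opLbar a v))‖ + ε * M * ‖toL2 (J ε s v)‖ := by
  have hza : IsTest fun z => conj z * a z := ha.mul_left contDiff_conj
  have hzab : IsTest fun z => conj z * conj (a z) := ha.conjugate.mul_left contDiff_conj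
  obtain ⟨K₁, hK₁, h₁⟩ := norm_J_mulZ_sub_le hza s
  obtain ⟨K₂, hK₂, h₂⟩ := norm_J_mulZ_sub_le hzab s
  obtain ⟨K₃, hK₃, h₃⟩ := norm_J_opDzbar_le ha (s - 1)
  have hta := ha.hasTemperateGrowth
  have htab := ha.conjugate.hasTemperateGrowth
  have htc := hasTemperateGrowth_conj_id
  refine ⟨K₁ + K₂ + 4 * |s| * K₃, by positivity, fun ε h0 h1 v => ?_⟩
  have b0 := norm_le_mulZbar_opL_add hta (J ε s v)
  have d2 : ‖toL2 (J ε (s - 1) (Dc 2 v))‖ ≤ ‖toL2 (J ε s v)‖ := by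
    simpa using norm_J_Dc_two_le ε (s - 1) v
  have dzb : ‖toL2 (J ε (s - 1) (opDzbar v))‖ ≤
      ‖toL2 (J ε (s - 1) (opLbar a v))‖ + K₃ * ‖toL2 (J ε s v)‖ :=
    (h₃ ε h0 h1 v).trans (by gcongr)
  have dz := (norm_J_opDz_le ε (s - 1) v).trans dzb
  have eL : mulZbar (opL a (J ε s v)) = J ε s (mulZbar (opL a v))
      - (J ε s (mulZbar (opDz v)) - mulZbar (J ε s (opDz v)))
      + Complex.I • (J ε s (mulZ (fun z => conj z * a z) (Dc 2 v))
        - mulZ (fun z => conj z * a z) (J ε s (Dc 2 v))) := by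
    simp only [opL, map_sub, map_smul, J_opDz, J_Dc, mulZ_mulZ htc hta, smul_sub]
    abel
  have eLb : mulZbar (opLbar a (J ε s v)) = J ε s (mulZbar (opLbar a v))
      - (J ε s (mulZbar (opDzbar v)) - mulZbar (J ε s (opDzbar v)))
      - Complex.I • (J ε s (mulZ (fun z => conj z * conj (a z)) (Dc 2 v))
        - mulZ (fun z => conj z * conj (a z)) (J ε s (Dc 2 v))) := by
    simp only [opLbar, map_add, map_smul, J_opDzbar, J_Dc, mulZ_mulZ htc htab, smul_sub]
    abel
  have nL : ‖toL2 (mulZbar (opL a (J ε s v)))‖ ≤ ‖toL2 (J ε s (mulZbar (opL a v)))‖ +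
      ε * (2 * |s|) * ‖toL2 (J ε (s - 1) (opDz v))‖ +
      ε * K₁ * ‖toL2 (J ε (s - 1) (Dc 2 v))‖ := by
    rw [eL, map_add, map_sub, map_smul]
    refine (norm_add_le _ _).trans (add_le_add ((norm_sub_le _ _).trans (add_le_add le_rfl ?_)) ?_)
    · exact norm_J_mulZbar_sub_le h0 s _
    · rw [norm_smul, Complex.norm_I, one_mul]
      exact h₁ ε h0 h1 _
  have nLb : ‖toL2 (mulZbar (opLbar a (J ε s v)))‖ ≤ ‖toL2 (J ε s (mulZbar (opLbar a v)))‖ +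
      ε * (2 * |s|) * ‖toL2 (J ε (s - 1) (opDzbar v))‖ +
      ε * K₂ * ‖toL2 (J ε (s - 1) (Dc 2 v))‖ := by
    rw [eLb, map_sub, map_sub, map_smul]
    refine (norm_sub_le _ _).trans (add_le_add ((norm_sub_le _ _).trans (add_le_add le_rfl ?_)) ?_)
    · exact norm_J_mulZbar_sub_le h0 s _
    · rw [norm_smul, Complex.norm_I, one_mul]
      exact h₂ ε h0 h1 _
  have c1 := mul_le_mul_of_nonneg_left dz (by positivity : 0 ≤ ε * (2 * |s|))
  have c2 := mul_le_mul_of_nonneg_left dzb (by positivity : 0 ≤ ε * (2 * |s|))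
  have c3 := mul_le_mul_of_nonneg_left d2 (by positivity : 0 ≤ ε * K₁)
  have c4 := mul_le_mul_of_nonneg_left d2 (by positivity : 0 ≤ ε * K₂)
  linarith

/-- The arithmetic of absorption: `x`, `y`, `z` and `X`, `Y`, `Z` are equivalent norms of the data, and
the term `ε M n` moves to the left-hand side. -/
lemma absorb_real {n X Y Z x y z c ε M S : ℝ} (hS : 0 ≤ S) (hε : ε ≤ 1) (hε0 : 0 ≤ ε) (hc : 0 ≤ c)
    (hn : 0 ≤ n) (hεM : ε * M ≤ 1 / 2) (h : n ≤ x + y + ε * (4 * S) * z + ε * M * n)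
    (hx : x ≤ c * X) (hy : y ≤ c * Y) (hz : z ≤ c * Z) (hX : 0 ≤ X) (hY : 0 ≤ Y) (hZ : 0 ≤ Z) :
    n ≤ 2 * (1 + 4 * S) * c * (X + Y + Z) := by
  have m2 := mul_le_mul_of_nonneg_right hεM hn
  have m3 : ε * (4 * S) * z ≤ 1 * (4 * S) * (c * Z) :=
    (mul_le_mul_of_nonneg_left hz (by positivity)).trans
      (mul_le_mul_of_nonneg_right (mul_le_mul_of_nonneg_right hε (by positivity)) (by positivity))
  have q1 : 0 ≤ S * (c * X) := by positivity
  have q2 : 0 ≤ S * (c * Y) := by positivity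
  have q3 : 0 ≤ c * Z := by positivity
  linarith

/-- The basic estimate in Sobolev norms. -/
theorem exists_nrm_le_energy {a : ℂ → ℂ} (ha : IsTest a) (s : ℝ) :
    ∃ C : ℝ, 0 ≤ C ∧ ∀ v : SF, nrm s v ≤
      C * (nrm s (mulZbar (opL a v)) + nrm s (mulZbar (opLbar a v))
        + nrm (s - 1) (opLbar a v)) := by
  obtain ⟨M, hM0, main⟩ := norm_J_le_energy ha s
  -- for such `ε` the term `ε M ‖J ε s v‖` is absorbed
  obtain ⟨ε, hε0, hε1, hεM⟩ : ∃ ε : ℝ, 0 < ε ∧ ε ≤ 1 ∧ ε * M ≤ 1 / 2 := by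
    refine ⟨1 / (2 * (M + 1)), by positivity, ?_, ?_⟩
    · rw [div_le_one (by positivity)]; linarith
    · rw [div_mul_eq_mul_div, one_mul, div_le_div_iff₀ (by positivity) (by positivity)]
      linarith
  have compare : ∀ r : ℝ, ∀ w : SF, ‖toL2 (J ε r w)‖ ≤ ε⁻¹ ^ |r| * nrm r w ∧
      nrm r w ≤ ε⁻¹ ^ |r| * ‖toL2 (J ε r w)‖ := fun r w => by
    constructor <;> refine norm_le_of_fourier_le fun ξ => ?_ <;>
      rw [norm_fourier_J_apply, norm_fourier_J_apply, ← mul_assoc] <;> gcongr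
    · exact (wt_one_le_wt hε0 hε1 r ξ).2
    · exact (wt_one_le_wt hε0 hε1 r ξ).1
  obtain ⟨c, hc⟩ : ∃ c : ℝ, c = ε⁻¹ ^ |s| + ε⁻¹ ^ |s - 1| := ⟨_, rfl⟩
  have hc1 : 0 < ε⁻¹ ^ |s| := by positivity
  have hc2 : 0 < ε⁻¹ ^ |s - 1| := by positivity
  have hc0 : 0 < c := by rw [hc]; positivity
  have up : ∀ w : SF, ‖toL2 (J ε s w)‖ ≤ c * nrm s w := fun w =>
    ((compare s w).1).trans (mul_le_mul_of_nonneg_right (by linarith) (norm_nonneg _))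
  have up' : ∀ w : SF, ‖toL2 (J ε (s - 1) w)‖ ≤ c * nrm (s - 1) w := fun w =>
    ((compare (s - 1) w).1).trans (mul_le_mul_of_nonneg_right (by linarith) (norm_nonneg _))
  have down : ∀ w : SF, nrm s w ≤ c * ‖toL2 (J ε s w)‖ := fun w =>
    ((compare s w).2).trans (mul_le_mul_of_nonneg_right (by linarith) (norm_nonneg _))
  refine ⟨c * (2 * (1 + 4 * |s|) * c), by positivity, fun v => ?_⟩
  have m4 := absorb_real (abs_nonneg s) hε1 hε0.le hc0.le (norm_nonneg _) hεM
    (main ε hε0.le hε1 v) (up (mulZbar (opL a v))) (up (mulZbar (opLbar a v))) (up' (opLbar a v))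
    (norm_nonneg _) (norm_nonneg _) (norm_nonneg _)
  refine (down v).trans ((mul_le_mul_of_nonneg_left m4 hc0.le).trans (le_of_eq ?_))
  unfold nrm
  ring

/-! ### The subelliptic gain -/

lemma nrm_nonneg (s : ℝ) (v : SF) : 0 ≤ nrm s v := norm_nonneg _

lemma nrm_mono {s r : ℝ} (h : s ≤ r) (v : SF) : nrm s v ≤ nrm r v := norm_J_mono 1 h v

lemma nrm_add_le (s : ℝ) (v w : SF) : nrm s (v + w) ≤ nrm s v + nrm s w := by
  unfold nrm; rw [map_add, map_add]; exact norm_add_le _ _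

lemma nrm_sub_le (s : ℝ) (v w : SF) : nrm s (v - w) ≤ nrm s v + nrm s w := by
  unfold nrm; rw [map_sub, map_sub]; exact norm_sub_le _ _

lemma nrm_smul (s : ℝ) (c : ℂ) (v : SF) : nrm s (c • v) = ‖c‖ * nrm s v := by
  unfold nrm; rw [map_smul, map_smul, norm_smul]

lemma norm_mulZ_le {a : ℂ → ℂ} (ha : IsTest a) :
    ∃ K : ℝ, 0 ≤ K ∧ ∀ v : SF, ‖toL2 (mulZ a v)‖ ≤ K * ‖toL2 v‖ := by
  obtain ⟨K, hK, h⟩ := norm_J_mulZ_le ha 0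
  exact ⟨K, hK, fun v => by simpa using h 1 zero_le_one le_rfl v⟩

/-- The Levi form, that is, the function `h` in the commutator identity `[L, L̄] = i h(z) ∂_t`. For
`a = g₁` it is `2 g_{1 1̄}`. -/
def levi (a : ℂ → ℂ) (z : ℂ) : ℂ := dz (fun z => conj (a z)) z + dzbar a z

lemma IsTest.levi {a : ℂ → ℂ} (ha : IsTest a) : IsTest (levi a) :=
  ha.conjugate.dz.add ha.dzbar

lemma opDz_opDzbar_comm (v : SF) : opDz (opDzbar v) = opDzbar (opDz v) := by
  simp only [opDz_apply, opDzbar_apply, map_smul, map_add, map_sub, Dc_comm 1 0]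
  module

lemma opDz_Dc_two (v : SF) : opDz (Dc 2 v) = Dc 2 (opDz v) := by
  simp only [opDz_apply, map_smul, map_sub, Dc_comm 2]

lemma opDzbar_Dc_two (v : SF) : opDzbar (Dc 2 v) = Dc 2 (opDzbar v) := by
  simp only [opDzbar_apply, map_smul, map_add, Dc_comm 2]

lemma opL_opLbar_sub {a : ℂ → ℂ} (ha : IsTest a) (v : SF) :
    opL a (opLbar a v) - opLbar a (opL a v) = Complex.I • mulZ (levi a) (Dc 2 v) := by
  have hta := ha.hasTemperateGrowth
  have htb := ha.conjugate.hasTemperateGrowth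
  have e1 : mulZ (levi a) (Dc 2 v) =
      mulZ (dz fun z => conj (a z)) (Dc 2 v) + mulZ (dzbar a) (Dc 2 v) := by
    ext p
    rw [add_apply, mulZ_apply ha.levi.hasTemperateGrowth,
      mulZ_apply ha.conjugate.dz.hasTemperateGrowth, mulZ_apply ha.dzbar.hasTemperateGrowth, levi]
    ring
  rw [e1]
  simp only [opL, opLbar, map_add, map_sub, map_smul, opDz_mulZ htb, opDzbar_mulZ hta,
    opDz_opDzbar_comm, opDz_Dc_two, opDzbar_Dc_two, Dc_two_mulZ hta, Dc_two_mulZ htb,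
    mulZ_comm hta htb]
  module

/-- The bounded multiplier `-i ∂_t ⟨∂_t⟩⁻¹`, a smooth substitute for the sign of the frequency dual
to `t`. -/
def tSign (v : SF) : SF := (-Complex.I) • Dc 2 (J 0 (-1) v)

lemma norm_tSign_le (v : SF) : ‖toL2 (tSign v)‖ ≤ ‖toL2 v‖ := by
  unfold tSign
  rw [map_smul, norm_smul, norm_neg, Complex.norm_I, one_mul, ← J_Dc]
  simpa using norm_J_Dc_two_le 0 (-1) v

lemma tSign_opL {a : ℂ → ℂ} (ha : IsTest a) (v : SF) : tSign (opL a v) = opL a (tSign v) := by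
  simp only [tSign, opL, map_sub, map_smul, J_opDz, J_zero_mulZ ha, J_Dc,
    Dc_two_mulZ ha.hasTemperateGrowth, opDz_Dc_two]
  module

lemma tSign_opLbar {a : ℂ → ℂ} (ha : IsTest a) (v : SF) :
    tSign (opLbar a v) = opLbar a (tSign v) := by
  simp only [tSign, opLbar, map_add, map_smul, J_opDzbar, J_zero_mulZ ha.conjugate, J_Dc,
    Dc_two_mulZ ha.conjugate.hasTemperateGrowth, opDzbar_Dc_two]
  module

lemma Dc_two_Dc_two (v : SF) : Dc 2 (Dc 2 v) = v - J 0 2 v := by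
  refine fourier_ext fun ξ => ?_
  have hsub : ∀ f g : SF, 𝓕 (f - g) = 𝓕 f - 𝓕 g := fun f g =>
    (FourierTransform.fourierCLM ℂ SF).map_sub f g
  rw [hsub, sub_apply, fourier_Dc_apply, fourier_Dc_apply, fourier_J_apply, wt_two,
    norm_sq_scaleFreq]
  push_cast
  linear_combination (2 * Real.pi) ^ 2 * (ξ 2 : ℂ) ^ 2 * 𝓕 v ξ * Complex.I_sq

/-- The identity `[L, L̄] = i h ∂_t`, paired with `tSign W` and integrated by parts. As
`∂_t² = 1 - ⟨∂_t⟩²`, the Levi form appears with `⟨∂_t⟩^{1/2} W`, up to a term of order `-1`. -/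
lemma inner_levi_eq {a : ℂ → ℂ} (ha : IsTest a) (W : SF) :
    inner ℂ (toL2 (J 0 (1 / 2) W)) (toL2 (mulZ (levi a) (J 0 (1 / 2) W))) =
      inner ℂ (toL2 (tSign (opLbar a W))) (toL2 (opLbar a W))
        - inner ℂ (toL2 (tSign (opL a W))) (toL2 (opL a W))
        + inner ℂ (toL2 (J 0 (-1) W)) (toL2 (mulZ (levi a) W)) := by
  have hta := ha.hasTemperateGrowth
  have hl := ha.levi
  have e1 : inner ℂ (toL2 (tSign (opLbar a W))) (toL2 (opLbar a W))
      - inner ℂ (toL2 (tSign (opL a W))) (toL2 (opL a W)) =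
      - inner ℂ (toL2 (tSign W)) (toL2 (Complex.I • mulZ (levi a) (Dc 2 W))) := by
    rw [tSign_opLbar ha, tSign_opL ha, inner_opLbar hta, inner_opL hta, ← opL_opLbar_sub ha,
      map_sub, inner_sub_right]
    ring
  have e2 : inner ℂ (toL2 (tSign W)) (toL2 (Complex.I • mulZ (levi a) (Dc 2 W))) =
      - inner ℂ (toL2 (J 0 (-1) W)) (toL2 (mulZ (levi a) (J 0 2 W)))
        + inner ℂ (toL2 (J 0 (-1) W)) (toL2 (mulZ (levi a) W)) := by
    rw [tSign, map_smul, map_smul, inner_smul_left, inner_smul_right, inner_Dc,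
      Dc_two_mulZ hl.hasTemperateGrowth, Dc_two_Dc_two, map_sub, map_sub, inner_sub_right, map_neg,
      Complex.conj_I]
    linear_combination (-(inner ℂ (toL2 (J 0 (-1) W)) (toL2 (mulZ (levi a) W)) -
      inner ℂ (toL2 (J 0 (-1) W)) (toL2 (mulZ (levi a) (J 0 2 W))))) * Complex.I_sq
  have e3 : inner ℂ (toL2 (J 0 (-1) W)) (toL2 (mulZ (levi a) (J 0 2 W))) =
      inner ℂ (toL2 (J 0 (1 / 2) W)) (toL2 (mulZ (levi a) (J 0 (1 / 2) W))) := by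
    have h2 : J 0 2 W = J 0 (3 / 2) (J 0 (1 / 2) W) := by rw [J_J]; norm_num
    have h3 : J 0 (1 / 2) W = J 0 (3 / 2) (J 0 (-1) W) := by rw [J_J]; norm_num
    rw [h2, ← J_zero_mulZ hl, ← inner_J, ← h3]
  rw [e1, e2, e3]
  ring

lemma integrable_conj_mul (f g : SF) : Integrable fun x => conj (f x) * g x := by
  refine (g.integrable (μ := volume)).bdd_mul (c := SchwartzMap.seminorm ℝ 0 0 f) ?_
    (Eventually.of_forall fun x => ?_)
  · exact (Complex.continuous_conj.comp f.continuous).aestronglyMeasurable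
  · rw [RCLike.norm_conj]
    exact SchwartzMap.norm_le_seminorm ℝ f x

lemma re_inner_toL2 (f g : SF) :
    (inner ℂ (toL2 f) (toL2 g)).re = ∫ x, (conj (f x) * g x).re := by
  rw [inner_toL2]
  exact (Complex.reCLM.integral_comp_comm (integrable_conj_mul f g)).symm

lemma sq_norm_mulZ_le {b h : ℂ → ℂ} (hb : b.HasTemperateGrowth) (hh : h.HasTemperateGrowth)
    {K : ℝ} (V : SF) (H : ∀ p, V p ≠ 0 → ‖b (zc p)‖ ^ 2 ≤ K * (h (zc p)).re) :
    ‖toL2 (mulZ b V)‖ ^ 2 ≤ K * (inner ℂ (toL2 V) (toL2 (mulZ h V))).re := by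
  have h1 : ‖toL2 (mulZ b V)‖ ^ 2 = (inner ℂ (toL2 (mulZ b V)) (toL2 (mulZ b V))).re :=
    (inner_self_eq_norm_sq (𝕜 := ℂ) _).symm
  rw [h1, re_inner_toL2, re_inner_toL2, ← integral_const_mul]
  refine integral_mono (integrable_conj_mul _ _).re ((integrable_conj_mul _ _).re.const_mul K)
    fun p => ?_
  have e1 : (conj (mulZ b V p) * mulZ b V p).re = ‖b (zc p)‖ ^ 2 * ‖V p‖ ^ 2 := by
    rw [mulZ_apply hb, Complex.conj_mul', norm_mul]
    norm_cast
    ring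
  have e2 : (conj (V p) * mulZ h V p).re = (h (zc p)).re * ‖V p‖ ^ 2 := by
    rw [mulZ_apply hh, mul_left_comm, Complex.conj_mul']
    norm_cast
    rw [Complex.re_mul_ofReal]
  change (conj (mulZ b V p) * mulZ b V p).re ≤ K * (conj (V p) * mulZ h V p).re
  rw [e1, e2]
  by_cases hV : V p = 0
  · simp [hV]
  · rw [← mul_assoc]
    exact mul_le_mul_of_nonneg_right (H p hV) (by positivity)

lemma re_inner_levi_le {a : ℂ → ℂ} (ha : IsTest a) : ∃ C : ℝ, 0 ≤ C ∧ ∀ W : SF,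
    (inner ℂ (toL2 (J 0 (1 / 2) W)) (toL2 (mulZ (levi a) (J 0 (1 / 2) W)))).re ≤
      ‖toL2 (opL a W)‖ ^ 2 + ‖toL2 (opLbar a W)‖ ^ 2 + C * ‖toL2 W‖ ^ 2 := by
  obtain ⟨C, hC, h⟩ := norm_mulZ_le ha.levi
  refine ⟨C, hC, fun W => ?_⟩
  rw [inner_levi_eq ha]
  refine (Complex.re_le_norm _).trans ((norm_add_le _ _).trans ?_)
  have h1 : ∀ F : SF, ‖inner ℂ (toL2 (tSign F)) (toL2 F)‖ ≤ ‖toL2 F‖ ^ 2 := fun F => by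
    refine (norm_inner_le_norm _ _).trans ?_
    rw [sq]
    gcongr
    exact norm_tSign_le F
  have h2 : ‖inner ℂ (toL2 (J 0 (-1) W)) (toL2 (mulZ (levi a) W))‖ ≤ C * ‖toL2 W‖ ^ 2 := by
    refine (norm_inner_le_norm _ _).trans ?_
    have h3 : ‖toL2 (J 0 (-1) W)‖ ≤ ‖toL2 W‖ := by
      simpa using norm_J_mono 0 (by norm_num : (-1 : ℝ) ≤ 0) W
    calc _ ≤ ‖toL2 W‖ * (C * ‖toL2 W‖) := by gcongr; exact h W
      _ = _ := by ring
  have h4 := (norm_sub_le (inner ℂ (toL2 (tSign (opLbar a W))) (toL2 (opLbar a W)))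
    (inner ℂ (toL2 (tSign (opL a W))) (toL2 (opL a W)))).trans
    (add_le_add (h1 (opLbar a W)) (h1 (opL a W)))
  linarith

lemma norm_opL_J_le {a : ℂ → ℂ} (ha : IsTest a) (s : ℝ) :
    ∃ K : ℝ, 0 ≤ K ∧ ∀ w : SF, ‖toL2 (opL a (J 1 s w))‖ ≤ nrm s (opL a w) + K * nrm s w := by
  obtain ⟨K, hK, h⟩ := norm_J_mulZ_sub_le ha s
  refine ⟨K, hK, fun w => ?_⟩
  have e : opL a (J 1 s w) = J 1 s (opL a w) +
      Complex.I • (J 1 s (mulZ a (Dc 2 w)) - mulZ a (J 1 s (Dc 2 w))) := by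
    simp only [opL, map_sub, map_smul, J_opDz, J_Dc, smul_sub]
    abel
  rw [e, map_add, map_smul]
  refine (norm_add_le _ _).trans (add_le_add le_rfl ?_)
  rw [norm_smul, Complex.norm_I, one_mul]
  refine (h 1 zero_le_one le_rfl _).trans ?_
  rw [one_mul]
  gcongr
  simpa [nrm] using norm_J_Dc_two_le 1 (s - 1) w

lemma norm_opLbar_J_le {a : ℂ → ℂ} (ha : IsTest a) (s : ℝ) :
    ∃ K : ℝ, 0 ≤ K ∧ ∀ w : SF,
      ‖toL2 (opLbar a (J 1 s w))‖ ≤ nrm s (opLbar a w) + K * nrm s w := by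
  obtain ⟨K, hK, h⟩ := norm_J_mulZ_sub_le ha.conjugate s
  refine ⟨K, hK, fun w => ?_⟩
  have e : opLbar a (J 1 s w) = J 1 s (opLbar a w) -
      Complex.I • (J 1 s (mulZ (fun z => conj (a z)) (Dc 2 w))
        - mulZ (fun z => conj (a z)) (J 1 s (Dc 2 w))) := by
    simp only [opLbar, map_add, map_smul, J_opDzbar, J_Dc, smul_sub]
    abel
  rw [e, map_sub, map_smul]
  refine (norm_sub_le _ _).trans (add_le_add le_rfl ?_)
  rw [norm_smul, Complex.norm_I, one_mul]
  refine (h 1 zero_le_one le_rfl _).trans ?_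
  rw [one_mul]
  gcongr
  simpa [nrm] using norm_J_Dc_two_le 1 (s - 1) w

lemma wt_zero_le_wt_one {s : ℝ} (hs : 0 ≤ s) (ξ : R3) : wt 0 s ξ ≤ wt 1 s ξ := by
  unfold wt
  have : ‖scaleFreq 0 ξ‖ ≤ ‖scaleFreq 1 ξ‖ := by
    rw [scaleFreq_one]; exact norm_scaleFreq_le le_rfl zero_le_one ξ
  gcongr

lemma wt_zero_one_le (ξ : R3) : wt 0 1 ξ ≤ wt 0 (1 / 2) ξ * wt 1 (1 / 2) ξ := by
  have h := wt_zero_le_wt_one (by norm_num : (0 : ℝ) ≤ 1 / 2) ξ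
  have h2 : wt 0 1 ξ = wt 0 (1 / 2) ξ * wt 0 (1 / 2) ξ := by rw [wt_mul]; norm_num
  rw [h2]
  have := wt_pos 0 (1 / 2) ξ
  gcongr

/-- Regularity in the direction `t`, of order `1/2`, and horizontal regularity imply full
regularity. -/
lemma nrm_add_half_le (s : ℝ) (v : SF) : nrm (s + 1 / 2) v ≤
    ‖toL2 (J 0 (1 / 2) (J 1 s v))‖ + 2 * nrm (s - 1 / 2) (opDzbar v) := by
  have hp := Real.pi_pos
  have e : 2 * nrm (s - 1 / 2) (opDzbar v) = ‖toL2 ((2 : ℂ) • J 1 (s - 1 / 2) (opDzbar v))‖ := by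
    rw [map_smul, norm_smul]; simp [nrm]
  rw [e]
  have hsm : ∀ f : SF, 𝓕 ((2 : ℂ) • f) = (2 : ℂ) • 𝓕 f := fun f =>
    (FourierTransform.fourierCLM ℂ SF).map_smul (2 : ℂ) f
  refine norm_le_of_fourier_le_add fun ξ => ?_
  rw [hsm, smul_apply, smul_eq_mul, norm_mul, norm_fourier_J_apply, norm_fourier_J_apply,
    norm_fourier_J_apply, norm_fourier_J_apply, fourier_opDzbar_apply, norm_mul, norm_mul,
    norm_add_I_mul]
  have n1 : ‖(Real.pi * Complex.I : ℂ)‖ = Real.pi := by simp [abs_of_pos hp]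
  rw [n1, Complex.norm_ofNat]
  have hr0 : 0 ≤ √(ξ 0 ^ 2 + ξ 1 ^ 2) := Real.sqrt_nonneg _
  have hr2 : √(ξ 0 ^ 2 + ξ 1 ^ 2) ^ 2 = ξ 0 ^ 2 + ξ 1 ^ 2 := Real.sq_sqrt (by positivity)
  set r := √(ξ 0 ^ 2 + ξ 1 ^ 2) with hr
  have h1 : wt 1 1 ξ ≤ wt 0 1 ξ + 2 * Real.pi * r := by
    have h0 := wt_pos 0 1 ξ
    refine abs_le_of_sq_le_sq' ?_ (by positivity) |>.2
    have e0 := wt_one_sq 0 ξ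
    have e1 := wt_one_sq 1 ξ
    rw [norm_sq_scaleFreq, ← hr2] at e0 e1
    have : 0 ≤ wt 0 1 ξ * (2 * Real.pi * r) := by positivity
    nlinarith
  have h2 := wt_zero_one_le ξ
  have e2 : wt 1 (s + 1 / 2) ξ = wt 1 (s - 1 / 2) ξ * wt 1 1 ξ := by rw [wt_mul]; ring_nf
  have e3 : wt 1 s ξ = wt 1 (s - 1 / 2) ξ * wt 1 (1 / 2) ξ := by rw [wt_mul]; ring_nf
  have hw := wt_pos 1 (s - 1 / 2) ξ
  rw [e2, e3]
  calc wt 1 (s - 1 / 2) ξ * wt 1 1 ξ * ‖𝓕 v ξ‖ ≤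
        wt 1 (s - 1 / 2) ξ * (wt 0 (1 / 2) ξ * wt 1 (1 / 2) ξ + 2 * Real.pi * r) * ‖𝓕 v ξ‖ := by
        gcongr; linarith
    _ = _ := by ring

lemma nrm_Dc_two_le_half (s : ℝ) (v : SF) :
    nrm (s - 1 / 2) (Dc 2 v) ≤ ‖toL2 (J 0 (1 / 2) (J 1 s v))‖ := by
  have hp := Real.pi_pos
  rw [← one_mul ‖toL2 (J 0 (1 / 2) (J 1 s v))‖]
  refine norm_le_of_fourier_le fun ξ => ?_
  rw [norm_fourier_J_apply, norm_fourier_J_apply, norm_fourier_J_apply, fourier_Dc_apply,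
    norm_mul, norm_mul, one_mul]
  have n1 : ‖(2 * Real.pi * Complex.I : ℂ)‖ = 2 * Real.pi := by simp [abs_of_pos hp]
  have h1 : 2 * Real.pi * |ξ 2| ≤ wt 0 1 ξ := by
    refine le_trans ?_ (norm_scaleFreq_le_wt 0 ξ)
    refine le_trans (le_of_eq ?_) (PiLp.norm_apply_le (scaleFreq 0 ξ) 2)
    rw [scaleFreq_two_coord]
    simp [abs_of_pos hp]
  have h2 := h1.trans (wt_zero_one_le ξ)
  have e3 : wt 1 s ξ = wt 1 (s - 1 / 2) ξ * wt 1 (1 / 2) ξ := by rw [wt_mul]; ring_nf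
  have hw := wt_pos 1 (s - 1 / 2) ξ
  rw [n1, Complex.norm_real, Real.norm_eq_abs, e3]
  calc _ ≤ wt 1 (s - 1 / 2) ξ * (wt 0 (1 / 2) ξ * wt 1 (1 / 2) ξ * ‖𝓕 v ξ‖) := by gcongr
    _ = _ := by ring

lemma nrm_mulZ_le {a : ℂ → ℂ} (ha : IsTest a) (s : ℝ) :
    ∃ K : ℝ, 0 ≤ K ∧ ∀ v : SF, nrm s (mulZ a v) ≤ K * nrm s v := by
  obtain ⟨K, hK, h⟩ := norm_J_mulZ_le ha s
  exact ⟨K, hK, fun v => h 1 zero_le_one le_rfl v⟩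

/-- The gain of half a derivative in the direction `t`. -/
lemma norm_half_mulZ_J_le {a b χ : ℂ → ℂ} (ha : IsTest a) (hb : IsTest b) (hχ : IsTest χ)
    (hbχ : ∀ z, b z * χ z = b z) {K : ℝ} (hK : 0 ≤ K)
    (H : ∀ z, χ z ≠ 0 → ‖b z‖ ^ 2 ≤ K * (levi a z).re) (s : ℝ) :
    ∃ C : ℝ, 0 ≤ C ∧ ∀ w : SF, ‖toL2 (mulZ b (J 0 (1 / 2) (J 1 s w)))‖ ≤
      C * (nrm s (opL a w) + nrm s (opLbar a w) + nrm s w) := by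
  obtain ⟨C₁, hC₁, h₁⟩ := re_inner_levi_le ha
  obtain ⟨C₂, hC₂, h₂⟩ := norm_opL_J_le ha s
  obtain ⟨C₃, hC₃, h₃⟩ := norm_opLbar_J_le ha s
  obtain ⟨C₄, hC₄, h₄⟩ := norm_mulZ_le hχ
  obtain ⟨C₅, hC₅, h₅⟩ := norm_mulZ_le hχ.dz
  obtain ⟨C₆, hC₆, h₆⟩ := norm_mulZ_le hχ.dzbar
  have hta := ha.hasTemperateGrowth
  have htχ := hχ.hasTemperateGrowth
  have htb := hb.hasTemperateGrowth
  set M : ℝ := C₄ + C₄ * C₂ + C₅ + C₄ * C₃ + C₆ with hM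
  have hM0 : 0 ≤ M := by positivity
  refine ⟨√(K * (2 + C₁)) * M, by positivity, fun w => ?_⟩
  obtain ⟨N, hN⟩ : ∃ N, N = nrm s (opL a w) + nrm s (opLbar a w) + nrm s w := ⟨_, rfl⟩
  have p1 := nrm_nonneg s (opL a w)
  have p2 := nrm_nonneg s (opLbar a w)
  have p3 := nrm_nonneg s w
  have hN0 : 0 ≤ N := by rw [hN]; positivity
  obtain ⟨U, hU⟩ : ∃ U, U = J 1 s w := ⟨_, rfl⟩
  have nU : ‖toL2 U‖ = nrm s w := by rw [hU]; rfl
  have aL : ‖toL2 (opL a (mulZ χ U))‖ ≤ M * N := by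
    rw [opL_mulZ hta htχ, map_add]
    refine (norm_add_le _ _).trans ((add_le_add (h₅ U) (h₄ _)).trans ?_)
    have := mul_le_mul_of_nonneg_left (h₂ w) hC₄
    rw [← hU] at this
    rw [nU]
    calc _ ≤ C₅ * N + (C₄ * N + C₄ * C₂ * N) := by
          have q1 : C₅ * nrm s w ≤ C₅ * N := by gcongr; linarith
          have q2 : C₄ * nrm s (opL a w) ≤ C₄ * N := by gcongr; linarith
          have q3 : C₄ * C₂ * nrm s w ≤ C₄ * C₂ * N := by gcongr; linarith
          linarith
      _ ≤ M * N := by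
          rw [hM]
          have : 0 ≤ (C₄ * C₃ + C₆) * N := by positivity
          linarith
  have aLb : ‖toL2 (opLbar a (mulZ χ U))‖ ≤ M * N := by
    rw [opLbar_mulZ hta htχ, map_add]
    refine (norm_add_le _ _).trans ((add_le_add (h₆ U) (h₄ _)).trans ?_)
    have := mul_le_mul_of_nonneg_left (h₃ w) hC₄
    rw [← hU] at this
    rw [nU]
    calc _ ≤ C₆ * N + (C₄ * N + C₄ * C₃ * N) := by
          have q1 : C₆ * nrm s w ≤ C₆ * N := by gcongr; linarith
          have q2 : C₄ * nrm s (opLbar a w) ≤ C₄ * N := by gcongr; linarith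
          have q3 : C₄ * C₃ * nrm s w ≤ C₄ * C₃ * N := by gcongr; linarith
          linarith
      _ ≤ M * N := by
          rw [hM]
          have : 0 ≤ (C₄ * C₂ + C₅) * N := by positivity
          linarith
  have aW : ‖toL2 (mulZ χ U)‖ ≤ M * N := by
    refine (h₄ U).trans ?_
    rw [nU]
    have q1 : C₄ * nrm s w ≤ C₄ * N := by gcongr; linarith
    rw [hM]
    have : 0 ≤ (C₄ * C₂ + C₅ + C₄ * C₃ + C₆) * N := by positivity
    linarith
  have eV : J 0 (1 / 2) (mulZ χ U) = mulZ χ (J 0 (1 / 2) U) := J_zero_mulZ hχ _ _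
  have eb : mulZ b (J 0 (1 / 2) U) = mulZ b (J 0 (1 / 2) (mulZ χ U)) := by
    rw [eV, mulZ_mulZ htb htχ]
    simp only [hbχ]
  have key := sq_norm_mulZ_le htb ha.levi.hasTemperateGrowth (K := K) (J 0 (1 / 2) (mulZ χ U))
    fun p hp => H _ fun h0 => hp (by rw [eV, mulZ_apply htχ, h0, zero_mul])
  have fin : ‖toL2 (mulZ b (J 0 (1 / 2) U))‖ ^ 2 ≤ (√(K * (2 + C₁)) * (M * N)) ^ 2 := by
    rw [eb]
    refine key.trans ((mul_le_mul_of_nonneg_left (h₁ _) hK).trans ?_)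
    rw [mul_pow, Real.sq_sqrt (by positivity), mul_assoc]
    gcongr
    have s1 := pow_le_pow_left₀ (norm_nonneg _) aL 2
    have s2 := pow_le_pow_left₀ (norm_nonneg _) aLb 2
    have s3 := mul_le_mul_of_nonneg_left (pow_le_pow_left₀ (norm_nonneg _) aW 2) hC₁
    linarith
  rw [← hU, ← hN, mul_assoc]
  exact abs_le_of_sq_le_sq' fin (by positivity) |>.2

/-- A subelliptic gain of half a derivative for `b(z) w` when `|b|²` is dominated by the Levi form
near the support of `b`. -/
theorem exists_nrm_mulZ_le_subelliptic {a b χ : ℂ → ℂ} (ha : IsTest a) (hb : IsTest b)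
    (hχ : IsTest χ) (hbχ : ∀ z, b z * χ z = b z) {K : ℝ} (hK : 0 ≤ K)
    (H : ∀ z, χ z ≠ 0 → ‖b z‖ ^ 2 ≤ K * (levi a z).re) (s : ℝ) :
    ∃ C : ℝ, 0 ≤ C ∧ ∀ w : SF, nrm (s + 1 / 2) (mulZ b w) ≤
      C * (nrm s (opL a w) + nrm s (opLbar a w) + nrm s w) := by
  obtain ⟨C₁, hC₁, h₁⟩ := norm_half_mulZ_J_le ha hb hχ hbχ hK H s
  obtain ⟨C₂, hC₂, h₂⟩ := norm_J_mulZ_sub_le hb s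
  obtain ⟨C₃, hC₃, h₃⟩ := norm_J_opDzbar_le ha (s - 1 / 2)
  obtain ⟨C₄, hC₄, h₄⟩ := nrm_mulZ_le hb s
  obtain ⟨C₅, hC₅, h₅⟩ := nrm_mulZ_le hb.dzbar s
  refine ⟨(1 + 2 * C₃) * (C₁ + C₂) + 2 * (C₄ + C₅), by positivity, fun w => ?_⟩
  have p1 := nrm_nonneg s (opL a w)
  have p2 := nrm_nonneg s (opLbar a w)
  have p3 := nrm_nonneg s w
  obtain ⟨N, hN⟩ : ∃ N, N = nrm s (opL a w) + nrm s (opLbar a w) + nrm s w := ⟨_, rfl⟩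
  rw [← hN]
  have f1 : ‖toL2 (J 0 (1 / 2) (J 1 s (mulZ b w)))‖ ≤ (C₁ + C₂) * N := by
    have e : J 0 (1 / 2) (J 1 s (mulZ b w)) = mulZ b (J 0 (1 / 2) (J 1 s w)) +
        (J 1 s (mulZ b (J 0 (1 / 2) w)) - mulZ b (J 1 s (J 0 (1 / 2) w))) := by
      rw [J_comm, J_zero_mulZ hb, J_comm 1 s]
      abel
    rw [e, map_add]
    refine (norm_add_le _ _).trans ((add_le_add (h₁ w) (h₂ 1 zero_le_one le_rfl _)).trans ?_)
    have q : ‖toL2 (J 1 (s - 1) (J 0 (1 / 2) w))‖ ≤ nrm s w := by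
      rw [← one_mul (nrm s w)]
      refine norm_le_of_fourier_le fun ξ => ?_
      rw [norm_fourier_J_apply, norm_fourier_J_apply, norm_fourier_J_apply, one_mul, ← mul_assoc]
      gcongr
      have hw := wt_pos 1 (s - 1) ξ
      calc _ ≤ wt 1 (s - 1) ξ * wt 1 1 ξ := by
            gcongr
            exact (wt_zero_le_wt_one (by norm_num) ξ).trans (wt_mono 1 (by norm_num) ξ)
        _ = _ := by rw [wt_mul]; ring_nf
    have q2 : C₂ * ‖toL2 (J 1 (s - 1) (J 0 (1 / 2) w))‖ ≤ C₂ * N := by gcongr; linarith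
    rw [← hN]
    linarith
  have f2 : nrm (s - 1 / 2) (opLbar a (mulZ b w)) ≤ (C₄ + C₅) * N := by
    refine (nrm_mono (by linarith : s - 1 / 2 ≤ s) _).trans ?_
    rw [opLbar_mulZ ha.hasTemperateGrowth hb.hasTemperateGrowth]
    refine (nrm_add_le _ _ _).trans ((add_le_add (h₅ _) (h₄ _)).trans ?_)
    have q1 : C₅ * nrm s w ≤ C₅ * N := by gcongr; linarith
    have q2 : C₄ * nrm s (opLbar a w) ≤ C₄ * N := by gcongr; linarith
    linarith
  have f3 := h₃ 1 zero_le_one le_rfl (mulZ b w)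
  have f4 := (nrm_Dc_two_le_half s (mulZ b w)).trans f1
  have f5 := mul_le_mul_of_nonneg_left f4 hC₃
  have f6 : nrm (s - 1 / 2) (opDzbar (mulZ b w)) ≤ (C₄ + C₅) * N + C₃ * ((C₁ + C₂) * N) :=
    f3.trans (add_le_add f2 f5)
  refine (nrm_add_half_le s _).trans ?_
  linarith

/-! ### The localized estimate -/

open scoped Classical in
/-- The product `θ u` as a Schwartz function, for a test function `θ` and a smooth function `u`. It
is `0` if `θ u` is not a test function. -/
def cut (θ u : R3 → ℂ) : SF :=
  if h : IsTest (fun p => θ p * u p) then h.compact.toSchwartzMap h.smooth else 0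

lemma cut_apply {θ u : R3 → ℂ} (hθ : IsTest θ) (hu : ContDiff ℝ ∞ u) (p : R3) :
    cut θ u p = θ p * u p := by
  have h : IsTest (fun p => θ p * u p) := hθ.mul_right hu
  simp [cut, h]

lemma cut_coe {θ u : R3 → ℂ} (hθ : IsTest θ) (hu : ContDiff ℝ ∞ u) :
    (cut θ u : R3 → ℂ) = fun p => θ p * u p :=
  funext fun p => cut_apply hθ hu p

/-- The vector field `∂_z - i a(z) ∂_t` on functions. -/
def fieldL (a : ℂ → ℂ) (u : R3 → ℂ) (p : R3) : ℂ :=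
  (1 / 2 : ℂ) * (pd 0 u p - Complex.I * pd 1 u p) - Complex.I * a (zc p) * pd 2 u p

/-- The vector field `∂_{z̄} + i (conj a(z)) ∂_t` on functions. -/
def fieldLbar (a : ℂ → ℂ) (u : R3 → ℂ) (p : R3) : ℂ :=
  (1 / 2 : ℂ) * (pd 0 u p + Complex.I * pd 1 u p) + Complex.I * conj (a (zc p)) * pd 2 u p

lemma contDiff_pd (j : Fin 3) {u : R3 → ℂ} (hu : ContDiff ℝ ∞ u) : ContDiff ℝ ∞ (pd j u) :=
  (hu.fderiv_right (m := ∞) (by simp)).clm_apply contDiff_const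

lemma IsTest.pd {θ : R3 → ℂ} (hθ : IsTest θ) (j : Fin 3) : IsTest (pd j θ) := hθ.fderiv_apply _

lemma contDiff_zc : ContDiff ℝ ∞ zc := by
  have : zc = zcL := funext fun p => (zcL_apply p).symm
  rw [this]
  exact zcL.contDiff

lemma contDiff_fieldL {a : ℂ → ℂ} (ha : ContDiff ℝ ∞ a) {u : R3 → ℂ} (hu : ContDiff ℝ ∞ u) :
    ContDiff ℝ ∞ (fieldL a u) :=
  (contDiff_const.mul ((contDiff_pd 0 hu).sub (contDiff_const.mul (contDiff_pd 1 hu)))).sub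
    ((contDiff_const.mul (ha.comp contDiff_zc)).mul (contDiff_pd 2 hu))

lemma contDiff_fieldLbar {a : ℂ → ℂ} (ha : ContDiff ℝ ∞ a) {u : R3 → ℂ} (hu : ContDiff ℝ ∞ u) :
    ContDiff ℝ ∞ (fieldLbar a u) :=
  (contDiff_const.mul ((contDiff_pd 0 hu).add (contDiff_const.mul (contDiff_pd 1 hu)))).add
    ((contDiff_const.mul ((contDiff_conj.comp ha).comp contDiff_zc)).mul (contDiff_pd 2 hu))

lemma pd_eq_zero_of_notMem_tsupport (j : Fin 3) {θ : R3 → ℂ} {p : R3} (hp : p ∉ tsupport θ) :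
    pd j θ p = 0 := by
  rw [pd, fderiv_of_notMem_tsupport (𝕜 := ℝ) hp]
  simp

lemma tsupport_pd_subset (j : Fin 3) (θ : R3 → ℂ) : tsupport (pd j θ) ⊆ tsupport θ :=
  closure_minimal (fun p hp => by
    by_contra h
    exact hp (pd_eq_zero_of_notMem_tsupport j h)) (isClosed_tsupport θ)

lemma fieldL_eq_zero_of_notMem_tsupport (a : ℂ → ℂ) {θ : R3 → ℂ} {p : R3} (hp : p ∉ tsupport θ) :
    fieldL a θ p = 0 := by
  simp [fieldL, pd_eq_zero_of_notMem_tsupport _ hp]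

lemma fieldLbar_eq_zero_of_notMem_tsupport (a : ℂ → ℂ) {θ : R3 → ℂ} {p : R3}
    (hp : p ∉ tsupport θ) : fieldLbar a θ p = 0 := by
  simp [fieldLbar, pd_eq_zero_of_notMem_tsupport _ hp]

lemma hasCompactSupport_of_tsupport {θ f : R3 → ℂ} (hθ : IsTest θ)
    (h : ∀ p, p ∉ tsupport θ → f p = 0) : HasCompactSupport f :=
  HasCompactSupport.intro hθ.compact fun p hp => h p hp

lemma IsTest.fieldL {a : ℂ → ℂ} (ha : ContDiff ℝ ∞ a) {θ : R3 → ℂ} (hθ : IsTest θ) :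
    IsTest (fieldL a θ) :=
  ⟨contDiff_fieldL ha hθ.smooth,
    hasCompactSupport_of_tsupport hθ fun _ hp => fieldL_eq_zero_of_notMem_tsupport a hp⟩

lemma IsTest.fieldLbar {a : ℂ → ℂ} (ha : ContDiff ℝ ∞ a) {θ : R3 → ℂ} (hθ : IsTest θ) :
    IsTest (fieldLbar a θ) :=
  ⟨contDiff_fieldLbar ha hθ.smooth,
    hasCompactSupport_of_tsupport hθ fun _ hp => fieldLbar_eq_zero_of_notMem_tsupport a hp⟩

lemma Dc_cut (j : Fin 3) {θ u : R3 → ℂ} (hθ : IsTest θ) (hu : ContDiff ℝ ∞ u) (p : R3) :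
    Dc j (cut θ u) p = pd j θ p * u p + θ p * pd j u p := by
  rw [Dc_apply, cut_coe hθ hu, pd, fderiv_fun_mul (hθ.smooth.differentiable (by simp) p)
    (hu.differentiable (by simp) p)]
  simp [pd]
  ring

lemma opL_cut {a : ℂ → ℂ} (ha : IsTest a) {θ u : R3 → ℂ} (hθ : IsTest θ) (hu : ContDiff ℝ ∞ u) :
    opL a (cut θ u) = cut θ (fieldL a u) + cut (fieldL a θ) u := by
  ext p
  simp only [opL, opDz_apply, sub_apply, smul_apply, add_apply, mulZ_apply ha.hasTemperateGrowth,
    Dc_cut _ hθ hu, cut_apply hθ (contDiff_fieldL ha.smooth hu),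
    cut_apply (hθ.fieldL ha.smooth) hu, smul_eq_mul, fieldL]
  ring

lemma opLbar_cut {a : ℂ → ℂ} (ha : IsTest a) {θ u : R3 → ℂ} (hθ : IsTest θ)
    (hu : ContDiff ℝ ∞ u) :
    opLbar a (cut θ u) = cut θ (fieldLbar a u) + cut (fieldLbar a θ) u := by
  ext p
  simp only [opLbar, opDzbar_apply, smul_apply, add_apply,
    mulZ_apply ha.conjugate.hasTemperateGrowth, Dc_cut _ hθ hu,
    cut_apply hθ (contDiff_fieldLbar ha.smooth hu), cut_apply (hθ.fieldLbar ha.smooth) hu,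
    smul_eq_mul, fieldLbar]
  ring

lemma contDiff_conj_zc : ContDiff ℝ ∞ fun p => conj (zc p) := contDiff_conj.comp contDiff_zc

lemma mulZbar_cut {θ u : R3 → ℂ} (hθ : IsTest θ) (hu : ContDiff ℝ ∞ u) :
    mulZbar (cut θ u) = cut (fun p => conj (zc p) * θ p) u := by
  ext p
  rw [mulZ_apply hasTemperateGrowth_conj_id, cut_apply hθ hu,
    cut_apply (hθ.mul_left contDiff_conj_zc) hu]
  ring

lemma mulZbar_cut' {θ u : R3 → ℂ} (hθ : IsTest θ) (hu : ContDiff ℝ ∞ u) :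
    mulZbar (cut θ u) = cut θ (fun p => conj (zc p) * u p) := by
  ext p
  rw [mulZ_apply hasTemperateGrowth_conj_id, cut_apply hθ hu,
    cut_apply hθ (contDiff_conj_zc.mul hu)]
  ring

lemma exists_nrm_cut_le {ρ θ ζ : R3 → ℂ} (hρ : IsTest ρ) (hζ : IsTest ζ)
    (h : ∀ p, θ p = ρ p * ζ p) (s : ℝ) :
    ∃ C : ℝ, 0 ≤ C ∧ ∀ u : R3 → ℂ, ContDiff ℝ ∞ u → nrm s (cut θ u) ≤ C * nrm s (cut ζ u) := by
  obtain ⟨C, hC, hb⟩ := norm_J_mulOp_le hρ s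
  refine ⟨C, hC, fun u hu => ?_⟩
  have hθ : IsTest θ := by
    have : θ = fun p => ρ p * ζ p := funext h
    rw [this]
    exact hρ.mul_right hζ.smooth
  have e : cut θ u = mulOp ρ (cut ζ u) := by
    ext p
    rw [mulOp_apply hρ.hasTemperateGrowth, cut_apply hθ hu, cut_apply hζ hu, h]
    ring
  rw [e]
  exact hb _

lemma exists_nrm_cut_le_of_subset {θ β ζ : R3 → ℂ} (hθ : IsTest θ) (hζ : IsTest ζ)
    (hθβ : ∀ p, p ∉ tsupport β → θ p = 0) (hβζ : ∀ p ∈ tsupport β, ζ p = 1) (s : ℝ) :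
    ∃ C : ℝ, 0 ≤ C ∧ ∀ u : R3 → ℂ, ContDiff ℝ ∞ u → nrm s (cut θ u) ≤ C * nrm s (cut ζ u) := by
  refine exists_nrm_cut_le hθ hζ (fun p => ?_) s
  by_cases hp : p ∈ tsupport β
  · rw [hβζ p hp, mul_one]
  · rw [hθβ p hp, zero_mul]

/-- `b` is a test function whose square is dominated by the Levi form on a neighbourhood of its
support. -/
def IsLeviBounded (a b : ℂ → ℂ) : Prop :=
  IsTest b ∧ ∃ χ : ℂ → ℂ, IsTest χ ∧ (∀ z, b z * χ z = b z) ∧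
    ∃ K : ℝ, 0 ≤ K ∧ ∀ z, χ z ≠ 0 → ‖b z‖ ^ 2 ≤ K * (levi a z).re

/-- The right-hand side of the local estimates, without its term of lower order. -/
def dataNorm (a : ℂ → ℂ) (s : ℝ) (ζ u : R3 → ℂ) : ℝ :=
  nrm s (cut ζ (fieldLbar a u)) + nrm s (cut ζ (fun p => conj (zc p) * fieldL a u p))

lemma dataNorm_nonneg (a : ℂ → ℂ) (s : ℝ) (ζ u : R3 → ℂ) : 0 ≤ dataNorm a s ζ u :=
  add_nonneg (nrm_nonneg _ _) (nrm_nonneg _ _)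

lemma dataNorm_mono (a : ℂ → ℂ) {s r : ℝ} (h : s ≤ r) (ζ u : R3 → ℂ) :
    dataNorm a s ζ u ≤ dataNorm a r ζ u :=
  add_le_add (nrm_mono h _) (nrm_mono h _)

/-- Terms `z̄ b(z) θ u`, with `b` dominated by the Levi form, gain half a derivative. -/
lemma exists_nrm_mulZ_mulZbar_cut_le {a b : ℂ → ℂ} (ha : IsTest a) (hb : IsLeviBounded a b)
    {θ β ζ : R3 → ℂ} (hθ : IsTest θ) (hζ : IsTest ζ) (hθβ : tsupport θ ⊆ tsupport β)
    (hβζ : ∀ p ∈ tsupport β, ζ p = 1) (s : ℝ) :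
    ∃ C : ℝ, 0 ≤ C ∧ ∀ u : R3 → ℂ, ContDiff ℝ ∞ u →
      nrm s (mulZ b (mulZbar (cut θ u))) ≤ C * (dataNorm a s ζ u + nrm (s - 1 / 2) (cut ζ u)) := by
  obtain ⟨hbt, χ, hχ, hbχ, K, hK, H⟩ := hb
  have hθζ : ∀ p ∈ tsupport θ, ζ p = 1 := fun p hp => hβζ p (hθβ hp)
  have off : ∀ p, p ∉ tsupport θ → θ p = 0 := fun p hp => image_eq_zero_of_notMem_tsupport hp
  obtain ⟨C₀, hC₀, h₀⟩ := exists_nrm_mulZ_le_subelliptic ha hbt hχ hbχ hK H (s - 1 / 2)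
  obtain ⟨C₁, hC₁, h₁⟩ := exists_nrm_cut_le_of_subset hθ hζ off hθζ (s - 1 / 2)
  obtain ⟨C₂, hC₂, h₂⟩ := exists_nrm_cut_le_of_subset (hθ.mul_left contDiff_conj_zc) hζ
    (fun p hp => by rw [off p hp, mul_zero]) hθζ (s - 1 / 2)
  obtain ⟨C₃, hC₃, h₃⟩ := exists_nrm_cut_le_of_subset
    ((hθ.fieldL ha.smooth).mul_left contDiff_conj_zc) hζ
    (fun p hp => by rw [fieldL_eq_zero_of_notMem_tsupport a hp, mul_zero]) hθζ (s - 1 / 2)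
  obtain ⟨C₄, hC₄, h₄⟩ := exists_nrm_cut_le_of_subset
    ((hθ.fieldLbar ha.smooth).mul_left contDiff_conj_zc) hζ
    (fun p hp => by rw [fieldLbar_eq_zero_of_notMem_tsupport a hp, mul_zero]) hθζ (s - 1 / 2)
  refine ⟨C₀ * (2 * C₁ + 2 * C₂ + C₃ + C₄), by positivity, fun u hu => ?_⟩
  have hLu := contDiff_fieldL ha.smooth hu
  have hLbu := contDiff_fieldLbar ha.smooth hu
  have hta := ha.hasTemperateGrowth
  obtain ⟨N, hN⟩ : ∃ N, N = dataNorm a s ζ u + nrm (s - 1 / 2) (cut ζ u) := ⟨_, rfl⟩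
  have hd := dataNorm_mono a (by linarith : s - 1 / 2 ≤ s) ζ u
  have b1 : nrm (s - 1 / 2) (cut ζ u) ≤ N := by linarith [dataNorm_nonneg a s ζ u]
  have b2 : nrm (s - 1 / 2) (cut ζ (fieldLbar a u)) ≤ N := by
    unfold dataNorm at hd
    have := nrm_nonneg (s - 1 / 2) (cut ζ fun p => conj (zc p) * fieldL a u p)
    have := nrm_nonneg (s - 1 / 2) (cut ζ u)
    rw [hN]; unfold dataNorm; linarith
  have b3 : nrm (s - 1 / 2) (cut ζ (fun p => conj (zc p) * fieldL a u p)) ≤ N := by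
    unfold dataNorm at hd
    have := nrm_nonneg (s - 1 / 2) (cut ζ (fieldLbar a u))
    have := nrm_nonneg (s - 1 / 2) (cut ζ u)
    rw [hN]; unfold dataNorm; linarith
  have g1 : nrm (s - 1 / 2) (opL a (mulZbar (cut θ u))) ≤ (C₁ + C₃) * N := by
    rw [opL_mulZbar hta, opL_cut ha hθ hu, map_add, mulZbar_cut' hθ hLu,
      mulZbar_cut (hθ.fieldL ha.smooth) hu]
    have t1 := (h₁ _ (contDiff_conj_zc.mul hLu)).trans (mul_le_mul_of_nonneg_left b3 hC₁)
    have t2 := (h₃ u hu).trans (mul_le_mul_of_nonneg_left b1 hC₃)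
    linarith [nrm_add_le (s - 1 / 2) (cut θ fun p => conj (zc p) * fieldL a u p)
      (cut (fun p => conj (zc p) * fieldL a θ p) u)]
  have g2 : nrm (s - 1 / 2) (opLbar a (mulZbar (cut θ u))) ≤ (C₁ + C₂ + C₄) * N := by
    rw [opLbar_mulZbar hta, opLbar_cut ha hθ hu, map_add, mulZbar_cut hθ hLbu,
      mulZbar_cut (hθ.fieldLbar ha.smooth) hu]
    have t0 := (h₁ u hu).trans (mul_le_mul_of_nonneg_left b1 hC₁)
    have t1 := (h₂ _ hLbu).trans (mul_le_mul_of_nonneg_left b2 hC₂)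
    have t2 := (h₄ u hu).trans (mul_le_mul_of_nonneg_left b1 hC₄)
    refine (nrm_add_le _ _ _).trans ?_
    linarith [nrm_add_le (s - 1 / 2) (cut (fun p => conj (zc p) * θ p) (fieldLbar a u))
      (cut (fun p => conj (zc p) * fieldLbar a θ p) u)]
  have g3 : nrm (s - 1 / 2) (mulZbar (cut θ u)) ≤ C₂ * N := by
    rw [mulZbar_cut hθ hu]
    exact (h₂ u hu).trans (mul_le_mul_of_nonneg_left b1 hC₂)
  have g0 := h₀ (mulZbar (cut θ u))
  rw [sub_add_cancel] at g0
  rw [← hN]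
  refine g0.trans ?_
  rw [mul_assoc]
  exact mul_le_mul_of_nonneg_left (by linarith) hC₀

/-- The local estimate with an error term of order `s - 1/2`. The cut-off `β` is such that
its horizontal derivatives live where `b₀ = 1`, with `b₀` dominated by the Levi form. -/
theorem exists_nrm_cut_le_half {a b₀ b₁ : ℂ → ℂ} (ha : IsTest a) (hb₀ : IsLeviBounded a b₀)
    (hb₁ : IsLeviBounded a fun z => a z * b₁ z)
    (hb₁' : IsLeviBounded a fun z => conj (a z) * b₁ z)
    {β ζ : R3 → ℂ} (hβ : IsTest β) (hζ : IsTest ζ) (hβζ : ∀ p ∈ tsupport β, ζ p = 1)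
    (h0 : ∀ p, b₀ (zc p) * pd 0 β p = pd 0 β p) (h1 : ∀ p, b₀ (zc p) * pd 1 β p = pd 1 β p)
    (h2 : ∀ p, b₁ (zc p) * pd 2 β p = pd 2 β p) (s : ℝ) :
    ∃ C : ℝ, 0 ≤ C ∧ ∀ u : R3 → ℂ, ContDiff ℝ ∞ u →
      nrm s (cut β u) ≤ C * (dataNorm a s ζ u + nrm (s - 1 / 2) (cut ζ u)) := by
  have off : ∀ p, p ∉ tsupport β → β p = 0 := fun p hp => image_eq_zero_of_notMem_tsupport hp
  obtain ⟨C, hC, hE⟩ := exists_nrm_le_energy ha s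
  obtain ⟨C₁, hC₁, h₁⟩ := exists_nrm_cut_le_of_subset hβ hζ off hβζ s
  obtain ⟨C₂, hC₂, h₂⟩ := exists_nrm_cut_le_of_subset (hβ.mul_left contDiff_conj_zc) hζ
    (fun p hp => by rw [off p hp, mul_zero]) hβζ s
  obtain ⟨C₃, hC₃, h₃⟩ := exists_nrm_cut_le_of_subset (hβ.fieldLbar ha.smooth) hζ
    (fun p hp => fieldLbar_eq_zero_of_notMem_tsupport a hp) hβζ (s - 1)
  have gain := fun {b : ℂ → ℂ} (hb : IsLeviBounded a b) (j : Fin 3) =>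
    exists_nrm_mulZ_mulZbar_cut_le ha hb (hβ.pd j) hζ (tsupport_pd_subset j β) hβζ s
  obtain ⟨D₀, hD₀, d₀⟩ := gain hb₀ 0
  obtain ⟨D₁, hD₁, d₁⟩ := gain hb₀ 1
  obtain ⟨D₂, hD₂, d₂⟩ := gain hb₁ 2
  obtain ⟨D₃, hD₃, d₃⟩ := gain hb₁' 2
  refine ⟨C * ((C₁ + D₀ + D₁ + D₂) + (C₂ + D₀ + D₁ + D₃) + (C₁ + C₃)), by positivity,
    fun u hu => ?_⟩
  have hLu := contDiff_fieldL ha.smooth hu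
  have hLbu := contDiff_fieldLbar ha.smooth hu
  have hta := ha.hasTemperateGrowth
  obtain ⟨N, hN⟩ : ∃ N, N = dataNorm a s ζ u + nrm (s - 1 / 2) (cut ζ u) := ⟨_, rfl⟩
  rw [← hN]
  have p1 := nrm_nonneg s (cut ζ (fieldLbar a u))
  have p2 := nrm_nonneg s (cut ζ (fun p => conj (zc p) * fieldL a u p))
  have p3 := nrm_nonneg (s - 1 / 2) (cut ζ u)
  have N1 : nrm s (cut ζ (fieldLbar a u)) ≤ N := by rw [hN, dataNorm]; linarith
  have N2 : nrm s (cut ζ (fun p => conj (zc p) * fieldL a u p)) ≤ N := by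
    rw [hN, dataNorm]; linarith
  have N3 : nrm (s - 1 / 2) (cut ζ u) ≤ N := by rw [hN, dataNorm]; linarith
  have m0 := d₀ u hu
  have m1 := d₁ u hu
  have m2 := d₂ u hu
  have m3 := d₃ u hu
  rw [← hN] at m0 m1 m2 m3
  have half : ‖(1 / 2 : ℂ)‖ = 1 / 2 := by simp
  have nI : ‖Complex.I‖ = 1 := Complex.norm_I
  have apply_gain : ∀ {b : ℂ → ℂ}, IsLeviBounded a b → ∀ (j : Fin 3) (p : R3),
      mulZ b (mulZbar (cut (pd j β) u)) p = b (zc p) * (conj (zc p) * (pd j β p * u p)) :=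
    fun hb j p => by
      rw [mulZ_apply hb.1.hasTemperateGrowth, mulZ_apply hasTemperateGrowth_conj_id,
        cut_apply (hβ.pd j) hu]
  -- In the commutators of `L` and `L̄` with `β`, each derivative of `β` comes with a factor to which
  -- `exists_nrm_mulZ_mulZbar_cut_le` applies.
  have e1 : mulZbar (opL a (cut β u)) = cut β (fun p => conj (zc p) * fieldL a u p) +
      ((1 / 2 : ℂ) • (mulZ b₀ (mulZbar (cut (pd 0 β) u))
        - Complex.I • mulZ b₀ (mulZbar (cut (pd 1 β) u)))
        - Complex.I • mulZ (fun z => a z * b₁ z) (mulZbar (cut (pd 2 β) u))) := by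
    rw [opL_cut ha hβ hu, map_add, mulZbar_cut' hβ hLu, mulZbar_cut (hβ.fieldL ha.smooth) hu]
    congr 1
    ext p
    rw [cut_apply ((hβ.fieldL ha.smooth).mul_left contDiff_conj_zc) hu]
    simp only [sub_apply, smul_apply, apply_gain hb₀, apply_gain hb₁, smul_eq_mul]
    rw [fieldL]
    linear_combination (-(1 / 2) * (conj (zc p) * u p)) * (h0 p - Complex.I * h1 p)
      + Complex.I * a (zc p) * (conj (zc p) * u p) * h2 p
  have e2 : mulZbar (opLbar a (cut β u)) = cut (fun p => conj (zc p) * β p) (fieldLbar a u) +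
      ((1 / 2 : ℂ) • (mulZ b₀ (mulZbar (cut (pd 0 β) u))
        + Complex.I • mulZ b₀ (mulZbar (cut (pd 1 β) u)))
        + Complex.I • mulZ (fun z => conj (a z) * b₁ z) (mulZbar (cut (pd 2 β) u))) := by
    rw [opLbar_cut ha hβ hu, map_add, mulZbar_cut hβ hLbu, mulZbar_cut (hβ.fieldLbar ha.smooth) hu]
    congr 1
    ext p
    rw [cut_apply ((hβ.fieldLbar ha.smooth).mul_left contDiff_conj_zc) hu]
    simp only [add_apply, smul_apply, apply_gain hb₀, apply_gain hb₁', smul_eq_mul]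
    rw [fieldLbar]
    linear_combination (-(1 / 2) * (conj (zc p) * u p)) * (h0 p + Complex.I * h1 p)
      - Complex.I * conj (a (zc p)) * (conj (zc p) * u p) * h2 p
  have q1 : nrm s (mulZbar (opL a (cut β u))) ≤ (C₁ + D₀ + D₁ + D₂) * N := by
    rw [e1]
    have t := (h₁ _ (contDiff_conj_zc.mul hLu)).trans (mul_le_mul_of_nonneg_left N2 hC₁)
    refine (nrm_add_le _ _ _).trans ?_
    have t2 := nrm_sub_le s ((1 / 2 : ℂ) • (mulZ b₀ (mulZbar (cut (pd 0 β) u))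
        - Complex.I • mulZ b₀ (mulZbar (cut (pd 1 β) u))))
        (Complex.I • mulZ (fun z => a z * b₁ z) (mulZbar (cut (pd 2 β) u)))
    have t3 := nrm_sub_le s (mulZ b₀ (mulZbar (cut (pd 0 β) u)))
      (Complex.I • mulZ b₀ (mulZbar (cut (pd 1 β) u)))
    rw [nrm_smul, nrm_smul, half, nI] at t2
    rw [nrm_smul, nI] at t3
    have := nrm_nonneg s (mulZ b₀ (mulZbar (cut (pd 0 β) u)))
    have := nrm_nonneg s (mulZ b₀ (mulZbar (cut (pd 1 β) u)))
    linarith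
  have q2 : nrm s (mulZbar (opLbar a (cut β u))) ≤ (C₂ + D₀ + D₁ + D₃) * N := by
    rw [e2]
    have t := (h₂ _ hLbu).trans (mul_le_mul_of_nonneg_left N1 hC₂)
    refine (nrm_add_le _ _ _).trans ?_
    have t2 := nrm_add_le s ((1 / 2 : ℂ) • (mulZ b₀ (mulZbar (cut (pd 0 β) u))
        + Complex.I • mulZ b₀ (mulZbar (cut (pd 1 β) u))))
        (Complex.I • mulZ (fun z => conj (a z) * b₁ z) (mulZbar (cut (pd 2 β) u)))
    have t3 := nrm_add_le s (mulZ b₀ (mulZbar (cut (pd 0 β) u)))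
      (Complex.I • mulZ b₀ (mulZbar (cut (pd 1 β) u)))
    rw [nrm_smul, nrm_smul, half, nI] at t2
    rw [nrm_smul, nI] at t3
    have := nrm_nonneg s (mulZ b₀ (mulZbar (cut (pd 0 β) u)))
    have := nrm_nonneg s (mulZ b₀ (mulZbar (cut (pd 1 β) u)))
    linarith
  have q3 : nrm (s - 1) (opLbar a (cut β u)) ≤ (C₁ + C₃) * N := by
    rw [opLbar_cut ha hβ hu]
    have t1 := (nrm_mono (by linarith : s - 1 ≤ s) (cut β (fieldLbar a u))).trans
      ((h₁ _ hLbu).trans (mul_le_mul_of_nonneg_left N1 hC₁))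
    have t2 := (h₃ u hu).trans (mul_le_mul_of_nonneg_left
      ((nrm_mono (by linarith : s - 1 ≤ s - 1 / 2) (cut ζ u)).trans N3) hC₃)
    linarith [nrm_add_le (s - 1) (cut β (fieldLbar a u)) (cut (fieldLbar a β) u)]
  refine (hE (cut β u)).trans ?_
  rw [mul_assoc]
  exact mul_le_mul_of_nonneg_left (by linarith) hC

/-- The estimate for `s ≤ -1`, which follows from `u = L̄(z̄u) - z̄L̄u`. -/
lemma exists_nrm_cut_le_of_le_neg_one {a : ℂ → ℂ} (ha : IsTest a) {θ ζ : R3 → ℂ} (hθ : IsTest θ)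
    (hζ : IsTest ζ) (hθζ : ∀ p ∈ tsupport θ, ζ p = 1) {s : ℝ} (hs : s ≤ -1) :
    ∃ C : ℝ, 0 ≤ C ∧ ∀ u : R3 → ℂ, ContDiff ℝ ∞ u →
      nrm s (cut θ u) ≤ C * (dataNorm a s ζ u + nrm 0 (mulZbar (cut ζ u))) := by
  have off : ∀ p, p ∉ tsupport θ → θ p = 0 := fun p hp => image_eq_zero_of_notMem_tsupport hp
  obtain ⟨C₁, hC₁, h₁⟩ := exists_nrm_cut_le_of_subset hθ hζ off hθζ 0
  obtain ⟨C₂, hC₂, h₂⟩ := exists_nrm_cut_le_of_subset (hθ.mul_left contDiff_conj_zc) hζ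
    (fun p hp => by rw [off p hp, mul_zero]) hθζ s
  obtain ⟨C₃, hC₃, h₃⟩ := exists_nrm_cut_le_of_subset (hθ.fieldLbar ha.smooth) hζ
    (fun p hp => fieldLbar_eq_zero_of_notMem_tsupport a hp) hθζ 0
  obtain ⟨C₄, hC₄, h₄⟩ := nrm_mulZ_le ha.conjugate (-1)
  have hp := Real.pi_pos
  -- `L̄` has order one
  have bound : ∀ w : SF, nrm (-1) (opLbar a w) ≤ (2 + C₄) * nrm 0 w := by
    intro w
    have hD : ∀ j : Fin 3, nrm (-1) (Dc j w) ≤ nrm 0 w := fun j => by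
      rw [← one_mul (nrm 0 w)]
      refine norm_le_of_fourier_le fun ξ => ?_
      rw [norm_fourier_J_apply, norm_fourier_J_apply, fourier_Dc_apply, wt_zero, norm_mul, norm_mul,
        one_mul, one_mul, Complex.norm_real, Real.norm_eq_abs, ← mul_assoc]
      have n1 : ‖(2 * Real.pi * Complex.I : ℂ)‖ = 2 * Real.pi := by simp [abs_of_pos hp]
      rw [n1]
      have h5 : 2 * Real.pi * |ξ j| ≤ wt 1 1 ξ := by
        refine le_trans ?_ (norm_scaleFreq_le_wt 1 ξ)
        rw [scaleFreq_one]
        gcongr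
        exact PiLp.norm_apply_le ξ j
      have h6 : wt 1 (-1) ξ * wt 1 1 ξ = 1 := by rw [wt_mul]; simp
      have h7 := wt_pos 1 (-1) ξ
      have h8 : wt 1 (-1) ξ * (2 * Real.pi * |ξ j|) ≤ 1 :=
        (mul_le_mul_of_nonneg_left h5 h7.le).trans h6.le
      calc _ ≤ 1 * ‖𝓕 w ξ‖ := by gcongr
        _ = _ := one_mul _
    have t1 := nrm_add_le (-1) (opDzbar w) (Complex.I • mulZ (fun z => conj (a z)) (Dc 2 w))
    have t2 := nrm_add_le (-1) (Dc 0 w) (Complex.I • Dc 1 w)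
    have t3 := (h₄ (Dc 2 w)).trans (mul_le_mul_of_nonneg_left (hD 2) hC₄)
    rw [nrm_smul, Complex.norm_I, one_mul] at t1 t2
    have t4 : nrm (-1) (opDzbar w) ≤ nrm (-1) (Dc 0 w + Complex.I • Dc 1 w) := by
      rw [opDzbar_apply, nrm_smul]
      have h9 := nrm_nonneg (-1) (Dc 0 w + Complex.I • Dc 1 w)
      have h10 : ‖(1 / 2 : ℂ)‖ = 1 / 2 := by simp
      rw [h10]; linarith
    rw [opLbar]
    linarith [hD 0, hD 1]
  refine ⟨(2 + C₄) * C₁ + C₂ + C₃, by positivity, fun u hu => ?_⟩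
  have hLbu := contDiff_fieldLbar ha.smooth hu
  have hzu : ContDiff ℝ ∞ fun p => conj (zc p) * u p := contDiff_conj_zc.mul hu
  have e : cut θ u = opLbar a (mulZbar (cut θ u)) -
      (cut (fun p => conj (zc p) * θ p) (fieldLbar a u)
        + cut (fieldLbar a θ) (fun p => conj (zc p) * u p)) := by
    rw [opLbar_mulZbar ha.hasTemperateGrowth, opLbar_cut ha hθ hu, map_add, mulZbar_cut hθ hLbu,
      mulZbar_cut' (hθ.fieldLbar ha.smooth) hu]
    abel
  obtain ⟨N, hN⟩ : ∃ N, N = dataNorm a s ζ u + nrm 0 (mulZbar (cut ζ u)) := ⟨_, rfl⟩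
  rw [← hN]
  have p1 := nrm_nonneg s (cut ζ (fieldLbar a u))
  have p2 := nrm_nonneg s (cut ζ (fun p => conj (zc p) * fieldL a u p))
  have p3 := nrm_nonneg 0 (mulZbar (cut ζ u))
  have N1 : nrm s (cut ζ (fieldLbar a u)) ≤ N := by rw [hN, dataNorm]; linarith
  have N2 : nrm 0 (mulZbar (cut ζ u)) ≤ N := by rw [hN, dataNorm]; linarith
  rw [mulZbar_cut' hζ hu] at N2
  have r1 : nrm s (opLbar a (mulZbar (cut θ u))) ≤ (2 + C₄) * C₁ * N := by
    refine (nrm_mono hs _).trans ((bound _).trans ?_)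
    rw [mul_assoc, mulZbar_cut' hθ hu]
    exact mul_le_mul_of_nonneg_left
      ((h₁ _ hzu).trans (mul_le_mul_of_nonneg_left N2 hC₁)) (by positivity)
  have r2 := (h₂ _ hLbu).trans (mul_le_mul_of_nonneg_left N1 hC₂)
  have r3 := (nrm_mono (by linarith : s ≤ 0) (cut (fieldLbar a θ) fun p => conj (zc p) * u p)).trans
    ((h₃ _ hzu).trans (mul_le_mul_of_nonneg_left N2 hC₃))
  rw [e]
  refine (nrm_sub_le _ _ _).trans ?_
  linarith [nrm_add_le s (cut (fun p => conj (zc p) * θ p) (fieldLbar a u))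
    (cut (fieldLbar a θ) fun p => conj (zc p) * u p)]

/-! ### Functions dominated by the Levi form -/

lemma fderiv_conj_comp {a : ℂ → ℂ} {z : ℂ} (ha : DifferentiableAt ℝ a z) (v : ℂ) :
    fderiv ℝ (fun w => conj (a w)) z v = conj (fderiv ℝ a z v) := by
  have h : HasFDerivAt (fun w => conj (a w))
      ((Complex.conjCLE.toContinuousLinearMap).comp (fderiv ℝ a z)) z :=
    (Complex.conjCLE.toContinuousLinearMap.hasFDerivAt).comp z ha.hasFDerivAt
  rw [h.fderiv]
  simp

lemma dzbar_eq_conj_dz {a : ℂ → ℂ} {z : ℂ} (ha : DifferentiableAt ℝ a z) :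
    dzbar a z = conj (dz (fun w => conj (a w)) z) := by
  rw [dz, dzbar, fderiv_conj_comp ha, fderiv_conj_comp ha]
  simp [map_ofNat]

lemma re_levi {a : ℂ → ℂ} {z : ℂ} (ha : DifferentiableAt ℝ a z) :
    (levi a z).re = 2 * (dz (fun w => conj (a w)) z).re := by
  rw [levi, dzbar_eq_conj_dz ha, Complex.add_re, Complex.conj_re]
  ring

lemma conj_g1 {g : ℂ → ℝ} {z : ℂ} (hg : DifferentiableAt ℝ g z) :
    conj (g1 g z) = dzbar (fun w => (g w : ℂ)) z := by
  have h : DifferentiableAt ℝ (fun w => (g w : ℂ)) z :=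
    Complex.ofRealCLM.differentiableAt.comp z hg
  rw [dzbar_eq_conj_dz h, g1]
  simp

lemma dz_congr {f h : ℂ → ℂ} {z : ℂ} (H : f =ᶠ[𝓝 z] h) : dz f z = dz h z := by
  rw [dz, dz, H.fderiv_eq]

/-- The Levi form of an extension of `g₁`. As `g` is real, `conj g₁ = ∂_{z̄} g`. -/
lemma re_levi_of_eventuallyEq {a : ℂ → ℂ} {g : ℂ → ℝ} {z : ℂ} (ha : DifferentiableAt ℝ a z)
    (hg : ∀ᶠ w in 𝓝 z, DifferentiableAt ℝ g w) (h : a =ᶠ[𝓝 z] g1 g) :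
    (levi a z).re = 2 * g11 g z := by
  rw [re_levi ha, g11]
  congr 2
  refine dz_congr ?_
  filter_upwards [hg, h] with w h1 h2
  rw [h2, conj_g1 h1]

lemma contDiffAt_g1 {Ω : Set ℂ} (hΩ : IsOpen Ω) {g : ℂ → ℝ} (hg : ContDiffOn ℝ ∞ g Ω) {z : ℂ}
    (hz : z ∈ Ω) : ContDiffAt ℝ ∞ (g1 g) z := by
  have h1 : ContDiffAt ℝ ∞ (fun w => (g w : ℂ)) z :=
    Complex.ofRealCLM.contDiff.contDiffAt.comp z (hg.contDiffAt (hΩ.mem_nhds hz))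
  have h2 : ContDiffAt ℝ ∞ (fderiv ℝ fun w => (g w : ℂ)) z := h1.fderiv_right (by simp)
  exact contDiffAt_const.mul ((h2.clm_apply contDiffAt_const).sub
    (contDiffAt_const.mul (h2.clm_apply contDiffAt_const)))

lemma isTest_ofReal {E : Type*} [NormedAddCommGroup E] [NormedSpace ℝ E] {f : E → ℝ}
    (hf : ContDiff ℝ ∞ f) (hc : HasCompactSupport f) : IsTest fun x => (f x : ℂ) :=
  ⟨Complex.ofRealCLM.contDiff.comp hf, hc.comp_left Complex.ofReal_zero⟩

lemma ContDiffBump.isTest {E : Type*} [NormedAddCommGroup E] [InnerProductSpace ℝ E]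
    [FiniteDimensional ℝ E] {c : E} (f : ContDiffBump c) : IsTest fun x => (f x : ℂ) :=
  isTest_ofReal f.contDiff f.hasCompactSupport

lemma bump_eq_one {r : ℝ} (f : ContDiffBump (0 : ℂ)) (hf : f.rIn = r) {z : ℂ} (hz : ‖z‖ ≤ r) :
    f z = 1 :=
  f.one_of_mem_closedBall (by simpa [hf] using hz)

lemma bump_eq_zero {r : ℝ} (f : ContDiffBump (0 : ℂ)) (hf : f.rOut = r) {z : ℂ} (hz : r ≤ ‖z‖) :
    f z = 0 :=
  f.zero_of_le_dist (by simpa [hf] using hz)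

lemma isLeviBounded_of_le {a f : ℂ → ℂ} (hf : IsTest f) {r : ℝ} (hr : 0 < r)
    (h0 : ∀ z, 2 * r ≤ ‖z‖ → f z = 0) {K : ℝ} (hK : 0 ≤ K)
    (H : ∀ z, ‖z‖ < 3 * r → ‖f z‖ ^ 2 ≤ K * (levi a z).re) : IsLeviBounded a f := by
  let χ : ContDiffBump (0 : ℂ) := ⟨2 * r, 3 * r, by positivity, by linarith⟩
  refine ⟨hf, fun z => (χ z : ℂ), ContDiffBump.isTest χ, fun z => ?_, K, hK, fun z hz => ?_⟩
  · rcases le_total ‖z‖ (2 * r) with h | h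
    · simp [bump_eq_one χ rfl h]
    · rw [h0 z h, zero_mul]
  · refine H z (lt_of_not_ge fun h => hz ?_)
    simp [bump_eq_zero χ rfl h]

/-- Extension of `g₁` from a neighbourhood of `0` to a test function `a`, with the cut-offs in `z`
which are dominated by the Levi form: those which vanish at `0`, and those with the factor `a`. -/
theorem exists_extension {Ω : Set ℂ} (hΩ : IsOpen Ω) (h0 : (0 : ℂ) ∈ Ω)
    {g : ℂ → ℝ} (hg : ContDiffOn ℝ ∞ g Ω) (hz : g11 g 0 = 0)
    (hpos : ∀ᶠ z : ℂ in 𝓝[≠] 0, 0 < g11 g z)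
    (hg1 : g1 g =O[𝓝 0] fun z : ℂ => √(g11 g z)) :
    ∃ r : ℝ, 0 < r ∧ ∃ a b₁ : ℂ → ℂ, IsTest a ∧ (∀ z, ‖z‖ < r → a z = g1 g z) ∧
      (∀ z, ‖z‖ < r → b₁ z = 1) ∧ IsLeviBounded a (fun z => a z * b₁ z) ∧
      IsLeviBounded a (fun z => conj (a z) * b₁ z) ∧
      ∀ ρ : ℝ, 0 < ρ → ∃ b₀ : ℂ → ℂ, IsLeviBounded a b₀ ∧
        ∀ z, ρ ≤ ‖z‖ → ‖z‖ < r → b₀ z = 1 := by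
  obtain ⟨c, hc⟩ := hg1.bound
  rw [eventually_nhdsWithin_iff] at hpos
  obtain ⟨δ, hδ, hball⟩ := Metric.eventually_nhds_iff.1 ((hΩ.eventually_mem h0).and
    (hc.and hpos))
  obtain ⟨r, hr, hrδ⟩ : ∃ r : ℝ, 0 < r ∧ 4 * r < δ := ⟨δ / 5, by positivity, by linarith⟩
  have hΩr : ∀ z : ℂ, ‖z‖ ≤ 4 * r → z ∈ Ω := fun z hz =>
    (hball (by rw [dist_zero_right]; linarith)).1
  have hcr : ∀ z : ℂ, ‖z‖ ≤ 4 * r → ‖g1 g z‖ ≤ c * ‖√(g11 g z)‖ := fun z hz =>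
    (hball (by rw [dist_zero_right]; linarith)).2.1
  have hpr : ∀ z : ℂ, ‖z‖ ≤ 4 * r → z ≠ 0 → 0 < g11 g z := fun z hz hz0 =>
    (hball (by rw [dist_zero_right]; linarith)).2.2 hz0
  have hnn : ∀ z : ℂ, ‖z‖ ≤ 4 * r → 0 ≤ g11 g z := fun z h => by
    rcases eq_or_ne z 0 with rfl | h'
    · exact hz.ge
    · exact (hpr z h h').le
  have hdiff : ∀ z ∈ Ω, DifferentiableAt ℝ g z := fun z h =>
    (hg.contDiffAt (hΩ.mem_nhds h)).differentiableAt (by simp)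
  let ψ : ContDiffBump (0 : ℂ) := ⟨3 * r, 4 * r, by positivity, by linarith⟩
  let φ : ContDiffBump (0 : ℂ) := ⟨r, 2 * r, hr, by linarith⟩
  obtain ⟨a, ha_def⟩ : ∃ a : ℂ → ℂ, a = fun z => (ψ z : ℂ) * g1 g z := ⟨_, rfl⟩
  have ha1 : ∀ z, ‖z‖ ≤ 3 * r → a z = g1 g z := fun z h => by
    rw [ha_def]; simp [bump_eq_one ψ rfl h]
  have ha : IsTest a := by
    refine ⟨contDiff_iff_contDiffAt.2 fun z => ?_, ?_⟩
    · by_cases h : z ∈ tsupport ψ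
      · rw [ha_def]
        refine (ContDiffBump.isTest ψ).smooth.contDiffAt.mul (contDiffAt_g1 hΩ hg (hΩr z ?_))
        rw [ψ.tsupport_eq] at h
        simpa using h
      · have h' := notMem_tsupport_iff_eventuallyEq.1 h
        refine (contDiffAt_const (c := (0 : ℂ))).congr_of_eventuallyEq ?_
        filter_upwards [h'] with w hw
        simp [ha_def, hw]
    · rw [ha_def]
      exact (ContDiffBump.isTest ψ).compact.mul_right
  have hlevi : ∀ z : ℂ, ‖z‖ < 3 * r → (levi a z).re = 2 * g11 g z := fun z h => by
    refine re_levi_of_eventuallyEq (ha.smooth.differentiable (by simp) z) ?_ ?_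
    · filter_upwards [hΩ.mem_nhds (hΩr z (by linarith))] with w hw using hdiff w hw
    · have : ∀ᶠ w : ℂ in 𝓝 z, ‖w‖ < 3 * r := continuous_norm.continuousAt.eventually_lt
        continuousAt_const h
      filter_upwards [this] with w hw using ha1 w hw.le
  have hb : IsTest fun z => (φ z : ℂ) := ContDiffBump.isTest φ
  have hb0 : ∀ z, 2 * r ≤ ‖z‖ → (φ z : ℂ) = 0 := fun z h => by
    rw [bump_eq_zero φ rfl h]; simp
  have hble : ∀ z, ‖(φ z : ℂ)‖ ≤ 1 := fun z => by
    rw [Complex.norm_real, Real.norm_of_nonneg φ.nonneg]; exact φ.le_one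
  have hab : ∀ z, ‖z‖ < 3 * r → (‖a z‖ * ‖(φ z : ℂ)‖) ^ 2 ≤ c ^ 2 * (levi a z).re := fun z h => by
    have h1 := hnn z (by linarith)
    have h2 := hcr z (by linarith)
    rw [Real.norm_of_nonneg (Real.sqrt_nonneg _)] at h2
    rw [hlevi z h, ha1 z h.le]
    calc (‖g1 g z‖ * ‖(φ z : ℂ)‖) ^ 2 ≤ (‖g1 g z‖ * 1) ^ 2 := by gcongr; exact hble z
      _ ≤ (c * √(g11 g z)) ^ 2 := by rw [mul_one]; gcongr
      _ = c ^ 2 * g11 g z := by rw [mul_pow, Real.sq_sqrt h1]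
      _ ≤ c ^ 2 * (2 * g11 g z) := by gcongr; linarith
  refine ⟨r, hr, a, fun z => (φ z : ℂ), ha, fun z h => ha1 z (by linarith), fun z h => ?_, ?_, ?_,
    fun ρ hρ => ?_⟩
  · simp [bump_eq_one φ rfl h.le]
  · refine isLeviBounded_of_le (ha.mul_right hb.smooth) hr
      (fun z h => by simp only [hb0 z h, mul_zero]) (sq_nonneg c) fun z h => ?_
    rw [norm_mul]; exact hab z h
  · refine isLeviBounded_of_le (ha.conjugate.mul_right hb.smooth) hr
      (fun z h => by simp only [hb0 z h, mul_zero]) (sq_nonneg c) fun z h => ?_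
    rw [norm_mul, RCLike.norm_conj]; exact hab z h
  · let η : ContDiffBump (0 : ℂ) := ⟨ρ / 2, ρ, by positivity, by linarith⟩
    have hη : ContDiff ℝ ∞ fun z => 1 - (η z : ℂ) :=
      contDiff_const.sub (ContDiffBump.isTest η).smooth
    have hcomp : IsCompact (Metric.closedBall (0 : ℂ) (2 * r) \ Metric.ball 0 (ρ / 2)) :=
      (isCompact_closedBall _ _).diff Metric.isOpen_ball
    obtain ⟨m, hm, hmle⟩ := hcomp.exists_forall_le' (f := fun z => (levi a z).re) (a := 0)
      (Complex.continuous_re.comp ha.levi.smooth.continuous).continuousOn (fun z hz' => by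
        have h1 : ‖z‖ ≤ 2 * r := by simpa using hz'.1
        have h2 : ρ / 2 ≤ ‖z‖ := by simpa using hz'.2
        have h3 := hpr z (by linarith) (norm_pos_iff.1 (by linarith))
        rw [hlevi z (by linarith)]; linarith)
    refine ⟨fun z => (φ z : ℂ) * (1 - (η z : ℂ)), isLeviBounded_of_le (hb.mul_right hη) hr
      (fun z h => by simp only [hb0 z h, zero_mul]) (inv_nonneg.2 hm.le) fun z h => ?_,
      fun z h1 h2 => ?_⟩
    · have hl : 0 ≤ (levi a z).re := by
        rw [hlevi z h]; linarith [hnn z (by linarith)]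
      rcases le_total ‖z‖ (ρ / 2) with h' | h'
      · rw [bump_eq_one η rfl h']
        simpa using mul_nonneg (inv_nonneg.2 hm.le) hl
      rcases le_total (2 * r) ‖z‖ with h'' | h''
      · rw [hb0 z h'']
        simpa using mul_nonneg (inv_nonneg.2 hm.le) hl
      · have h3 := hmle z ⟨by simpa using h'', by simpa using h'⟩
        have h4 : ‖(1 - (η z : ℂ))‖ ≤ 1 := by
          have : (1 - (η z : ℂ)) = ((1 - η z : ℝ) : ℂ) := by push_cast; rfl
          rw [this, Complex.norm_real, Real.norm_of_nonneg (by linarith [η.le_one (x := z)])]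
          linarith [η.nonneg (x := z)]
        calc ‖(φ z : ℂ) * (1 - (η z : ℂ))‖ ^ 2 ≤ (1 * 1) ^ 2 := by
              rw [norm_mul]; gcongr; exact hble z
          _ = m⁻¹ * m := by rw [inv_mul_cancel₀ hm.ne']; norm_num
          _ ≤ _ := by gcongr
    · simp [bump_eq_one φ rfl h2.le, bump_eq_zero η rfl h1]

/-! ### Induction on the Sobolev order -/

lemma exists_isTest_eq_one {E : Type*} [NormedAddCommGroup E] [InnerProductSpace ℝ E]
    [FiniteDimensional ℝ E] {K V : Set E} (hK : IsCompact K) (hV : IsOpen V) (hKV : K ⊆ V) :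
    ∃ β : E → ℂ, IsTest β ∧ (∀ᶠ x in 𝓝ˢ K, β x = 1) ∧ tsupport β ⊆ V := by
  obtain ⟨K', hK', hKK', hK'V⟩ := exists_compact_between hK hV hKV
  obtain ⟨f, h1, h0, -⟩ := exists_contMDiffMap_one_nhds_of_subset_interior (n := (⊤ : ℕ∞))
    (modelWithCornersSelf ℝ E) hK.isClosed hKK'
  have hts : tsupport (f : E → ℝ) ⊆ K' := closure_minimal (fun x hx => by
    by_contra h
    exact hx (h0 x h)) hK'.isClosed
  refine ⟨fun x => (f x : ℂ), isTest_ofReal f.contMDiff.contDiff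
    (hK'.of_isClosed_subset (isClosed_tsupport _) hts), ?_, ?_⟩
  · filter_upwards [h1] with x hx
    rw [hx, Complex.ofReal_one]
  · exact ((closure_mono (Function.support_comp_subset Complex.ofReal_zero f)).trans
      hts).trans hK'V

/-- The point `(0, t)`. -/
def vertical (t : ℝ) : R3 := EuclideanSpace.single 2 t

lemma continuous_vertical : Continuous vertical := by
  have : vertical = fun t => t • (EuclideanSpace.single 2 (1 : ℝ) : R3) := by
    ext t j; simp [vertical]
  rw [this]
  fun_prop

lemma norm_sub_vertical (p : R3) : ‖p - vertical (p 2)‖ = ‖zc p‖ := by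
  have h : ‖p - vertical (p 2)‖ ^ 2 = ‖zc p‖ ^ 2 := by
    rw [norm_sq_R3, Complex.sq_norm, Complex.normSq_apply]
    simp [vertical, zc]
    ring
  exact (pow_left_inj₀ (norm_nonneg _) (norm_nonneg _) two_ne_zero).1 h

lemma eq_vertical {p : R3} (h : zc p = 0) : p = vertical (p 2) := by
  rw [← sub_eq_zero, ← norm_eq_zero, norm_sub_vertical, h, norm_zero]

lemma pd_eq_zero_of_eventuallyEq {β : R3 → ℂ} {τ : ℝ → ℂ} (hτ : Differentiable ℝ τ) {p : R3}
    (h : β =ᶠ[𝓝 p] fun q => τ (q 2)) {j : Fin 3} (hj : j ≠ 2) : pd j β p = 0 := by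
  have h1 : HasFDerivAt (fun q : R3 => τ (q 2))
      ((fderiv ℝ τ (p 2)).comp (EuclideanSpace.proj (2 : Fin 3) : R3 →L[ℝ] ℝ)) p :=
    (hτ (p 2)).hasFDerivAt.comp p (EuclideanSpace.proj (2 : Fin 3) : R3 →L[ℝ] ℝ).hasFDerivAt
  rw [pd, h.fderiv_eq, h1.fderiv]
  simp [hj.symm]

/-- Cut-offs which depend only on `t` when `z` is small. -/
theorem exists_cutoff_flat {K V : Set R3} (hK : IsCompact K) (hV : IsOpen V) (hKV : K ⊆ V) :
    ∃ β : R3 → ℂ, IsTest β ∧ (∀ p ∈ K, β p = 1) ∧ tsupport β ⊆ V ∧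
      ∃ ρ : ℝ, 0 < ρ ∧ ∀ p, ‖zc p‖ < ρ → pd 0 β p = 0 ∧ pd 1 β p = 0 := by
  have hco : Continuous fun p : R3 => p 2 := (EuclideanSpace.proj (2 : Fin 3)).continuous
  have hcz : Continuous zc := contDiff_zc.continuous
  obtain ⟨η, hη, hη1, hηV⟩ := exists_isTest_eq_one hK hV hKV
  -- The slice of `K` over `z = 0`.
  have hK0 : IsCompact ((fun p : R3 => p 2) '' (K ∩ {p | zc p = 0})) :=
    (hK.inter_right (isClosed_eq hcz continuous_const)).image hco
  obtain ⟨τ, hτ, hτ1, hτV⟩ := exists_isTest_eq_one hK0 (hV.preimage continuous_vertical) (by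
    rintro _ ⟨p, ⟨hp, hp0⟩, rfl⟩
    rw [Set.mem_preimage, ← eq_vertical hp0]
    exact hKV hp)
  obtain ⟨T, hT, hKT, hT1⟩ := eventually_nhdsSet_iff_exists.1 hτ1
  obtain ⟨ρ₁, hρ₁, h₁⟩ : ∃ ρ, 0 < ρ ∧ ∀ p ∈ K, ‖zc p‖ < ρ → τ (p 2) = 1 := by
    have hc : IsCompact (K \ (fun p : R3 => p 2) ⁻¹' T) := hK.diff (hT.preimage hco)
    obtain ⟨m, hm, h⟩ := hc.exists_forall_le' (f := fun p => ‖zc p‖) (a := 0)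
      hcz.norm.continuousOn fun p hp => norm_pos_iff.2 fun h0 => hp.2 (hKT ⟨p, ⟨hp.1, h0⟩, rfl⟩)
    refine ⟨m, hm, fun p hp hpm => hT1 _ ?_⟩
    by_contra hpT
    exact absurd (h p ⟨hp, hpT⟩) (not_le.2 hpm)
  have hS : IsCompact (vertical '' tsupport τ) := hτ.compact.isCompact.image continuous_vertical
  obtain ⟨ρ₂, hρ₂, h₂⟩ := hS.exists_cthickening_subset_open hV (Set.image_subset_iff.2 hτV)
  obtain ⟨ρ, hρ, hle₁, hle₂⟩ : ∃ ρ, 0 < ρ ∧ ρ ≤ ρ₁ ∧ ρ ≤ ρ₂ :=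
    ⟨min ρ₁ ρ₂, lt_min hρ₁ hρ₂, min_le_left _ _, min_le_right _ _⟩
  -- The cut-off is `φ(z) τ(t) + (1 - φ(z)) η`, and `τ = 1` on the part of `K` where `‖z‖ < ρ`.
  let φ : ContDiffBump (0 : ℂ) := ⟨ρ / 2, ρ, by positivity, by linarith⟩
  have hφs : ContDiff ℝ ∞ fun p : R3 => (φ (zc p) : ℂ) :=
    (ContDiffBump.isTest φ).smooth.comp contDiff_zc
  have hsub : Function.support
      (fun p : R3 => (φ (zc p) : ℂ) * τ (p 2) + (1 - (φ (zc p) : ℂ)) * η p) ⊆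
        Metric.cthickening ρ₂ (vertical '' tsupport τ) ∪ tsupport η := by
    intro p hp
    by_contra hc
    rw [Set.mem_union, not_or] at hc
    refine hp ?_
    have e1 : η p = 0 := image_eq_zero_of_notMem_tsupport hc.2
    have e2 : (φ (zc p) : ℂ) * τ (p 2) = 0 := by
      by_contra hne
      rw [mul_eq_zero, not_or] at hne
      refine hc.1 (Metric.mem_cthickening_of_dist_le p (vertical (p 2)) _ _
        (Set.mem_image_of_mem _ (subset_tsupport _ hne.2)) ?_)
      rw [dist_eq_norm, norm_sub_vertical]
      refine le_trans (le_of_not_ge fun h => hne.1 ?_) hle₂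
      simp [bump_eq_zero φ rfl h]
    simp only [e1, e2, mul_zero, add_zero]
  have hcl := closure_minimal hsub (hS.cthickening.isClosed.union (isClosed_tsupport η))
  refine ⟨_, ⟨?_, ?_⟩, fun p hp => ?_, hcl.trans (Set.union_subset h₂ hηV), ρ / 2, by positivity,
    fun p hp => ?_⟩
  · exact (hφs.mul (hτ.smooth.comp (EuclideanSpace.proj (2 : Fin 3) : R3 →L[ℝ] ℝ).contDiff)).add
      ((contDiff_const.sub hφs).mul hη.smooth)
  · exact (hS.cthickening.union hη.compact).of_isClosed_subset (isClosed_tsupport _) hcl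
  · have e1 : η p = 1 := hη1.self_of_nhdsSet p hp
    rcases lt_or_ge ‖zc p‖ ρ with h | h
    · simp only [e1, h₁ p hp (h.trans_le hle₁)]; ring
    · simp [e1, bump_eq_zero φ rfl h]
  · have hev : (fun p : R3 => (φ (zc p) : ℂ) * τ (p 2) + (1 - (φ (zc p) : ℂ)) * η p)
        =ᶠ[𝓝 p] fun q => τ (q 2) := by
      filter_upwards [hcz.norm.continuousAt.eventually_lt continuousAt_const hp] with q hq
      simp [bump_eq_one φ rfl (le_of_lt hq)]
    have hd := hτ.smooth.differentiable (by simp)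
    exact ⟨pd_eq_zero_of_eventuallyEq hd hev (by decide),
      pd_eq_zero_of_eventuallyEq hd hev (by decide)⟩

/-- Comparison of two cut-offs, the larger of which does not vanish on the support of the other. -/
lemma exists_nrm_cut_le_of_ne_zero {θ ζ : R3 → ℂ} (hθ : IsTest θ) (hζ : IsTest ζ)
    (h : ∀ p ∈ tsupport θ, ζ p ≠ 0) (s : ℝ) :
    ∃ C : ℝ, 0 ≤ C ∧ ∀ u : R3 → ℂ, ContDiff ℝ ∞ u → nrm s (cut θ u) ≤ C * nrm s (cut ζ u) := by
  refine exists_nrm_cut_le (ρ := fun p => θ p / ζ p) ⟨contDiff_iff_contDiffAt.2 fun p => ?_, ?_⟩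
    hζ (fun p => ?_) s
  · by_cases hp : p ∈ tsupport θ
    · simp only [div_eq_mul_inv]
      exact hθ.smooth.contDiffAt.mul (hζ.smooth.contDiffAt.inv (h p hp))
    · refine (contDiffAt_const (c := (0 : ℂ))).congr_of_eventuallyEq ?_
      filter_upwards [notMem_tsupport_iff_eventuallyEq.1 hp] with q hq
      simp [hq]
  · exact hasCompactSupport_of_tsupport hθ fun p hp => by
      rw [image_eq_zero_of_notMem_tsupport hp, zero_div]
  · by_cases hp : p ∈ tsupport θ
    · rw [div_mul_cancel₀ _ (h p hp)]
    · rw [image_eq_zero_of_notMem_tsupport hp, zero_div, zero_mul]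

/-- The a priori estimate for cut-offs supported in `‖z‖ < r`, by induction on the order `s` in
steps of `1/2`. Since `ζ ≠ 0` is an open condition, there is room for intermediate cut-offs. -/
theorem exists_nrm_cut_le_dataNorm {r : ℝ} {a b₁ : ℂ → ℂ} (ha : IsTest a)
    (hb1 : ∀ z, ‖z‖ < r → b₁ z = 1) (hb₁ : IsLeviBounded a fun z => a z * b₁ z)
    (hb₁' : IsLeviBounded a fun z => conj (a z) * b₁ z)
    (hb₀ : ∀ ρ : ℝ, 0 < ρ → ∃ b₀ : ℂ → ℂ, IsLeviBounded a b₀ ∧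
        ∀ z, ρ ≤ ‖z‖ → ‖z‖ < r → b₀ z = 1) (n : ℕ) :
    ∀ (s : ℝ), s ≤ n / 2 - 1 → ∀ θ ζ : R3 → ℂ, IsTest θ → IsTest ζ →
      (∀ p ∈ tsupport θ, ‖zc p‖ < r) → (∀ p ∈ tsupport θ, ζ p ≠ 0) →
      ∃ C : ℝ, 0 ≤ C ∧ ∀ u : R3 → ℂ, ContDiff ℝ ∞ u →
        nrm s (cut θ u) ≤ C * (dataNorm a s ζ u + nrm 0 (mulZbar (cut ζ u))) := by
  have hopen : IsOpen {p : R3 | ‖zc p‖ < r} :=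
    isOpen_lt contDiff_zc.continuous.norm continuous_const
  have hopen' : ∀ ζ : R3 → ℂ, IsTest ζ → IsOpen {p : R3 | ζ p ≠ 0} := fun ζ hζ =>
    isOpen_ne_fun hζ.smooth.continuous continuous_const
  -- The right-hand side is monotone with respect to the cut-off.
  have data : ∀ η ζ : R3 → ℂ, IsTest η → IsTest ζ → (∀ p ∈ tsupport η, ζ p ≠ 0) → ∀ s : ℝ,
      ∃ C : ℝ, 0 ≤ C ∧ ∀ u : R3 → ℂ, ContDiff ℝ ∞ u →
        dataNorm a s η u + nrm 0 (mulZbar (cut η u)) ≤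
          C * (dataNorm a s ζ u + nrm 0 (mulZbar (cut ζ u))) := by
    intro η ζ hη hζ h s
    obtain ⟨C₁, hC₁, h₁⟩ := exists_nrm_cut_le_of_ne_zero hη hζ h s
    obtain ⟨C₂, hC₂, h₂⟩ := exists_nrm_cut_le_of_ne_zero hη hζ h 0
    refine ⟨C₁ + C₂, by positivity, fun u hu => ?_⟩
    have t1 := h₁ _ (contDiff_fieldLbar ha.smooth hu)
    have t2 := h₁ _ (contDiff_conj_zc.mul (contDiff_fieldL ha.smooth hu))
    have t3 := h₂ _ (contDiff_conj_zc.mul hu)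
    rw [mulZbar_cut' hη hu, mulZbar_cut' hζ hu, dataNorm, dataNorm]
    have p1 := mul_nonneg hC₂ (nrm_nonneg s (cut ζ (fieldLbar a u)))
    have p2 := mul_nonneg hC₂ (nrm_nonneg s (cut ζ (fun p => conj (zc p) * fieldL a u p)))
    have p3 := mul_nonneg hC₁ (nrm_nonneg 0 (cut ζ (fun p => conj (zc p) * u p)))
    linarith
  induction n with
  | zero =>
    intro s hs θ ζ hθ hζ _ hθζ
    obtain ⟨η, hη, hη1, hηζ⟩ := exists_isTest_eq_one hθ.compact.isCompact (hopen' ζ hζ) hθζ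
    obtain ⟨C₁, hC₁, h₁⟩ := exists_nrm_cut_le_of_le_neg_one ha hθ hη
      (fun p hp => hη1.self_of_nhdsSet p hp) (s := s) (by simpa using hs)
    obtain ⟨C₂, hC₂, h₂⟩ := data η ζ hη hζ hηζ s
    refine ⟨C₁ * C₂, by positivity, fun u hu => (h₁ u hu).trans ?_⟩
    rw [mul_assoc]
    exact mul_le_mul_of_nonneg_left (h₂ u hu) hC₁
  | succ n ih =>
    intro s hs θ ζ hθ hζ hθr hθζ
    -- `θ ≺ β ≺ η ≺ ζ`
    obtain ⟨β, hβ, hβ1, hβV, ρ, hρ, hflat⟩ := exists_cutoff_flat hθ.compact.isCompact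
      (hopen.inter (hopen' ζ hζ)) fun p hp => ⟨hθr p hp, hθζ p hp⟩
    obtain ⟨η, hη, hη1, hηV⟩ := exists_isTest_eq_one hβ.compact.isCompact
      (hopen.inter (hopen' ζ hζ)) hβV
    obtain ⟨b₀, hb₀L, hb₀1⟩ := hb₀ ρ hρ
    have hor : ∀ j : Fin 3, (∀ p, ‖zc p‖ < ρ → pd j β p = 0) →
        ∀ p, b₀ (zc p) * pd j β p = pd j β p := fun j hj p => by
      by_cases hp : p ∈ tsupport β
      · rcases lt_or_ge ‖zc p‖ ρ with h | h
        · rw [hj p h, mul_zero]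
        · rw [hb₀1 _ h (hβV hp).1, one_mul]
      · rw [pd_eq_zero_of_notMem_tsupport j hp, mul_zero]
    obtain ⟨C₁, hC₁, h₁⟩ := exists_nrm_cut_le_of_subset (β := θ) hθ hβ
      (fun p hp => image_eq_zero_of_notMem_tsupport hp) hβ1 s
    obtain ⟨C₂, hC₂, h₂⟩ := exists_nrm_cut_le_half ha hb₀L hb₁ hb₁' hβ hη
      (fun p hp => hη1.self_of_nhdsSet p hp) (hor 0 fun p hp => (hflat p hp).1)
      (hor 1 fun p hp => (hflat p hp).2) (fun p => by
        by_cases hp : p ∈ tsupport β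
        · rw [hb1 _ (hβV hp).1, one_mul]
        · rw [pd_eq_zero_of_notMem_tsupport 2 hp, mul_zero]) s
    obtain ⟨C₃, hC₃, h₃⟩ := data η ζ hη hζ (fun p hp => (hηV hp).2) s
    obtain ⟨C₄, hC₄, h₄⟩ := ih (s - 1 / 2) (by push_cast at hs; linarith) η ζ hη hζ
      (fun p hp => (hηV hp).1) (fun p hp => (hηV hp).2)
    refine ⟨C₁ * (C₂ * (C₃ + C₄)), by positivity, fun u hu => (h₁ u hu).trans ?_⟩
    rw [mul_assoc]
    refine mul_le_mul_of_nonneg_left ((h₂ u hu).trans ?_) hC₁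
    rw [mul_assoc]
    refine mul_le_mul_of_nonneg_left ?_ hC₂
    have t3 := h₃ u hu
    have t4 := (h₄ u hu).trans (mul_le_mul_of_nonneg_left (add_le_add_left
      (dataNorm_mono a (by linarith : s - 1 / 2 ≤ s) ζ u) (nrm 0 (mulZbar (cut ζ u)))) hC₄)
    linarith [nrm_nonneg 0 (mulZbar (cut η u))]

/-! ### Sobolev norms of test functions -/

lemma eLpNorm_eq_ofReal_norm_toL2 (v : SF) :
    eLpNorm v 2 volume = ENNReal.ofReal ‖toL2 v‖ := by
  rw [toL2, SchwartzMap.toLpCLM_apply, SchwartzMap.norm_toLp,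
    ENNReal.ofReal_toReal (v.memLp 2 volume).eLpNorm_ne_top]

lemma sobolevNorm_eq_ofReal_nrm (s : ℝ) (v : SF) :
    sobolevNorm s v = ENNReal.ofReal (nrm s v) := by
  rw [nrm, ← norm_toL2_fourier, ← eLpNorm_eq_ofReal_norm_toL2, sobolevNorm]
  congr 1
  ext ξ
  rw [fourier_J_apply, wt, scaleFreq_one, SchwartzMap.fourier_coe]

lemma eLpNorm_cut_le {ζ u : R3 → ℂ} (hζ : IsTest ζ) (hu : ContDiff ℝ ∞ u) {M : ℝ≥0}
    (hM : ∀ p, ‖ζ p‖ ≤ M) : ENNReal.ofReal (nrm 0 (cut ζ u)) ≤ M * eLpNorm u 2 volume := by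
  rw [nrm, J_zero, ← eLpNorm_eq_ofReal_norm_toL2]
  refine (eLpNorm_le_nnreal_smul_eLpNorm_of_ae_le_mul (Eventually.of_forall fun p => ?_) 2).trans_eq
    (by rw [ENNReal.smul_def, smul_eq_mul])
  rw [cut_apply hζ hu, nnnorm_mul]
  gcongr
  exact hM p

lemma tsupport_ofReal_subset (ζ : R3 → ℝ) : tsupport (fun p => (ζ p : ℂ)) ⊆ tsupport ζ :=
  closure_mono (Function.support_comp_subset Complex.ofReal_zero ζ)

end

end LossDeriv

theorem theorem1p2 (Ω : Set ℂ) (hΩ : IsOpen Ω) (h0 : (0 : ℂ) ∈ Ω)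
    (g : ℂ → ℝ) (hg : ContDiffOn ℝ ∞ g Ω)
    -- infinite type at `0`: `g_{1 1̄}` vanishes to infinite order
    (hinf : ∀ n : ℕ, g11 g =O[𝓝 0] fun z : ℂ => ‖z‖ ^ n)
    -- exponential non-degeneracy; `log g_{1 1̄}` has to make sense near `0`
    (hpos : ∀ᶠ z : ℂ in 𝓝[≠] 0, 0 < g11 g z)
    (α : ℝ) (hα : α ≤ 1)
    (hlog : Tendsto (fun z : ℂ => ‖z‖ ^ α * |Real.log (g11 g z)|) (𝓝[≠] 0) (𝓝 0))
    -- the additional hypothesis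
    (hg1 : g1 g =O[𝓝 0] fun z : ℂ => √(g11 g z)) :
    ∃ U ∈ 𝓝 (0 : R3), ∀ (s : ℝ) (ζ₀ ζ₁ : R3 → ℝ), IsCutoff U ζ₀ → IsCutoff U ζ₁ →
      (∀ p ∈ tsupport ζ₀, ζ₁ p = 1) →
      ∃ C : ℝ≥0, ∀ u : R3 → ℂ, ContDiff ℝ ∞ u →
        sobolevNorm s (fun p => (ζ₀ p : ℂ) * u p) ≤
          C * (sobolevNorm s (fun p => (ζ₁ p : ℂ) * Lbar g u p)
            + sobolevNorm s (fun p => (ζ₁ p : ℂ) * (conj (zc p) * L g u p))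
            + eLpNorm (fun p => conj (zc p) * u p) 2 volume) := by
  -- the values at `0` matter too, since `=O[𝓝 0]` includes the point `0`
  have hz : g11 g 0 = 0 := by
    obtain ⟨c, hc⟩ := (hinf 1).bound
    simpa using hc.self_of_nhds
  obtain ⟨r, hr, a, b₁, ha, hag, hb1, hb₁, hb₁', hb₀⟩ := exists_extension hΩ h0 hg hz hpos hg1
  refine ⟨{p | ‖zc p‖ < r}, ?_, fun s ζ₀ ζ₁ hζ₀ hζ₁ h01 => ?_⟩
  · refine (isOpen_lt contDiff_zc.continuous.norm continuous_const).mem_nhds ?_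
    have : zc 0 = 0 := by rw [← zcL_apply, map_zero]
    simpa [this] using hr
  have hθ : IsTest fun p => (ζ₀ p : ℂ) := isTest_ofReal hζ₀.smooth hζ₀.compact
  have hζ : IsTest fun p => (ζ₁ p : ℂ) := isTest_ofReal hζ₁.smooth hζ₁.compact
  obtain ⟨n, hn⟩ := exists_nat_ge (2 * (s + 1))
  obtain ⟨C, hC, H⟩ := exists_nrm_cut_le_dataNorm ha hb1 hb₁ hb₁' hb₀ n s (by linarith) _ _ hθ hζ
    (fun p hp => hζ₀.support_subset (tsupport_ofReal_subset ζ₀ hp)) (fun p hp => by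
      rw [h01 p (tsupport_ofReal_subset ζ₀ hp)]; simp)
  obtain ⟨M₀, hM₀⟩ := hζ.compact.exists_bound_of_continuous hζ.smooth.continuous
  obtain ⟨M, hM1, hM⟩ : ∃ M : ℝ≥0, 1 ≤ M ∧ ∀ p, ‖(ζ₁ p : ℂ)‖ ≤ M :=
    ⟨max 1 M₀.toNNReal, le_max_left _ _, fun p => (hM₀ p).trans
      ((Real.le_coe_toNNReal M₀).trans (NNReal.coe_le_coe.2 (le_max_right _ _)))⟩
  refine ⟨C.toNNReal * M, fun u hu => ?_⟩
  have hag' : ∀ p, ζ₁ p ≠ 0 → a (zc p) = g1 g (zc p) := fun p hp =>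
    hag _ (hζ₁.support_subset (subset_tsupport _ hp))
  have hLu := contDiff_conj_zc.mul (contDiff_fieldL ha.smooth hu)
  have hLbu := contDiff_fieldLbar ha.smooth hu
  have hzu := contDiff_conj_zc.mul hu
  -- On the support of `ζ₁` the vector fields are those with the coefficient `a`.
  have e1 : (fun p => (ζ₁ p : ℂ) * Lbar g u p) = cut (fun p => (ζ₁ p : ℂ)) (fieldLbar a u) := by
    rw [cut_coe hζ hLbu]
    funext p
    by_cases hp : ζ₁ p = 0
    · simp [hp]
    · rw [fieldLbar, hag' p hp, Lbar]
  have e2 : (fun p => (ζ₁ p : ℂ) * (conj (zc p) * L g u p)) =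
      cut (fun p => (ζ₁ p : ℂ)) (fun p => conj (zc p) * fieldL a u p) := by
    rw [cut_coe hζ hLu]
    funext p
    by_cases hp : ζ₁ p = 0
    · simp [hp]
    · rw [fieldL, hag' p hp, L]
  rw [← cut_coe hθ hu, e1, e2, sobolevNorm_eq_ofReal_nrm, sobolevNorm_eq_ofReal_nrm,
    sobolevNorm_eq_ofReal_nrm]
  have hM1' : (1 : ℝ≥0∞) ≤ M := by exact_mod_cast hM1
  have t := H u hu
  rw [mulZbar_cut' hζ hu, dataNorm] at t
  refine (ENNReal.ofReal_le_ofReal t).trans ?_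
  rw [ENNReal.ofReal_mul hC, ENNReal.ofReal_add (add_nonneg (nrm_nonneg _ _) (nrm_nonneg _ _))
    (nrm_nonneg _ _), ENNReal.ofReal_add (nrm_nonneg _ _) (nrm_nonneg _ _), ENNReal.coe_mul,
    mul_assoc]
  refine mul_le_mul_right ?_ _
  rw [mul_add, mul_add]
  gcongr
  · exact le_mul_of_one_le_left' hM1'
  · exact le_mul_of_one_le_left' hM1'
  · exact eLpNorm_cut_le hζ hzu hM
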